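/- **Setting.** Let $d\ge 2$, let $\mathcal J$ be an index set, $\|\cdot\|$ the norm of $\ell_2$. For $w\in\ell_2(\mathcal J)$ put $\|w\|_{\mathcal A_s}:=\sup_{\varepsilon>0}\varepsilon\,[\min\{N:\exists v,\ \#\operatorname{supp}v\le N,\ \|w-v\|\le\varepsilon\}]^s$. For $v\in\ell_2(\mathcal J^d)$ let $\pi_j(v)[x]:=(\sum_{\lambda:\lambda_j=x}|v_\lambda|^2)^{1/2}$, $\operatorname{supp}_j(v):=\operatorname{supp}\pi_j(v)$, and let $R_\Lambda$ be the restriction to $\Lambda$ (extended by zero). Put $\operatorname{tail}(v,\Lambda):=(\sum_j\sum_{x\notin\Lambda_j}|\pi_j(v)[x]|^2)^{1/2}$ for $\Lambda=\Lambda_1\times\dots\times\Lambda_d$. *Operator.* Let $\omega_{j,x}>0$ be weights ($H^1$-norms of one-dimensional wavelets), $t_\lambda:=\sum_j\omega_{j,\lambda_j}^2\ge1$, $\boldsymbol D:=\operatorname{diag}(t_\lambda^{1/2})$. For $\delta\in(0,1)$ let $0<h<\pi^2/(5(|\ln(\delta/2)|+4))$, $n^+\ge h^{-1}\max\{4/\sqrt\pi,\sqrt{|\ln(\delta/2)|}\}$,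 $\varphi_n(t):=\sum_{k=-n}^{n^+}h\frac{2}{\sqrt\pi}(1+e^{-kh})^{-1}e^{-t\ln^2(1+e^{kh})}$; $\boldsymbol S^{-1}(\delta,\eta)$ is the diagonal matrix with entries $\varphi_n(t_\lambda)$, where $n\ge h^{-1}(\ln\frac2{\sqrt\pi}+|\ln\min\{\delta/2,\eta\}|+\frac12\ln T)$ and $T>1$ bounds $t_\lambda$ on the indices that occur; $\boldsymbol S^{-1}(\delta)$ has entries $\varphi_\infty(t_\lambda)$. Let $\boldsymbol A=\sum_{n=1}^R\bigotimes_{j=1}^d\boldsymbol A_{n,j}$. Let $a_{n,j},b_{n,j}\in\{0,1\}$ be the orders of differentiation of test and trial functions, $\sum_ja_{n,j}\le1$, $\sum_jb_{n,j}\le1$, and assume that the scaled components $\hat{\boldsymbol A}_{n,j}:=(\omega_{j,x}^{-a_{n,j}}(\boldsymbol A_{n,j})_{xy}\,\omega_{j,y}^{-b_{n,j}})_{x,y}$ are bounded on $\ell_2(\mathcal J)$ and $s^*$-compressible: for each $0<s<s^*$ there are matrices $\hat{\boldsymbol A}_{n,j,[p]}$, $p\ge0$, with at most $\alpha_p2^p$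 nonzero entries per row and column and $\|\hat{\boldsymbol A}_{n,j}-\hat{\boldsymbol A}_{n,j,[p]}\|\le\beta_p2^{-sp}$, where $(\alpha_p),(\beta_p)$ are positive and summable. Assume that $\boldsymbol A^\delta:=\boldsymbol S^{-1}(\delta)\boldsymbol A\boldsymbol S^{-1}(\delta)$ is bounded and symmetric on $\ell_2(\mathcal J^d)$ with $\lambda_{\min}\|v\|^2\le\langle v,\boldsymbol A^\delta v\rangle\le\lambda_{\max}\|v\|^2$, $0<\lambda_{\min}\le\lambda_{\max}$; put $\kappa:=\lambda_{\max}/\lambda_{\min}$, $\boldsymbol f^\delta:=\boldsymbol S^{-1}(\delta)\boldsymbol f\in\ell_2(\mathcal J^d)$ and $\boldsymbol A^\delta\boldsymbol u^\delta=\boldsymbol f^\delta$. *Algorithm (HT-AWGM)*, with parameters $\omega_0,\dots,\omega_5>0$, $\omega_0\ge\|\boldsymbol f^\delta\|$, $\alpha\in(0,1)$, $M\in\mathbb N$, a finite product set $\Lambda^{(0,0)}\neq\emptyset$, a binary dimension tree, and target tolerance $\varepsilon>0$. Start with $\boldsymbol u^{(0,0)}=0$, $\|\boldsymbol r^{(0,0)}\|:=\omega_0$,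 and put $\omega_0^{(k)}:=(\omega_3+\omega_4+\omega_5)^k\omega_0$. In step $(k,m)$: (i) $\boldsymbol u^{(k,m+1)}$ is obtained by the truncated CG method for the Galerkin system on $\Lambda^{(k,m)}$, started at $\boldsymbol u^{(k,m)}$ and stopped once the Galerkin residual is $\le\omega_2\|\boldsymbol r^{(k,m)}\|$; (ii) $\boldsymbol r^{(k,m+1)}=\mathbf{RES}(\boldsymbol u^{(k,m+1)})$; (iii) if $(1+\omega_1)\|\boldsymbol r^{(k,m+1)}\|\le\varepsilon$, stop; (iv) if $(1+\omega_1)\|\boldsymbol r^{(k,m+1)}\|\le\omega_3\omega_0^{(k)}$ or $m=M$, then $\boldsymbol u^{(k+1,0)}:=\mathcal C(\mathcal T(\boldsymbol u^{(k,m+1)},\omega_4\lambda_{\min}^{-1}\omega_0^{(k)}),\omega_5\lambda_{\min}^{-1}\omega_0^{(k)})$, $\Lambda^{(k+1,0)}_j:=\operatorname{supp}_j(\boldsymbol u^{(k+1,0)})$, $\boldsymbol r^{(k+1,0)}:=\mathbf{RES}(\boldsymbol u^{(k+1,0)})$, and continue with $(k+1,0)$; (v) otherwise $\Lambda_j^{(k,m+1)}:=\Lambda_j^{(k,m)}\cup\Gamma_j$,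 where $\Gamma$ is a coarse set of $\boldsymbol r^{(k,m+1)}$ for the tolerance $\sqrt{1-\alpha^2}\,\|\boldsymbol r^{(k,m+1)}\|$, and continue with $(k,m+1)$. Here: - a coarse set of $v$ for the tolerance $\epsilon$ is a product set $\Lambda$ with $\operatorname{tail}(v,\Lambda)\le\epsilon$ whose total size $\sum_j\#\Lambda_j$ is minimal up to a fixed factor $K\ge1$, and $\mathcal C(v,\epsilon)=R_\Lambda v$ for such a $\Lambda$; - $\mathcal T(v,\epsilon)$ is a hierarchical HOSVD truncation of $v$ (projections onto the leading left singular vectors of the matricizations of $v$ for all non-root nodes of the tree, applied from the root to the leaves) with $\|v-\mathcal T(v,\epsilon)\|\le\epsilon$; - $\tilde{\boldsymbol r}=\mathbf{RES}(v)$ satisfies $\|(\boldsymbol f^\delta-\boldsymbol A^\delta v)-\tilde{\boldsymbol r}\|\le\omega_1\|\tilde{\boldsymbol r}\|$ and, unless $\boldsymbol f^\delta=\boldsymbol A^\delta v$ and $\tilde{\boldsymbol r}=0$, $\tilde{\boldsymbol r}=\boldsymbol S^{-1}(\delta,\eta)(\boldsymbol f_\epsilon-\boldsymbol A_\epsilon\boldsymbol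 S^{-1}(\delta,\eta)v)$ for some $\eta>0$, where $\epsilon=\mathit{tol}/(3(1+\delta)(2+\delta))$ and $\mathit{tol}>0$, $c\|\tilde{\boldsymbol r}\|\le\mathit{tol}\le\omega_1\|\tilde{\boldsymbol r}\|$ with a fixed $c\in(0,\omega_1]$. Here $\boldsymbol A_\epsilon=\sum_n\bigotimes_j\tilde{\boldsymbol A}_{n,j}$, where $\tilde{\boldsymbol A}_{n,j}$ is $\sum_{p=0}^{L}\hat{\boldsymbol A}_{n,j,[L-p]}R_{\Gamma_{j,p}\setminus\Gamma_{j,p-1}}$ with the scaling undone, the sets $\Gamma_{j,0}\subset\Gamma_{j,1}\subset\cdots$ are supports of best $2^p$-term approximations of $\pi_j(v)$ ($\Gamma_{j,-1}=\emptyset$), the compressed matrices are those for the rate $s$ below, and $L$ is minimal with $\|\boldsymbol D^{-1}(\boldsymbol A-\boldsymbol A_\epsilon)\boldsymbol D^{-1}v\|\le\epsilon$; - the truncated CG method for $Bx=b$ (here $B=\boldsymbol A^\delta$ and $b=\boldsymbol f^\delta$ restricted to $\Lambda^{(k,m)}$) is $r_i=b-Bx_i$, $p_0=r_0+e_0$,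 $x_{i+1}=x_i+\frac{\langle r_i,p_i\rangle}{\langle p_i,Bp_i\rangle}p_i+e'_{i+1}$, $p_{i+1}=r_{i+1}+b_ip_i+e_{i+1}$, $b_i=-\frac{\langle r_{i+1},Bp_i\rangle}{\langle p_i,Bp_i\rangle}$ (a quotient with denominator $0$ is read as $0$), with arbitrary perturbations subject to: there are bounds $0<l\le L$ of the spectrum of $B$ and, with $\kappa_B=L/l$, numbers $0<\tau<(1+\kappa_B^2)^{-1/2}$, $\delta_1,\delta_2>0$, $0<\gamma_B<1$, $\theta=(1-\gamma_B^2/(2\kappa_B))^{1/2}$, $0\le\mu<\theta^{-1}-1$ such that $\frac32\delta_1+\delta_2\le\tau^{-2}-(1+\kappa_B^2)$, $(1-\frac{\delta_1}2)\tau\ge\gamma_B$, $\|e_i\|\le\frac{\delta_1}2\|r_i\|$, $2|b_i|\|p_i\|\|e_{i+1}\|\le\delta_2\|r_{i+1}\|^2$ and $\|e'_{i+1}\|\le\theta\mu L^{-1}\|r_i\|$. **Proposition.** Let $0<s<s^*$, and assume: 1. $\pi_j(\boldsymbol u^\delta)\in\mathcal A_s$ for all $j$, and $\boldsymbol u^\delta\in\mathcal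 A(\gamma)$, i.e. $\sup_N\gamma(N)\inf\{\|\boldsymbol u^\delta-w\|: w\text{ has hierarchical ranks}\le N\}<\infty$, for a positive, strictly increasing sequence $\gamma$ with $\gamma(0)=1$ and $\sup_n\gamma(n)/\gamma(n-1)<\infty$; 2. $\omega_4>\sqrt{2d-3}\,\omega_3$, $\omega_5>\sqrt d(1+\sqrt{2d-3})\,\omega_3$, $\omega_3+\omega_4+\omega_5<1$; 3. $0<\omega_1<\alpha$, $\omega_2<\frac{(1-\omega_1)(\alpha-\omega_1)}{1+\omega_1}\kappa^{-1}$, and $M\ge\lceil|\ln(\omega_3\kappa^{-1/2})/\ln\vartheta|\rceil$ with $\vartheta=\big(1-(\frac{\alpha-\omega_1}{1+\omega_1})^2\kappa^{-1}+(\frac{\omega_2}{1-\omega_1})^2\kappa\big)^{1/2}$; 4. there are finitely supported $\boldsymbol f_\epsilon$, $\epsilon>0$, with $\|\boldsymbol D^{-1}(\boldsymbol f-\boldsymbol f_\epsilon)\|\le\epsilon$ and, for $\boldsymbol f^\delta_\epsilon=\boldsymbol S^{-1}(\delta)\boldsymbol f_\epsilon$ and a constant $C'$ independent of $\epsilon$,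 $\sum_j\#\operatorname{supp}_j(\boldsymbol f^\delta_\epsilon)\le C'\epsilon^{-1/s}(\sum_j\|\pi_j(\boldsymbol f^\delta)\|_{\mathcal A_s})^{1/s}$ and $\sum_j\|\pi_j(\boldsymbol f^\delta_\epsilon)\|_{\mathcal A_s}\le C'\sum_j\|\pi_j(\boldsymbol f^\delta)\|_{\mathcal A_s}$. Then there is a constant $C>0$, independent of $k$ and $m$ (and of $\varepsilon$ and of the choices made during the run), such that for every iteration $(k,m)$ reached by the algorithm with $\boldsymbol u^{(k,m)}\ne\boldsymbol u^\delta$ $$\sum_{j=1}^d\#\Lambda_j^{(k,m)}\le C\,\|\boldsymbol u^\delta-\boldsymbol u^{(k,m)}\|^{-1/s}\Big(\sum_{j=1}^d\|\pi_j(\boldsymbol u^\delta)\|_{\mathcal A_s}\Big)^{1/s}.$$ -/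

import Mathlib

open scoped ENNReal

noncomputable section

namespace HTAWGM

/-! ### Sequence spaces, restrictions, best `N`-term approximation -/

/-- The real sequence space `ℓ₂(ι)`. -/
abbrev L2 (ι : Type*) := lp (fun _ : ι => ℝ) 2

/-- `R_Λ v` (followed by extension by zero): all entries outside `Λ` are replaced by zero. -/
def restr {ι : Type*} (Λ : Set ι) (v : L2 ι) : L2 ι :=
  ⟨Λ.indicator v, by
    refine Memℓp.mono' (lp.memℓp v) fun i => ?_
    by_cases h : i ∈ Λ <;> simp [h]⟩

/-- `v` is supported in `Λ`, i.e. `v ∈ ℓ₂(Λ)`. -/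
def SuppIn {ι : Type*} (Λ : Set ι) (v : L2 ι) : Prop := ∀ i, i ∉ Λ → v i = 0

open Classical in
/-- The matrix entry with row `x` and column `y` of a bounded operator on `ℓ₂(ι)`. -/
def entry {ι : Type*} (B : L2 ι →L[ℝ] L2 ι) (x y : ι) : ℝ := B (lp.single 2 y (1 : ℝ)) x

/-- `min {N : ‖w - w_N‖ ≤ ε}`, with `w_N` a best `N`-term approximation of `w`. -/
def nterm {J : Type*} (w : L2 J) (ε : ℝ) : ℕ :=
  sInf {N : ℕ | ∃ v : L2 J, (Function.support v).encard ≤ N ∧ ‖w - v‖ ≤ ε}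

/-- The quasi-norm of the approximation class `𝒜_s`; `w ∈ 𝒜_s` means that it is finite. -/
def asNorm {J : Type*} (s : ℝ) (w : L2 J) : ℝ≥0∞ :=
  ⨆ (ε : ℝ) (_ : 0 < ε), ENNReal.ofReal (ε * (nterm w ε : ℝ) ^ s)

/-- `Γ p`, `p = 0, 1, …`, are nested supports of best `2^p`-term approximations of `w`. -/
def IsBestLayers {J : Type*} (w : L2 J) (Γ : ℕ → Finset J) : Prop :=
  Monotone Γ ∧ ∀ p, (Γ p).card ≤ 2 ^ p ∧ ∀ F : Finset J, F.card ≤ 2 ^ p →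
    ‖w - restr (Γ p : Set J) w‖ ≤ ‖w - restr (F : Set J) w‖

/-! ### Compressible matrices -/

/-- The matrices `Bp p` compress `B` at the rate `s`. -/
def IsCompressionScheme {J : Type*} (s : ℝ) (B : L2 J →L[ℝ] L2 J)
    (Bp : ℕ → L2 J →L[ℝ] L2 J) : Prop :=
  ∃ a b : ℕ → ℝ, (∀ p, 0 < a p) ∧ (∀ p, 0 < b p) ∧ Summable a ∧ Summable b ∧
    ∀ p : ℕ,
      (∀ x, {y | entry (Bp p) x y ≠ 0}.Finite ∧
        ({y | entry (Bp p) x y ≠ 0}.ncard : ℝ) ≤ a p * 2 ^ p) ∧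
      (∀ y, {x | entry (Bp p) x y ≠ 0}.Finite ∧
        ({x | entry (Bp p) x y ≠ 0}.ncard : ℝ) ≤ a p * 2 ^ p) ∧
      ‖B - Bp p‖ ≤ b p * (2 : ℝ) ^ (-(s * p))

/-- `B` is `sstar`-compressible. -/
def IsCompressible {J : Type*} (sstar : ℝ) (B : L2 J →L[ℝ] L2 J) : Prop :=
  ∀ s, 0 < s → s < sstar → ∃ Bp : ℕ → L2 J →L[ℝ] L2 J, IsCompressionScheme s B Bp

/-! ### Tensors and contractions -/

/-- Multi-indices: the index set of tensors of order `d`. -/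
abbrev MIdx (d : ℕ) (J : Type*) := Fin d → J

open Classical in
/-- The entries of the contraction `π_j(v)`. -/
def contractionFun {d : ℕ} {J : Type*} (j : Fin d) (v : L2 (MIdx d J)) (x : J) : ℝ :=
  √(∑' l : MIdx d J, if l j = x then v l ^ 2 else 0)

theorem contractionFun_memℓp {d : ℕ} {J : Type*} (j : Fin d) (v : L2 (MIdx d J)) :
    Memℓp (contractionFun j v) 2 := by
  classical
  have hs : Summable fun l : MIdx d J => v l ^ 2 := by
    have := (lp.memℓp v).summable (by norm_num)
    simpa using this
  have hs' : ∀ x : J, Summable fun l : MIdx d J => if l j = x then v l ^ 2 else 0 := fun x =>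
    Summable.of_nonneg_of_le (fun l => by split_ifs <;> positivity)
      (fun l => by split_ifs <;> first | exact le_rfl | positivity) hs
  refine memℓp_gen' (C := ∑' l, v l ^ 2) fun t => ?_
  have h1 : ∀ x ∈ t, ‖contractionFun j v x‖ ^ (2 : ℝ≥0∞).toReal
      = ∑' l : MIdx d J, if l j = x then v l ^ 2 else 0 := fun x _ => by
    have h0 : 0 ≤ ∑' l : MIdx d J, if l j = x then v l ^ 2 else 0 :=
      tsum_nonneg fun l => by split_ifs <;> positivity
    simp [contractionFun, Real.sq_sqrt h0]
  rw [Finset.sum_congr rfl h1, ← Summable.tsum_finsetSum fun x _ => hs' x]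
  refine Summable.tsum_le_tsum (fun l => ?_) (summable_sum fun x _ => hs' x) hs
  rw [Finset.sum_ite_eq]
  split_ifs <;> first | exact le_rfl | positivity

/-- The contraction `π_j(v) ∈ ℓ₂(J)` of a tensor `v ∈ ℓ₂(J^d)`. -/
def contraction {d : ℕ} {J : Type*} (j : Fin d) (v : L2 (MIdx d J)) : L2 J :=
  ⟨contractionFun j v, contractionFun_memℓp j v⟩

/-- The product index set `Λ₁ × ⋯ × Λ_d`. -/
def box {d : ℕ} {J : Type*} (Λ : Fin d → Finset J) : Set (MIdx d J) := {l | ∀ j, l j ∈ Λ j}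

/-- `(∑_j ∑_{x ∉ Λ_j} |π_j(v)[x]|²)^{1/2}`. -/
def tail {d : ℕ} {J : Type*} (v : L2 (MIdx d J)) (Λ : Fin d → Finset J) : ℝ :=
  √(∑ j, ‖contraction j v - restr (Λ j : Set J) (contraction j v)‖ ^ 2)

/-- `Λ` is a product set found by sorting the contractions of `v` to the tolerance `ε`: the
discarded part of the contractions has norm at most `ε`, and the total size `∑_j #Λ_j` is minimal
up to the factor `K` (`K = 1` for exact sorting, `K > 1` for approximate sorting into bins). -/
def IsCoarseSet {d : ℕ} {J : Type*} (K : ℝ) (v : L2 (MIdx d J)) (ε : ℝ)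
    (Λ : Fin d → Finset J) : Prop :=
  tail v Λ ≤ ε ∧ ∀ Λ' : Fin d → Finset J, tail v Λ' ≤ ε →
    (∑ j, ((Λ j).card : ℝ)) ≤ K * ∑ j, ((Λ' j).card : ℝ)

/-- `w` is a result of `COARSE(v, ε)`. -/
def IsCoarse {d : ℕ} {J : Type*} (K : ℝ) (v : L2 (MIdx d J)) (ε : ℝ) (w : L2 (MIdx d J)) : Prop :=
  ∃ Λ, IsCoarseSet K v ε Λ ∧ w = restr (box Λ) v

open Classical in
/-- `Λ'` is a result of `EXPAND(Λ, r, bulk)`: the old set is enlarged by a product set that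
captures the fraction `bulk` of `r` and is found by sorting contractions. -/
def IsExpand {d : ℕ} {J : Type*} (K : ℝ) (Λ : Fin d → Finset J) (r : L2 (MIdx d J)) (bulk : ℝ)
    (Λ' : Fin d → Finset J) : Prop :=
  ∃ Γ, IsCoarseSet K r (√(1 - bulk ^ 2) * ‖r‖) Γ ∧ ∀ j, Λ' j = Λ j ∪ Γ j

/-! ### The hierarchical Tucker format -/

/-- Binary dimension trees. -/
inductive DimTree (d : ℕ) : Type
  | leaf (j : Fin d) : DimTree d
  | node (l r : DimTree d) : DimTree d

namespace DimTree

/-- The set of modes at the root of a tree. -/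
def modes {d : ℕ} : DimTree d → Finset (Fin d)
  | leaf j => {j}
  | node l r => l.modes ∪ r.modes

/-- At every inner node the modes are split into two disjoint sets. -/
def Proper {d : ℕ} : DimTree d → Prop
  | leaf _ => True
  | node l r => Disjoint l.modes r.modes ∧ l.Proper ∧ r.Proper

/-- All mode sets that occur in a tree. -/
def nodes {d : ℕ} : DimTree d → Set (Finset (Fin d))
  | leaf j => {{j}}
  | node l r => {l.modes ∪ r.modes} ∪ l.nodes ∪ r.nodes

/-- A dimension tree for tensors of order `d`. -/
def IsDimTree {d : ℕ} (t : DimTree d) : Prop := t.modes = Finset.univ ∧ t.Proper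

/-- Apply the operators `P α` for all nodes `α` except the root, from the root to the leaves. -/
def applyAll {d : ℕ} {X : Type*} (P : Finset (Fin d) → X → X) : DimTree d → X → X
  | leaf _, x => x
  | node l r, x => r.applyAll P (l.applyAll P (P r.modes (P l.modes x)))

end DimTree

/-- The rank of the matricization of `w` with row indices in the modes `α`. -/
def matRank {d : ℕ} {J : Type*} (α : Finset (Fin d)) (w : MIdx d J → ℝ) : Cardinal :=
  Module.rank ℝ (Submodule.span ℝ (Set.range fun (x : MIdx d J) (y : MIdx d J) =>
    w fun i => if i ∈ α then x i else y i))

/-- Tensors with hierarchical ranks at most `N`. -/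
def htSet {d : ℕ} {J : Type*} (t : DimTree d) (N : ℕ) : Set (L2 (MIdx d J)) :=
  {w | ∀ α ∈ t.nodes, matRank α w ≤ N}

/-- `v ∈ 𝒜(γ)`. -/
def MemRankClass {d : ℕ} {J : Type*} (t : DimTree d) (γ : ℕ → ℝ) (v : L2 (MIdx d J)) : Prop :=
  ∃ B : ℝ, ∀ N : ℕ, γ N * Metric.infDist v (htSet t N) ≤ B

/-- The part of a multi-index in the modes `α`, and the remaining part. -/
def splitIdx {d : ℕ} {J : Type*} (α : Finset (Fin d)) :
    MIdx d J ≃ ({i // i ∈ α} → J) × ({i // i ∉ α} → J) :=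
  Equiv.piEquivPiSubtypeProd (fun i => i ∈ α) fun _ => J

/-- A singular value decomposition of the matricization of a finitely supported tensor `v` with
row indices in the modes `α`, with the (positive) singular values in decreasing order. -/
structure MatSVD {d : ℕ} {J : Type*} (α : Finset (Fin d)) (v : MIdx d J → ℝ) where
  /-- the number of positive singular values -/
  n : ℕ
  /-- the singular values -/
  σ : Fin n → ℝ
  /-- the left singular vectors -/
  left : Fin n → (({i // i ∈ α} → J) →₀ ℝ)
  /-- the right singular vectors -/
  right : Fin n → (({i // i ∉ α} → J) →₀ ℝ)
  pos : ∀ k, 0 < σ k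
  anti : Antitone σ
  left_orth : ∀ k l, ((left k).sum fun x c => c * left l x) = if k = l then 1 else 0
  right_orth : ∀ k l, ((right k).sum fun x c => c * right l x) = if k = l then 1 else 0
  eq_sum : ∀ m, v m = ∑ k, σ k * left k (splitIdx α m).1 * right k (splitIdx α m).2

/-- The orthogonal projection, acting on the modes `α`, onto the span of the first `ρ` left
singular vectors. -/
def MatSVD.proj {d : ℕ} {J : Type*} {α : Finset (Fin d)} {v : MIdx d J → ℝ} (S : MatSVD α v)
    (ρ : ℕ) (x : MIdx d J → ℝ) : MIdx d J → ℝ := fun m =>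
  ∑ k : Fin S.n, if (k : ℕ) < ρ then
    S.left k (splitIdx α m).1 *
      (S.left k).sum fun y c => c * x ((splitIdx α).symm (y, (splitIdx α m).2))
  else 0

/-- `w` is a result of the truncation `𝒯(v, ε)`: a hierarchical HOSVD truncation of `v` to some
ranks `ρ`, with an error of at most `ε`. -/
def IsTrunc {d : ℕ} {J : Type*} (t : DimTree d) (v : L2 (MIdx d J)) (ε : ℝ)
    (w : L2 (MIdx d J)) : Prop :=
  ∃ (S : ∀ α : Finset (Fin d), MatSVD (J := J) α v) (ρ : Finset (Fin d) → ℕ),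
    (∀ m, w m = t.applyAll (fun α => (S α).proj (ρ α)) (v : MIdx d J → ℝ) m) ∧ ‖v - w‖ ≤ ε

/-! ### The truncated conjugate gradient method -/

/-- Constants of the truncated conjugate gradient method. -/
structure CGParams where
  /-- lower bound of the spectrum -/
  lmin : ℝ
  /-- upper bound of the spectrum -/
  lmax : ℝ
  τ : ℝ
  δ₁ : ℝ
  δ₂ : ℝ
  γ : ℝ
  μ : ℝ

/-- The condition number. -/
def CGParams.κ (c : CGParams) : ℝ := c.lmax / c.lmin

/-- The error reduction factor of the unperturbed step. -/
def CGParams.θ (c : CGParams) : ℝ := √(1 - c.γ ^ 2 / (2 * c.κ))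

/-- The requirements on the constants, for the Galerkin matrix of `A` on the index set `Λ`. -/
structure CGParams.Valid {ι : Type*} (c : CGParams) (A : L2 ι →L[ℝ] L2 ι) (Λ : Set ι) : Prop where
  lmin_pos : 0 < c.lmin
  lmin_le : c.lmin ≤ c.lmax
  lower : ∀ v, SuppIn Λ v → c.lmin * ‖v‖ ^ 2 ≤ inner ℝ v (A v)
  upper : ∀ v, SuppIn Λ v → inner ℝ v (A v) ≤ c.lmax * ‖v‖ ^ 2
  τ_pos : 0 < c.τ
  τ_lt : c.τ < 1 / √(1 + c.κ ^ 2)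
  δ₁_pos : 0 < c.δ₁
  δ₂_pos : 0 < c.δ₂
  γ_pos : 0 < c.γ
  γ_lt : c.γ < 1
  δ_le : 3 / 2 * c.δ₁ + c.δ₂ ≤ 1 / c.τ ^ 2 - (1 + c.κ ^ 2)
  γ_le : c.γ ≤ (1 - c.δ₁ / 2) * c.τ
  μ_nonneg : 0 ≤ c.μ
  μ_lt : c.μ < c.θ⁻¹ - 1

/-- `x'` is a result of `PCG(A, f, x₀, Λ, tol)`: the truncated conjugate gradient iteration in
`ℓ₂(Λ)` for the Galerkin system on `Λ`, started at `x₀` and stopped as soon as the norm of the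
residual is at most `tol`. The perturbations `e₁`, `e₂` of the directions and of the iterates are
arbitrary elements of `ℓ₂(Λ)` that obey the tolerances of the method. -/
def IsPCG {ι : Type*} (A : L2 ι →L[ℝ] L2 ι) (f x₀ : L2 ι) (Λ : Set ι) (tol : ℝ)
    (x' : L2 ι) : Prop :=
  ∃ (c : CGParams) (I : ℕ) (x r p e₁ e₂ : ℕ → L2 ι) (a b : ℕ → ℝ),
    c.Valid A Λ ∧
    (∀ i, SuppIn Λ (e₁ i) ∧ SuppIn Λ (e₂ i)) ∧
    x 0 = x₀ ∧
    (∀ i, r i = restr Λ (f - A (x i))) ∧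
    p 0 = r 0 + e₁ 0 ∧
    (∀ i < I,
      a i = inner ℝ (r i) (p i) / inner ℝ (p i) (A (p i)) ∧
      x (i + 1) = x i + a i • p i + e₂ (i + 1) ∧
      b i = -(inner ℝ (r (i + 1)) (A (p i)) / inner ℝ (p i) (A (p i))) ∧
      p (i + 1) = r (i + 1) + b i • p i + e₁ (i + 1)) ∧
    ‖e₁ 0‖ ≤ c.δ₁ / 2 * ‖r 0‖ ∧
    (∀ i < I,
      ‖e₁ (i + 1)‖ ≤ c.δ₁ / 2 * ‖r (i + 1)‖ ∧
      2 * |b i| * ‖p i‖ * ‖e₁ (i + 1)‖ ≤ c.δ₂ * ‖r (i + 1)‖ ^ 2 ∧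
      ‖e₂ (i + 1)‖ ≤ c.θ * c.μ * c.lmax⁻¹ * ‖r i‖) ∧
    (∀ i < I, tol < ‖r i‖) ∧ ‖r I‖ ≤ tol ∧ x' = x I

/-! ### Separable scaling -/

/-- One term `h w(x) exp(-α(x) t)` of the exponential sum, at the node `x`, with
`w(x) = 2 / (√π (1 + e^{-x}))` and `α(x) = ln²(1 + e^x)`. -/
def expTerm (h x t : ℝ) : ℝ :=
  h * (2 / √Real.pi * (1 + Real.exp (-x))⁻¹) * Real.exp (-(Real.log (1 + Real.exp x) ^ 2 * t))

/-- The exponential sum over the nodes `k h`, `-n ≤ k ≤ n⁺`, which approximates `t ^ (-1/2)`. -/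
def expSum (h : ℝ) (nplus n : ℕ) (t : ℝ) : ℝ :=
  ∑ k ∈ Finset.Icc (-(n : ℤ)) (nplus : ℤ), expTerm h (k * h) t

/-- The limit `n → ∞` of `expSum`: the sum over all nodes `k h` with `k ≤ n⁺`. -/
def expSumLim (h : ℝ) (nplus : ℕ) (t : ℝ) : ℝ :=
  ∑' i : ℕ, expTerm h (((nplus : ℝ) - i) * h) t

/-! ### The discretized problem -/

/-- The data of the problem, of the separable preconditioner and of the residual evaluation. -/
structure Problem (d R : ℕ) (J : Type*) where
  /-- `‖ψ_x‖_{H¹}` for the one-dimensional basis function with index `x` in direction `j` -/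
  weight : Fin d → J → ℝ
  /-- the one-dimensional components: `A = ∑_n ⨂_j comp n j` -/
  comp : Fin R → Fin d → J → J → ℝ
  /-- order of differentiation of the test function in the component `(n, j)` -/
  testOrd : Fin R → Fin d → ℕ
  /-- order of differentiation of the trial function in the component `(n, j)` -/
  trialOrd : Fin R → Fin d → ℕ
  /-- the one-dimensional components, scaled to operators on `ℓ₂(J)` -/
  compHat : Fin R → Fin d → L2 J →L[ℝ] L2 J
  /-- compressed versions of the scaled components -/
  compressed : Fin R → Fin d → ℕ → L2 J →L[ℝ] L2 J
  /-- accuracy of the separable scaling -/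
  δ : ℝ
  /-- step size of the exponential sum -/
  h : ℝ
  /-- upper summation limit of the exponential sum -/
  nplus : ℕ
  /-- the right-hand side `f` -/
  f : MIdx d J → ℝ
  /-- the finitely supported approximations `f_ε` -/
  fApprox : ℝ → (MIdx d J →₀ ℝ)
  /-- the preconditioned operator `A^δ` -/
  Aδ : L2 (MIdx d J) →L[ℝ] L2 (MIdx d J)
  /-- the preconditioned right-hand side `f^δ` -/
  fδ : L2 (MIdx d J)
  /-- the solution `u^δ` -/
  uδ : L2 (MIdx d J)

namespace Problem

variable {d R : ℕ} {J : Type*} (P : Problem d R J)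

/-- The scaling weight `t = ∑_j ‖ψ_{λ_j}‖²_{H¹}`. -/
def t (l : MIdx d J) : ℝ := ∑ j, P.weight j (l j) ^ 2

/-- The diagonal of `D`. -/
def D (l : MIdx d J) : ℝ := √(P.t l)

/-- The diagonal of `S⁻¹(δ)`. -/
def Sinv (l : MIdx d J) : ℝ := expSumLim P.h P.nplus (P.t l)

/-- The diagonal of `S⁻¹(δ, η)`, where `η` determines the number `n`. -/
def SinvN (n : ℕ) (l : MIdx d J) : ℝ := expSum P.h P.nplus n (P.t l)

/-- The entries of the (unscaled) matrix `A`. -/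
def matA (l m : MIdx d J) : ℝ := ∑ n, ∏ j, P.comp n j (l j) (m j)

/-- The parameters of the separable scaling are chosen as required. -/
structure ScalingValid : Prop where
  weight_pos : ∀ j x, 0 < P.weight j x
  one_le_t : ∀ l, 1 ≤ P.t l
  δ_pos : 0 < P.δ
  δ_lt : P.δ < 1
  h_pos : 0 < P.h
  h_lt : P.h < Real.pi ^ 2 / (5 * (|Real.log (P.δ / 2)| + 4))
  nplus_ge : P.h⁻¹ * max (4 / √Real.pi) (√|Real.log (P.δ / 2)|) ≤ P.nplus

/-- `A` is separable with components which, scaled by the one-dimensional weights according to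
the orders of differentiation, are the matrices of the bounded operators `compHat n j`. In each
term the test and the trial function are differentiated at most once. -/
structure Separable : Prop where
  testOrd_le : ∀ n, ∑ j, P.testOrd n j ≤ 1
  trialOrd_le : ∀ n, ∑ j, P.trialOrd n j ≤ 1
  entry_eq : ∀ n j x y, entry (P.compHat n j) x y =
    (P.weight j x ^ P.testOrd n j)⁻¹ * P.comp n j x y * (P.weight j y ^ P.trialOrd n j)⁻¹

/-- `A^δ = S⁻¹(δ) A S⁻¹(δ)`, `f^δ = S⁻¹(δ) f` and `A^δ u^δ = f^δ`, where `A^δ` is a bounded,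
symmetric and positive definite operator with spectrum in `[lmin, lmax]`. -/
structure Equation (lmin lmax : ℝ) : Prop where
  entry_eq : ∀ l m, entry P.Aδ l m = P.Sinv l * P.matA l m * P.Sinv m
  symm : ∀ v w, inner ℝ (P.Aδ v) w = inner ℝ v (P.Aδ w)
  lmin_pos : 0 < lmin
  lmin_le : lmin ≤ lmax
  lower : ∀ v, lmin * ‖v‖ ^ 2 ≤ inner ℝ v (P.Aδ v)
  upper : ∀ v, inner ℝ v (P.Aδ v) ≤ lmax * ‖v‖ ^ 2
  rhs : ∀ l, P.fδ l = P.Sinv l * P.f l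
  solution : P.Aδ P.uδ = P.fδ

/-- Efficient approximability of the right-hand side: `‖D⁻¹ (f - f_ε)‖ ≤ ε`, and with
`f^δ_ε = S⁻¹(δ) f_ε` (the vector `g` below)
`∑_j #supp_j f^δ_ε ≤ C ε^{-1/s} (∑_j ‖π_j f^δ‖_{𝒜_s})^{1/s}` and
`∑_j ‖π_j f^δ_ε‖_{𝒜_s} ≤ C ∑_j ‖π_j f^δ‖_{𝒜_s}`, with `C` independent of `ε`. -/
def RhsApproximable (s : ℝ) : Prop :=
  ∃ C : ℝ, 0 < C ∧ ∀ ε : ℝ, 0 < ε →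
    (∃ e : L2 (MIdx d J), (∀ l, e l = (P.D l)⁻¹ * (P.f l - P.fApprox ε l)) ∧ ‖e‖ ≤ ε) ∧
    ∃ g : L2 (MIdx d J), (∀ l, g l = P.Sinv l * P.fApprox ε l) ∧
      (∑ j, ((Function.support (contraction j g)).encard : ℝ≥0∞)) ≤
        ENNReal.ofReal (C * ε ^ (-1 / s)) *
          (∑ j, asNorm s (contraction j P.fδ)) ^ (1 / s) ∧
      (∑ j, asNorm s (contraction j g)) ≤
        ENNReal.ofReal C * ∑ j, asNorm s (contraction j P.fδ)

/-! ### Residual evaluation -/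

open Classical in
/-- The entries of the adaptively compressed component `∑_{p ≤ L} A_{[L-p]} R_{Γ p \ Γ (p-1)}`
(with `Γ (-1) = ∅`), with the scaling undone. -/
def compL (Γ : ℕ → Finset J) (L : ℕ) (n : Fin R) (j : Fin d) (x y : J) : ℝ :=
  if y ∈ Γ L then
    P.weight j x ^ P.testOrd n j *
      entry (P.compressed n j (L - sInf {p | y ∈ Γ p})) x y * P.weight j y ^ P.trialOrd n j
  else 0

/-- The entries of the compressed operator built from the layers `Γ j` and the level `L`. -/
def matL (Γ : Fin d → ℕ → Finset J) (L : ℕ) (l m : MIdx d J) : ℝ :=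
  ∑ n, ∏ j, P.compL (Γ j) L n j (l j) (m j)

/-- `‖D⁻¹ (A - A_L) D⁻¹ v‖ ≤ ε` for the compressed operator `A_L` of level `L`. -/
def ApplyAccurate (Γ : Fin d → ℕ → Finset J) (v : L2 (MIdx d J)) (ε : ℝ) (L : ℕ) : Prop :=
  ∃ e : L2 (MIdx d J),
    (∀ l, e l = (P.D l)⁻¹ * ∑' m, (P.matA l m - P.matL Γ L l m) * ((P.D m)⁻¹ * v m)) ∧ ‖e‖ ≤ ε

/-- `r` is a result of `RES(v, ω₁)` for a finitely supported `v`: an approximate residual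
`r = S⁻¹(δ,η) (f_ε - A_ε S⁻¹(δ,η) v)` with relative accuracy `ω₁`. Here `tol` is the absolute
tolerance, which is comparable to `‖r‖`; `ε` is the corresponding tolerance for the data; `A_ε`
is the compressed operator, of the smallest level `L` that meets the tolerance `ε`; and `n` is
large enough for the accuracy `η` on all indices that occur. For an exact solution `v` the
residual is zero. -/
def IsRES (cRes ω₁ : ℝ) (v r : L2 (MIdx d J)) : Prop :=
  (P.fδ = P.Aδ v ∧ r = 0) ∨
  ‖P.fδ - P.Aδ v - r‖ ≤ ω₁ * ‖r‖ ∧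
  ∃ (tol ε η T : ℝ) (Γ : Fin d → ℕ → Finset J) (L n : ℕ) (g : MIdx d J → ℝ),
    0 < tol ∧ cRes * ‖r‖ ≤ tol ∧ tol ≤ ω₁ * ‖r‖ ∧
    ε = tol / (3 * (1 + P.δ) * (2 + P.δ)) ∧
    (∀ j, IsBestLayers (contraction j v) (Γ j)) ∧
    IsLeast {L | P.ApplyAccurate Γ v ε L} L ∧
    (∀ l, g l = ∑' m, P.matL Γ L l m * (P.SinvN n m * v m)) ∧
    0 < η ∧ 1 < T ∧
    (∀ l, (v l ≠ 0 ∨ P.fApprox ε l ≠ 0 ∨ g l ≠ 0) → P.t l ≤ T) ∧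
    P.h⁻¹ * (Real.log (2 / √Real.pi) + |Real.log (min (P.δ / 2) η)| + 1 / 2 * Real.log T) ≤ n ∧
    ∀ l, r l = P.SinvN n l * (P.fApprox ε l - g l)

end Problem

/-! ### The adaptive algorithm -/

/-- The parameters of the algorithm. -/
structure Params (d : ℕ) (J : Type*) where
  /-- the initial product index set -/
  Λ₀ : Fin d → Finset J
  /-- the dimension tree of the tensor format -/
  tree : DimTree d
  /-- the bulk parameter `α` -/
  bulk : ℝ
  ω₀ : ℝ
  ω₁ : ℝ
  ω₂ : ℝ
  ω₃ : ℝ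
  ω₄ : ℝ
  ω₅ : ℝ
  /-- the maximal number of inner iterations -/
  M : ℕ
  /-- lower spectral bound of `A^δ` -/
  lmin : ℝ
  /-- upper spectral bound of `A^δ` -/
  lmax : ℝ
  /-- quasi-optimality constant of `COARSE` -/
  K : ℝ
  /-- `RES` works with absolute tolerances between `cRes ‖r‖` and `ω₁ ‖r‖` -/
  cRes : ℝ

namespace Params

variable {d : ℕ} {J : Type*} (q : Params d J)

/-- The condition number of `A^δ`. -/
def κ : ℝ := q.lmax / q.lmin

/-- The tolerance `ω₀^{(k)} = (ω₃ + ω₄ + ω₅)^k ω₀`. -/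
def ω₀k (k : ℕ) : ℝ := (q.ω₃ + q.ω₄ + q.ω₅) ^ k * q.ω₀

/-- The error reduction factor of the inner iterations. -/
def ϑ : ℝ :=
  √(1 - ((q.bulk - q.ω₁) / (1 + q.ω₁)) ^ 2 * q.κ⁻¹ + (q.ω₂ / (1 - q.ω₁)) ^ 2 * q.κ)

/-- The requirements on the parameters for convergence. -/
structure Convergence : Prop where
  Λ₀_nonempty : ∀ j, (q.Λ₀ j).Nonempty
  tree : q.tree.IsDimTree
  bulk_lt : q.bulk < 1
  ω₀_pos : 0 < q.ω₀
  ω₁_pos : 0 < q.ω₁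
  ω₁_lt : q.ω₁ < q.bulk
  ω₂_pos : 0 < q.ω₂
  ω₂_lt : q.ω₂ < (1 - q.ω₁) * (q.bulk - q.ω₁) / (1 + q.ω₁) * q.κ⁻¹
  ω₃_pos : 0 < q.ω₃
  ω₄_pos : 0 < q.ω₄
  ω₅_pos : 0 < q.ω₅
  sum_lt : q.ω₃ + q.ω₄ + q.ω₅ < 1
  M_ge : ⌈|Real.log (q.ω₃ * q.κ ^ (-1 / 2 : ℝ)) / Real.log q.ϑ|⌉₊ ≤ q.M
  K_ge : 1 ≤ q.K
  cRes_pos : 0 < q.cRes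
  cRes_le : q.cRes ≤ q.ω₁

end Params

/-- `Reach P q ε k m Λ u ρ`: a run of the algorithm with the target tolerance `ε` arrives at the
iteration `(k, m)` with `Λ^{(k,m)} = Λ`, `u^{(k,m)} = u` and `‖r^{(k,m)}‖ = ρ`. -/
inductive Reach {d R : ℕ} {J : Type*} (P : Problem d R J) (q : Params d J) (ε : ℝ) :
    ℕ → ℕ → (Fin d → Finset J) → L2 (MIdx d J) → ℝ → Prop
  | init : Reach P q ε 0 0 q.Λ₀ 0 q.ω₀
  /-- solve, estimate, and expand the index set -/
  | inner {k m : ℕ} {Λ Λ' : Fin d → Finset J} {u u' r : L2 (MIdx d J)} {ρ : ℝ}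
      (prev : Reach P q ε k m Λ u ρ)
      (solve : IsPCG P.Aδ P.fδ u (box Λ) (q.ω₂ * ρ) u')
      (estimate : P.IsRES q.cRes q.ω₁ u' r)
      (not_done : ε < (1 + q.ω₁) * ‖r‖)
      (not_small : q.ω₃ * q.ω₀k k < (1 + q.ω₁) * ‖r‖) (not_last : m ≠ q.M)
      (expand : IsExpand q.K Λ r q.bulk Λ') :
      Reach P q ε k (m + 1) Λ' u' ‖r‖
  /-- solve, estimate, then truncate the ranks and coarsen -/
  | outer {k m : ℕ} {Λ Λ' : Fin d → Finset J} {u u' r w v r' : L2 (MIdx d J)} {ρ : ℝ}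
      (prev : Reach P q ε k m Λ u ρ)
      (solve : IsPCG P.Aδ P.fδ u (box Λ) (q.ω₂ * ρ) u')
      (estimate : P.IsRES q.cRes q.ω₁ u' r)
      (not_done : ε < (1 + q.ω₁) * ‖r‖)
      (finished : (1 + q.ω₁) * ‖r‖ ≤ q.ω₃ * q.ω₀k k ∨ m = q.M)
      (trunc : IsTrunc q.tree u' (q.ω₄ * q.lmin⁻¹ * q.ω₀k k) w)
      (coarse : IsCoarse q.K w (q.ω₅ * q.lmin⁻¹ * q.ω₀k k) v)
      (supp : ∀ j, (Λ' j : Set J) = Function.support (contraction j v))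
      (estimate' : P.IsRES q.cRes q.ω₁ v r') :
      Reach P q ε (k + 1) 0 Λ' v ‖r'‖

end HTAWGM

end

noncomputable section

namespace HTAWGM

/-! ### Norms in `ℓ₂` as sums of squares -/

section Basics

variable {ι : Type*}

/-! The constant may depend on `u^δ`, so it is enough to compare both quantities with the outer
tolerance `ω₀k k`: the error of every iterate is `O(ω₀k k)`, and the total size of its index set is
`O((ω₀k k)^{-1/s})`. Eliminating the tolerance gives the claim, because the factor `(∑ ‖π_j
u^δ‖)^{1/s}` is a fixed number that can be divided out. It vanishes only for `u^δ = 0`, and then the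
run ends in its first iteration with the iterate `0`.

Error. One inner iteration reduces the squared energy error by `ϑ²` (`SpectralBounds.energy_step`):
a Galerkin solution is nearly optimal on its index set, hence not much worse than a gradient step
there, and the bulk criterion makes that step effective. The first solve of an outer loop has no
bulk criterion and may increase the energy, at most by a factor 2. The constant `81/25` in
`energyBound` closes this loop. At the end of an inner loop the error is at most `9/5 ω₃ lmin⁻¹ ω₀k
k`; truncation and coarsening add `(ω₄ + ω₅) lmin⁻¹ ω₀k k`; the sum is at most `6/5 lmin⁻¹ ω₀k
(k+1)` because `3 ω₃ ≤ ω₄ + ω₅`; and twice the resulting energy is below the next bound since `2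
(6/5)² ≤ (9/5)²` (`iterateBounds_of_reach`).

Size after coarsening. The sets that approximate `u^δ` sparsely are also admissible for the
truncated iterate, for a HOSVD truncation does not increase any contraction
(`IsTrunc.norm_restr_le`). The reason is that projecting a tensor onto left singular vectors of one
of its matricizations equals projecting it onto the right ones, which act on the complementary
modes. So for every mode `j` all projections can be moved away from `j`. Near-minimality of the
coarse set then bounds its size (`exists_coarse_size_bound`).

Size after expansion. The new indices come from a residual whose tolerance is comparable to `ω₀k k`,
since the inner loop has not ended. Its support is governed by `2^L`, with `L` the compression
level. Minimality of `L` bounds `2^L` once the layers of the iterate decay like `2^{-sp}`, and they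
do: up to the size of the current support, the error against `u^δ` is itself of this order, and
beyond it the remainder is zero (`exists_residual_support_bound`). The right-hand side has finite
`𝒜_s` norms because it is the compressible operator applied to the sparse `u^δ`. Each expansion
enlarges the constant, but there are at most `M` of them between two coarsenings
(`exists_size_bound`). -/

theorem summable_sq (v : L2 ι) : Summable fun i => v i ^ 2 := by
  simpa using (lp.memℓp v).summable (by norm_num)

theorem norm_sq_eq_tsum (v : L2 ι) : ‖v‖ ^ 2 = ∑' i, v i ^ 2 := by
  have := lp.norm_rpow_eq_tsum (p := 2) (by norm_num) v
  simpa using this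

theorem ofReal_norm_sq (v : L2 ι) :
    ENNReal.ofReal (‖v‖ ^ 2) = ∑' i, ENNReal.ofReal (v i ^ 2) := by
  rw [norm_sq_eq_tsum, ENNReal.ofReal_tsum_of_nonneg (fun i => sq_nonneg _) (summable_sq v)]

theorem memℓp_of_tsum_lt {g : ι → ℝ} (h : ∑' i, ENNReal.ofReal (g i ^ 2) ≠ ⊤) : Memℓp g 2 := by
  refine memℓp_gen ?_
  have := ENNReal.summable_toReal h
  refine this.congr fun i => ?_
  rw [ENNReal.toReal_ofReal (sq_nonneg _)]
  simp

theorem norm_le_of_tsum_le {v : L2 ι} {c : ℝ} (hc : 0 ≤ c)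
    (h : ∑' i, ENNReal.ofReal (v i ^ 2) ≤ ENNReal.ofReal (c ^ 2)) : ‖v‖ ≤ c := by
  rw [← ofReal_norm_sq, ENNReal.ofReal_le_ofReal_iff (sq_nonneg _)] at h
  exact le_of_sq_le_sq h hc

theorem exists_of_tsum_le {g : ι → ℝ} {c : ℝ} (hc : 0 ≤ c)
    (h : ∑' i, ENNReal.ofReal (g i ^ 2) ≤ ENNReal.ofReal (c ^ 2)) :
    ∃ e : L2 ι, (∀ i, e i = g i) ∧ ‖e‖ ≤ c :=
  ⟨⟨g, memℓp_of_tsum_lt (ne_top_of_le_ne_top ENNReal.ofReal_ne_top h)⟩, fun _ => rfl,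
    norm_le_of_tsum_le hc h⟩

theorem norm_le_of_abs_le {v w : L2 ι} (h : ∀ i, |v i| ≤ |w i|) : ‖v‖ ≤ ‖w‖ := by
  refine norm_le_of_tsum_le (norm_nonneg _) ?_
  rw [ofReal_norm_sq]
  exact ENNReal.tsum_le_tsum fun i => ENNReal.ofReal_le_ofReal (sq_le_sq.2 (h i))

/-- A function dominated by an element of `ℓ₂` is in `ℓ₂`. -/
theorem exists_of_abs_le {g : ι → ℝ} {c : ℝ} (hc : 0 ≤ c) (v : L2 ι)
    (h : ∀ i, |g i| ≤ c * |v i|) : ∃ e : L2 ι, (∀ i, e i = g i) ∧ ‖e‖ ≤ c * ‖v‖ := by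
  refine exists_of_tsum_le (mul_nonneg hc (norm_nonneg _)) ?_
  rw [mul_pow, ENNReal.ofReal_mul (sq_nonneg _), ofReal_norm_sq, ← ENNReal.tsum_mul_left]
  refine ENNReal.tsum_le_tsum fun i => ?_
  rw [← ENNReal.ofReal_mul (sq_nonneg _), ← mul_pow]
  refine ENNReal.ofReal_le_ofReal (sq_le_sq.2 ((h i).trans (le_of_eq ?_)))
  rw [abs_mul, abs_of_nonneg hc]

/-! ### Restrictions -/

open Classical in
theorem restr_apply (Λ : Set ι) (v : L2 ι) (i : ι) :
    restr Λ v i = if i ∈ Λ then v i else 0 := by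
  change Λ.indicator (v : ι → ℝ) i = _
  rw [Set.indicator_apply]

theorem restr_of_mem {Λ : Set ι} {i : ι} (h : i ∈ Λ) (v : L2 ι) : restr Λ v i = v i := by
  rw [restr_apply, if_pos h]

theorem restr_of_notMem {Λ : Set ι} {i : ι} (h : i ∉ Λ) (v : L2 ι) : restr Λ v i = 0 := by
  rw [restr_apply, if_neg h]

theorem suppIn_restr (Λ : Set ι) (v : L2 ι) : SuppIn Λ (restr Λ v) :=
  fun _ hi => restr_of_notMem hi v

theorem norm_restr_le (Λ : Set ι) (v : L2 ι) : ‖restr Λ v‖ ≤ ‖v‖ := by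
  classical
  refine norm_le_of_abs_le fun i => ?_
  rw [restr_apply]
  split_ifs <;> simp

theorem norm_restr_mono {Λ Λ' : Set ι} (h : Λ ⊆ Λ') (v : L2 ι) :
    ‖restr Λ v‖ ≤ ‖restr Λ' v‖ := by
  classical
  refine norm_le_of_abs_le fun i => ?_
  by_cases hi : i ∈ Λ
  · rw [restr_of_mem hi, restr_of_mem (h hi)]
  · rw [restr_of_notMem hi]; simp

theorem sub_restr (Λ : Set ι) (v : L2 ι) : v - restr Λ v = restr Λᶜ v := by
  classical
  ext i
  by_cases hi : i ∈ Λ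
  · simp [restr_apply, hi]
  · simp [restr_apply, hi]

theorem restr_add (Λ : Set ι) (v w : L2 ι) : restr Λ (v + w) = restr Λ v + restr Λ w := by
  classical
  ext i
  by_cases hi : i ∈ Λ <;> simp [restr_apply, hi]

theorem restr_sub (Λ : Set ι) (v w : L2 ι) : restr Λ (v - w) = restr Λ v - restr Λ w := by
  classical
  ext i
  by_cases hi : i ∈ Λ <;> simp [restr_apply, hi]

theorem restr_smul (Λ : Set ι) (c : ℝ) (v : L2 ι) : restr Λ (c • v) = c • restr Λ v := by
  classical
  ext i
  by_cases hi : i ∈ Λ <;> simp [restr_apply, hi]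

theorem restr_eq_self {Λ : Set ι} {v : L2 ι} (h : SuppIn Λ v) : restr Λ v = v := by
  classical
  ext i
  by_cases hi : i ∈ Λ
  · simp [restr_apply, hi]
  · simp [restr_apply, hi, h i hi]

/-- The restriction to `Λ` as a bounded operator. -/
def restrL (Λ : Set ι) : L2 ι →L[ℝ] L2 ι :=
  LinearMap.mkContinuous ⟨⟨restr Λ, restr_add Λ⟩, restr_smul Λ⟩ 1
    fun v => by simpa using norm_restr_le Λ v

@[simp]
theorem restrL_apply (Λ : Set ι) (v : L2 ι) : restrL Λ v = restr Λ v := rfl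

theorem inner_eq_tsum (v w : L2 ι) : inner ℝ v w = ∑' i, v i * w i := by
  rw [lp.inner_eq_tsum]
  refine tsum_congr fun i => ?_
  simp [mul_comm]

theorem inner_restr_left (Λ : Set ι) (v w : L2 ι) :
    inner ℝ (restr Λ v) w = inner ℝ v (restr Λ w) := by
  classical
  rw [inner_eq_tsum, inner_eq_tsum]
  refine tsum_congr fun i => ?_
  by_cases hi : i ∈ Λ <;> simp [restr_apply, hi]

theorem inner_restr_self (Λ : Set ι) (v : L2 ι) : inner ℝ v (restr Λ v) = ‖restr Λ v‖ ^ 2 := by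
  rw [← real_inner_self_eq_norm_sq, inner_restr_left, restr_eq_self (suppIn_restr Λ v)]

theorem norm_sq_restr_add (Λ : Set ι) (v : L2 ι) :
    ‖restr Λ v‖ ^ 2 + ‖v - restr Λ v‖ ^ 2 = ‖v‖ ^ 2 := by
  rw [@norm_sub_sq_real, inner_restr_self]
  ring

theorem SuppIn.add {Λ : Set ι} {v w : L2 ι} (hv : SuppIn Λ v) (hw : SuppIn Λ w) :
    SuppIn Λ (v + w) := fun i hi => by simp [hv i hi, hw i hi]

theorem SuppIn.smul {Λ : Set ι} {v : L2 ι} (hv : SuppIn Λ v) (c : ℝ) : SuppIn Λ (c • v) :=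
  fun i hi => by simp [hv i hi]

theorem SuppIn.sub {Λ : Set ι} {v w : L2 ι} (hv : SuppIn Λ v) (hw : SuppIn Λ w) :
    SuppIn Λ (v - w) := fun i hi => by simp [hv i hi, hw i hi]

theorem SuppIn.mono {Λ Λ' : Set ι} (h : Λ ⊆ Λ') {v : L2 ι} (hv : SuppIn Λ v) : SuppIn Λ' v :=
  fun i hi => hv i fun hi' => hi (h hi')

theorem suppIn_zero (Λ : Set ι) : SuppIn Λ (0 : L2 ι) := fun _ _ => rfl

/-! ### Matrix entries and finite truncations. -/

open Classical in
theorem apply_of_suppIn (B : L2 ι →L[ℝ] L2 ι) {F : Finset ι} {v : L2 ι}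
    (hv : SuppIn (F : Set ι) v) (x : ι) : B v x = ∑ y ∈ F, entry B x y * v y := by
  have h : v = ∑ y ∈ F, v y • lp.single 2 y (1 : ℝ) := by
    ext i
    rw [lp.coeFn_sum, Finset.sum_apply]
    by_cases hi : i ∈ F
    · rw [Finset.sum_eq_single i]
      · simp
      · intro b _ hb
        simp [hb.symm]
      · exact fun h => absurd hi h
    · rw [hv i (by simpa using hi), Finset.sum_eq_zero]
      intro b hb
      have : i ≠ b := fun h => hi (h ▸ hb)
      simp [this]
  conv_lhs => rw [h]
  rw [map_sum, lp.coeFn_sum, Finset.sum_apply]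
  refine Finset.sum_congr rfl fun y _ => ?_
  rw [map_smul]
  simp [entry, mul_comm]

theorem exists_finset_norm_sub_restr_le (w : L2 ι) {ε : ℝ} (hε : 0 < ε) :
    ∃ F : Finset ι, ‖w - restr (F : Set ι) w‖ ≤ ε := by
  classical
  have h := lp.hasSum_single (p := 2) (by norm_num) w
  have h1 := (Metric.tendsto_nhds.1 h ε hε).exists
  obtain ⟨F, hF⟩ := h1
  refine ⟨F, ?_⟩
  rw [dist_comm, dist_eq_norm] at hF
  suffices hr : restr (F : Set ι) w = ∑ b ∈ F, lp.single 2 b (w b) by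
    rw [hr]
    exact hF.le
  ext i
  rw [lp.coeFn_sum, Finset.sum_apply, restr_apply]
  by_cases hi : i ∈ F
  · rw [Finset.sum_eq_single i]
    · simp [hi]
    · intro b _ hb
      simp [hb.symm]
    · exact fun h => absurd hi h
  · rw [Finset.sum_eq_zero]
    · simp [hi]
    intro b hb
    have : i ≠ b := fun h => hi (h ▸ hb)
    simp [this]

end Basics

/-! ### Contractions and tails -/

section Contractions

variable {d : ℕ} {J : Type*}

open Classical in
theorem ofReal_contraction_sq (j : Fin d) (v : L2 (MIdx d J)) (x : J) :
    ENNReal.ofReal (contraction j v x ^ 2) =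
      ∑' l : MIdx d J, if l j = x then ENNReal.ofReal (v l ^ 2) else 0 := by
  have h0 : ∀ l : MIdx d J, 0 ≤ if l j = x then v l ^ 2 else 0 := fun l => by
    split_ifs <;> positivity
  have hs : Summable fun l : MIdx d J => if l j = x then v l ^ 2 else 0 :=
    Summable.of_nonneg_of_le h0
      (fun l => by split_ifs <;> first | exact le_rfl | positivity) (summable_sq v)
  have : contraction j v x ^ 2 = ∑' l : MIdx d J, if l j = x then v l ^ 2 else 0 :=
    Real.sq_sqrt (tsum_nonneg h0)
  rw [this, ENNReal.ofReal_tsum_of_nonneg h0 hs]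
  exact tsum_congr fun l => by split_ifs <;> simp

/-- Restricting a contraction amounts to restricting the corresponding mode of the tensor. -/
theorem norm_restr_contraction (j : Fin d) (S : Set J) (v : L2 (MIdx d J)) :
    ‖restr S (contraction j v)‖ = ‖restr {l : MIdx d J | l j ∈ S} v‖ := by
  classical
  rw [← sq_eq_sq₀ (norm_nonneg _) (norm_nonneg _), ← ENNReal.ofReal_eq_ofReal_iff (sq_nonneg _)
    (sq_nonneg _), ofReal_norm_sq, ofReal_norm_sq]
  have h : ∀ x, ENNReal.ofReal (restr S (contraction j v) x ^ 2) =
      ∑' l : MIdx d J, if l j = x then (if x ∈ S then ENNReal.ofReal (v l ^ 2) else 0) else 0 := by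
    intro x
    by_cases hx : x ∈ S
    · simp only [restr_of_mem hx, hx, if_true, ofReal_contraction_sq]
    · simp [restr_of_notMem hx, hx]
  simp_rw [h]
  rw [ENNReal.tsum_comm]
  refine tsum_congr fun l => ?_
  rw [tsum_eq_single (l j)]
  · by_cases hx : l j ∈ S <;> simp [restr_apply, hx]
  · intro x hx
    rw [if_neg hx.symm]

theorem norm_contraction_sub_restr (j : Fin d) (F : Finset J) (v : L2 (MIdx d J)) :
    ‖contraction j v - restr (F : Set J) (contraction j v)‖ =
      ‖restr {l : MIdx d J | l j ∉ F} v‖ := by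
  rw [sub_restr, norm_restr_contraction]
  rfl

theorem norm_contraction (j : Fin d) (v : L2 (MIdx d J)) : ‖contraction j v‖ = ‖v‖ := by
  have := norm_restr_contraction j Set.univ v
  rwa [restr_eq_self fun i hi => absurd (Set.mem_univ i) hi,
    restr_eq_self fun i hi => absurd (by trivial) hi] at this

/-- No cancellation can occur in a sum of squares. This turns statements on mode supports into
statements on single multi-indices. -/
theorem contraction_ne_zero_iff (j : Fin d) (v : L2 (MIdx d J)) (x : J) :
    contraction j v x ≠ 0 ↔ ∃ l : MIdx d J, l j = x ∧ v l ≠ 0 := by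
  classical
  have h0 : contraction j v x = 0 ↔ ENNReal.ofReal (contraction j v x ^ 2) = 0 := by
    rw [ENNReal.ofReal_eq_zero]
    constructor
    · intro h; simp [h]
    · intro h; exact pow_eq_zero_iff (two_ne_zero) |>.1 (le_antisymm h (sq_nonneg _))
  rw [Ne, h0, ofReal_contraction_sq, ENNReal.tsum_eq_zero]
  push Not
  refine exists_congr fun l => ?_
  by_cases h : l j = x
  · simp only [h, if_true, true_and]
    rw [Ne, ENNReal.ofReal_eq_zero, not_le, sq_pos_iff]
  · simp [h]

theorem tail_sq (v : L2 (MIdx d J)) (Λ : Fin d → Finset J) :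
    tail v Λ ^ 2 = ∑ j, ‖restr {l : MIdx d J | l j ∉ Λ j} v‖ ^ 2 := by
  rw [tail, Real.sq_sqrt (Finset.sum_nonneg fun j _ => sq_nonneg _)]
  simp_rw [norm_contraction_sub_restr]

theorem tail_nonneg (v : L2 (MIdx d J)) (Λ : Fin d → Finset J) : 0 ≤ tail v Λ :=
  Real.sqrt_nonneg _

theorem tail_le (v : L2 (MIdx d J)) (Λ : Fin d → Finset J) {b : ℝ} (hb : 0 ≤ b)
    (h : ∀ j, ‖restr {l : MIdx d J | l j ∉ Λ j} v‖ ≤ b) : tail v Λ ≤ √d * b := by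
  refine le_of_sq_le_sq ?_ (by positivity)
  rw [tail_sq, mul_pow, Real.sq_sqrt (Nat.cast_nonneg _)]
  refine (Finset.sum_le_sum fun j _ => pow_le_pow_left₀ (norm_nonneg _) (h j) 2).trans ?_
  simp

/-- The error of the restriction to a product set is bounded by the tail of the contractions. -/
theorem norm_sub_restr_box_le (v : L2 (MIdx d J)) (Λ : Fin d → Finset J) :
    ‖v - restr (box Λ) v‖ ≤ tail v Λ := by
  classical
  refine le_of_sq_le_sq ?_ (tail_nonneg _ _)
  rw [sub_restr, tail_sq, ← ENNReal.ofReal_le_ofReal_iff (by positivity),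
    ENNReal.ofReal_sum_of_nonneg fun _ _ => sq_nonneg _]
  simp_rw [ofReal_norm_sq]
  rw [← Summable.tsum_finsetSum fun _ _ => ENNReal.summable]
  refine ENNReal.tsum_le_tsum fun l => ?_
  by_cases hl : l ∈ box Λ
  · rw [restr_of_notMem (by simpa using hl)]; simp
  · rw [restr_of_mem (by simpa using hl)]
    obtain ⟨j, hj⟩ : ∃ j, l j ∉ Λ j := by
      by_contra! h
      exact hl h
    refine le_trans (le_of_eq ?_) (Finset.single_le_sum (f := fun j : Fin d =>
      ENNReal.ofReal (restr {l : MIdx d J | l j ∉ Λ j} v l ^ 2)) (fun _ _ => zero_le)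
      (Finset.mem_univ j))
    dsimp only
    rw [restr_of_mem (by exact hj)]

theorem tail_eq_zero {v : L2 (MIdx d J)} {Λ : Fin d → Finset J}
    (h : ∀ l, v l ≠ 0 → ∀ j, l j ∈ Λ j) : tail v Λ = 0 := by
  classical
  refine le_antisymm ((tail_le v Λ le_rfl fun j => le_of_eq ?_).trans (by simp))
    (tail_nonneg _ _)
  rw [norm_eq_zero]
  ext l
  rw [restr_apply]
  by_cases hl : v l = 0
  · simp [hl]
  · simp [h l hl j]

theorem suppIn_box_piFinset {Λ : Fin d → Finset J} {v : L2 (MIdx d J)}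
    [DecidableEq (Fin d)] (h : SuppIn (box Λ) v) :
    SuppIn (Fintype.piFinset Λ : Set (MIdx d J)) v :=
  h.mono fun l hl => by simpa [box] using hl

end Contractions

/-! ### Energy estimates for approximate Galerkin solutions -/

/-- `A` is symmetric with spectrum in `[lmin, lmax]`, where `lmin > 0`. -/
structure SpectralBounds {ι : Type*} (A : L2 ι →L[ℝ] L2 ι) (lmin lmax : ℝ) : Prop where
  symm : ∀ v w, inner ℝ (A v) w = inner ℝ v (A w)
  lmin_pos : 0 < lmin
  lmin_le : lmin ≤ lmax
  lower : ∀ v, lmin * ‖v‖ ^ 2 ≤ inner ℝ v (A v)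
  upper : ∀ v, inner ℝ v (A v) ≤ lmax * ‖v‖ ^ 2

namespace SpectralBounds

variable {ι : Type*} {A : L2 ι →L[ℝ] L2 ι} {lmin lmax : ℝ}

theorem lmax_pos (h : SpectralBounds A lmin lmax) : 0 < lmax := h.lmin_pos.trans_le h.lmin_le

theorem energy_add (h : SpectralBounds A lmin lmax) (e w : L2 ι) : inner ℝ (e + w) (A (e + w)) =
    inner ℝ e (A e) + 2 * inner ℝ (A e) w + inner ℝ w (A w) := by
  rw [map_add, inner_add_left, inner_add_right, inner_add_right, ← h.symm e w,
    real_inner_comm (A e) w]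
  ring

theorem energy_nonneg (h : SpectralBounds A lmin lmax) (e : L2 ι) : 0 ≤ inner ℝ e (A e) :=
  (mul_nonneg h.lmin_pos.le (sq_nonneg _)).trans (h.lower e)

/-- Quasi-optimality of an approximate Galerkin solution `x` in the energy norm. -/
theorem energy_le_of_residual_le (h : SpectralBounds A lmin lmax) {Λ : Set ι} {u x z : L2 ι}
    {δ : ℝ} (hx : SuppIn Λ (x - z))
    (hres : ‖restr Λ (A (u - x))‖ ≤ δ) :
    inner ℝ (u - x) (A (u - x)) ≤ inner ℝ (u - z) (A (u - z)) + δ ^ 2 / lmin := by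
  have h1 : u - z = (u - x) + (x - z) := by abel
  have h2 : inner ℝ (A (u - x)) (x - z) = inner ℝ (restr Λ (A (u - x))) (x - z) := by
    rw [inner_restr_left, restr_eq_self hx]
  have h3 : -(δ * ‖x - z‖) ≤ inner ℝ (A (u - x)) (x - z) := by
    rw [h2]
    have := (abs_le.1 (abs_real_inner_le_norm (restr Λ (A (u - x))) (x - z))).1
    have := mul_le_mul_of_nonneg_right hres (norm_nonneg (x - z))
    linarith
  have h4 := h.lower (x - z)
  -- The cross term is linear and the energy of `x - z` quadratic in `‖x - z‖`; completing the
  -- square leaves only `δ² / lmin`.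
  have h5 : 0 ≤ δ ^ 2 / lmin - 2 * (δ * ‖x - z‖) + lmin * ‖x - z‖ ^ 2 := by
    have : δ ^ 2 / lmin - 2 * (δ * ‖x - z‖) + lmin * ‖x - z‖ ^ 2 =
        (δ - lmin * ‖x - z‖) ^ 2 / lmin := by
      field_simp [h.lmin_pos.ne']
      ring
    rw [this]
    exact div_nonneg (sq_nonneg _) h.lmin_pos.le
  rw [h1, h.energy_add]
  linarith

/-- Energy reduction by a step in the direction of the restricted residual. -/
theorem energy_descent (h : SpectralBounds A lmin lmax) (Λ : Set ι) (e : L2 ι) :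
    inner ℝ (e - lmax⁻¹ • restr Λ (A e)) (A (e - lmax⁻¹ • restr Λ (A e))) ≤
      inner ℝ e (A e) - ‖restr Λ (A e)‖ ^ 2 / lmax := by
  have h0 := h.lmax_pos
  have h1 := h.upper (-(lmax⁻¹ • restr Λ (A e)))
  rw [sub_eq_add_neg, h.energy_add, inner_neg_right, inner_smul_right, inner_restr_self]
  rw [norm_neg, norm_smul, Real.norm_of_nonneg (inv_nonneg.2 h0.le)] at h1
  have h2 : lmax * (lmax⁻¹ * ‖restr Λ (A e)‖) ^ 2 = lmax⁻¹ * ‖restr Λ (A e)‖ ^ 2 := by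
    field_simp
  rw [h2] at h1
  rw [div_eq_inv_mul]
  linarith

/-- The gradient step on the full index set lowers the energy by `‖A e‖² / lmax` and cannot make it
negative. -/
theorem norm_apply_sq_le (h : SpectralBounds A lmin lmax)
    (e : L2 ι) : ‖A e‖ ^ 2 ≤ lmax * inner ℝ e (A e) := by
  have h1 := h.energy_descent Set.univ e
  have h2 := h.energy_nonneg (e - lmax⁻¹ • restr Set.univ (A e))
  rw [restr_eq_self fun i hi => absurd (Set.mem_univ i) hi] at h1 h2
  have h3 : ‖A e‖ ^ 2 / lmax ≤ inner ℝ e (A e) := by linarith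
  rwa [div_le_iff₀ h.lmax_pos, mul_comm] at h3

theorem lmin_mul_norm_le (h : SpectralBounds A lmin lmax) (e : L2 ι) : lmin * ‖e‖ ≤ ‖A e‖ := by
  rcases (norm_nonneg e).eq_or_lt with h0 | h0
  · rw [← h0]; simp
  have h1 := (h.lower e).trans (real_inner_le_norm e (A e))
  exact le_of_mul_le_mul_left (by nlinarith) h0

/-- Cauchy–Schwarz gives energy at most `‖e‖ ‖A e‖`, and `‖e‖` is at most `lmin⁻¹ ‖A e‖`. -/
theorem energy_le_norm_apply_sq (h : SpectralBounds A lmin lmax) (e : L2 ι) :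
    lmin * inner ℝ e (A e) ≤ ‖A e‖ ^ 2 := by
  have h1 := real_inner_le_norm e (A e)
  have h2 := h.lmin_mul_norm_le e
  have h3 := mul_le_mul_of_nonneg_left h1 h.lmin_pos.le
  have h4 := mul_le_mul_of_nonneg_right h2 (norm_nonneg (A e))
  nlinarith

/-- Error reduction by one inner iteration on an index set which captures the fraction `α` of an
approximate residual `r`. -/
theorem energy_step (h : SpectralBounds A lmin lmax) {Λ : Set ι} {u x x' r : L2 ι} {α ω₁ ω₂ : ℝ}
    (hω₁ : 0 < ω₁) (hα : ω₁ < α)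
    (hα1 : α < 1) (hx : SuppIn Λ x) (hx' : SuppIn Λ x')
    (hr : ‖A (u - x) - r‖ ≤ ω₁ * ‖r‖) (hbulk : α * ‖r‖ ≤ ‖restr Λ r‖)
    (hres : ‖restr Λ (A (u - x'))‖ ≤ ω₂ * ‖r‖) :
    inner ℝ (u - x') (A (u - x')) ≤ (1 - ((α - ω₁) / (1 + ω₁)) ^ 2 * (lmax / lmin)⁻¹ +
      (ω₂ / (1 - ω₁)) ^ 2 * (lmax / lmin)) * inner ℝ (u - x) (A (u - x)) := by
  have hlmin := h.lmin_pos
  have hlmax := h.lmax_pos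
  set e := u - x with he
  set N := inner ℝ e (A e) with hN
  have h1 : ‖A e‖ ≤ (1 + ω₁) * ‖r‖ := by
    have := norm_add_le (A e - r) r
    rw [sub_add_cancel] at this
    linarith
  have h2 : (1 - ω₁) * ‖r‖ ≤ ‖A e‖ := by
    have := norm_sub_norm_le r (A e)
    rw [norm_sub_rev] at this
    linarith
  have h3 : (α - ω₁) * ‖r‖ ≤ ‖restr Λ (A e)‖ := by
    have h4 := norm_sub_norm_le (restr Λ r) (restr Λ (A e))
    rw [← restr_sub] at h4
    have h5 := norm_restr_le Λ (r - A e)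
    rw [norm_sub_rev] at h5
    linarith
  have h4 : (α - ω₁) / (1 + ω₁) * ‖A e‖ ≤ ‖restr Λ (A e)‖ := by
    refine le_trans ?_ h3
    rw [div_mul_eq_mul_div, div_le_iff₀ (by linarith)]
    have := mul_le_mul_of_nonneg_left h1 (sub_pos.2 hα).le
    linarith
  have h5 : ((α - ω₁) / (1 + ω₁)) ^ 2 * (lmax / lmin)⁻¹ * N ≤ ‖restr Λ (A e)‖ ^ 2 / lmax := by
    have hb : 0 ≤ (α - ω₁) / (1 + ω₁) := div_nonneg (by linarith) (by linarith)
    have h6 := pow_le_pow_left₀ (mul_nonneg hb (norm_nonneg _)) h4 2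
    rw [mul_pow] at h6
    have h7 := mul_le_mul_of_nonneg_left (h.energy_le_norm_apply_sq e)
      (sq_nonneg ((α - ω₁) / (1 + ω₁)))
    rw [le_div_iff₀ hlmax, inv_div]
    calc _ = ((α - ω₁) / (1 + ω₁)) ^ 2 * (lmin * N) := by field_simp
      _ ≤ _ := h7.trans h6
  have h6 : (ω₂ * ‖r‖) ^ 2 / lmin ≤ (ω₂ / (1 - ω₁)) ^ 2 * (lmax / lmin) * N := by
    have hp : 0 < 1 - ω₁ := by linarith
    have h7 := pow_le_pow_left₀ (mul_nonneg hp.le (norm_nonneg _)) h2 2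
    have h8 := h7.trans (h.norm_apply_sq_le e)
    rw [mul_pow] at h8
    rw [div_pow, mul_pow]
    calc ω₂ ^ 2 * ‖r‖ ^ 2 / lmin
        = ω₂ ^ 2 / (1 - ω₁) ^ 2 / lmin * ((1 - ω₁) ^ 2 * ‖r‖ ^ 2) := by field_simp
      _ ≤ ω₂ ^ 2 / (1 - ω₁) ^ 2 / lmin * (lmax * N) :=
        mul_le_mul_of_nonneg_left h8 (by positivity)
      _ = _ := by field_simp
  have h7 := h.energy_descent Λ e
  -- The competitor in the quasi-optimality is the gradient step from `x` restricted to `Λ`; the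
  -- solver inherits its energy reduction up to the residual tolerance.
  have h8 : SuppIn Λ (x' - (x + lmax⁻¹ • restr Λ (A e))) :=
    hx'.sub (hx.add ((suppIn_restr _ _).smul _))
  have h9 := h.energy_le_of_residual_le h8 hres
  rw [← sub_sub, ← he] at h9
  linarith

end SpectralBounds

/-! ### The result of the truncated conjugate gradient method -/

/-- Only three facts about the CG method enter: it stays in `ℓ₂(Λ)`, it ends with a small Galerkin
residual, and it returns its start if that is good enough. Its convergence rate plays no role. -/
theorem IsPCG.suppIn {ι : Type*} {A : L2 ι →L[ℝ] L2 ι} {f x₀ x' : L2 ι} {Λ : Set ι} {tol : ℝ}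
    (h : IsPCG A f x₀ Λ tol x') (h₀ : SuppIn Λ x₀) : SuppIn Λ x' := by
  obtain ⟨c, I, x, r, p, e₁, e₂, a, b, -, he, hx0, hr, hp0, hstep, -, -, -, -, rfl⟩ := h
  have hr' : ∀ i, SuppIn Λ (r i) := fun i => hr i ▸ suppIn_restr _ _
  suffices ∀ i ≤ I, SuppIn Λ (x i) ∧ SuppIn Λ (p i) from (this I le_rfl).1
  intro i
  induction i with
  | zero => exact fun _ => ⟨hx0 ▸ h₀, hp0 ▸ (hr' 0).add (he 0).1⟩
  | succ i ih =>
    intro hi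
    obtain ⟨hx, hp⟩ := ih (by omega)
    obtain ⟨-, hx', -, hp'⟩ := hstep i (by omega)
    exact ⟨hx' ▸ (hx.add (hp.smul _)).add (he (i + 1)).2,
      hp' ▸ ((hr' (i + 1)).add (hp.smul _)).add (he (i + 1)).1⟩

theorem IsPCG.norm_residual_le {ι : Type*} {A : L2 ι →L[ℝ] L2 ι} {f x₀ x' : L2 ι} {Λ : Set ι}
    {tol : ℝ} (h : IsPCG A f x₀ Λ tol x') : ‖restr Λ (f - A x')‖ ≤ tol := by
  obtain ⟨c, I, x, r, p, e₁, e₂, a, b, -, -, -, hr, -, -, -, -, -, hI, rfl⟩ := h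
  rwa [← hr I]

/-- Every step before the last requires a residual above `tol`, so a small initial residual forces
`I = 0`. -/
theorem IsPCG.eq_of_residual_le {ι : Type*} {A : L2 ι →L[ℝ] L2 ι} {f x₀ x' : L2 ι} {Λ : Set ι}
    {tol : ℝ} (h : IsPCG A f x₀ Λ tol x') (h₀ : ‖restr Λ (f - A x₀)‖ ≤ tol) : x' = x₀ := by
  obtain ⟨c, I, x, r, p, e₁, e₂, a, b, -, -, hx0, hr, -, -, -, -, hlt, -, rfl⟩ := h
  rcases I.eq_zero_or_pos with rfl | hI
  · exact hx0
  · have := hlt 0 hI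
    rw [hr 0, hx0] at this
    exact absurd h₀ (not_le.2 this)

/-! ### Contractions of hierarchical HOSVD truncations -/

section ModeProjections

variable {d : ℕ} {J : Type*}

/-- Replace the entries of the multi-index `m` in the modes with property `p` by those of `y`. -/
def glue (p : Fin d → Prop) [DecidablePred p] (y : {i // p i} → J) (m : MIdx d J) : MIdx d J :=
  fun i => if h : p i then y ⟨i, h⟩ else m i

/-- The part of a multi-index in the modes with property `p`. -/
def part (p : Fin d → Prop) (m : MIdx d J) : {i // p i} → J := fun i => m i

/-- The operator, acting on the modes with property `p`, with kernel `∑_{k<ρ} U_k ⊗ U_k`. -/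
def modeProj (p : Fin d → Prop) [DecidablePred p] {n : ℕ} (U : Fin n → (({i // p i} → J) →₀ ℝ))
    (ρ : ℕ) (x : MIdx d J → ℝ) : MIdx d J → ℝ := fun m =>
  ∑ k : Fin n, if (k : ℕ) < ρ then
    U k (part p m) * (U k).sum fun y c => c * x (glue p y m) else 0

theorem MatSVD.proj_eq_modeProj {α : Finset (Fin d)} {v : MIdx d J → ℝ} (S : MatSVD α v) (ρ : ℕ)
    (x : MIdx d J → ℝ) : S.proj ρ x = modeProj (fun i => i ∈ α) S.left ρ x := by
  rfl

theorem part_glue_of_disjoint {p q : Fin d → Prop} [DecidablePred p] (h : ∀ i, p i → ¬ q i)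
    (y : {i // p i} → J) (m : MIdx d J) : part q (glue p y m) = part q m := by
  funext i
  simp only [part, glue]
  rw [dif_neg fun hp => h _ hp i.2]

theorem glue_comm {p q : Fin d → Prop} [DecidablePred p] [DecidablePred q]
    (h : ∀ i, p i → ¬ q i) (y : {i // p i} → J) (z : {i // q i} → J) (m : MIdx d J) :
    glue p y (glue q z m) = glue q z (glue p y m) := by
  funext i
  simp only [glue]
  by_cases hp : p i
  · simp [hp, h i hp]
  · simp [hp]

/-- Projections which act on disjoint sets of modes commute. -/
theorem modeProj_comm {p q : Fin d → Prop} [DecidablePred p] [DecidablePred q]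
    (h : ∀ i, p i → ¬ q i) {n n' : ℕ} (U : Fin n → (({i // p i} → J) →₀ ℝ))
    (V : Fin n' → (({i // q i} → J) →₀ ℝ)) (ρ ρ' : ℕ) (x : MIdx d J → ℝ) :
    modeProj p U ρ (modeProj q V ρ' x) = modeProj q V ρ' (modeProj p U ρ x) := by
  have h' : ∀ i, q i → ¬ p i := fun i hq hp => h i hp hq
  funext m
  have key : ∀ (k : Fin n) (l : Fin n'),
      (U k (part p m) * ∑ y ∈ (U k).support, U k y *
        (V l (part q m) * ∑ z ∈ (V l).support, V l z * x (glue q z (glue p y m)))) =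
      (V l (part q m) * ∑ z ∈ (V l).support, V l z *
        (U k (part p m) * ∑ y ∈ (U k).support, U k y * x (glue p y (glue q z m)))) := by
    intro k l
    simp only [Finset.mul_sum]
    rw [Finset.sum_comm]
    refine Finset.sum_congr rfl fun z _ => Finset.sum_congr rfl fun y _ => ?_
    rw [glue_comm h]
    ring
  -- Stated for arbitrary disjoint `p`, `q`, so that it serves both orders of composition.
  have expand : ∀ {p q : Fin d → Prop} [DecidablePred p] [DecidablePred q]
      (_ : ∀ i, p i → ¬ q i) {n n' : ℕ} (U : Fin n → (({i // p i} → J) →₀ ℝ))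
      (V : Fin n' → (({i // q i} → J) →₀ ℝ)) (ρ ρ' : ℕ),
      modeProj p U ρ (modeProj q V ρ' x) m = ∑ k : Fin n, ∑ l : Fin n',
        if (k : ℕ) < ρ ∧ (l : ℕ) < ρ' then
          (U k (part p m) * ∑ y ∈ (U k).support, U k y *
            (V l (part q m) * ∑ z ∈ (V l).support, V l z * x (glue q z (glue p y m))))
        else 0 := by
    intro p q _ _ h n n' U V ρ ρ'
    simp only [modeProj, Finsupp.sum, part_glue_of_disjoint h]
    refine Finset.sum_congr rfl fun k _ => ?_
    split_ifs with hk
    · simp only [hk, true_and, Finset.mul_sum (s := Finset.univ)]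
      rw [Finset.sum_comm, Finset.mul_sum]
      refine Finset.sum_congr rfl fun l _ => ?_
      split_ifs with hl
      · rfl
      · simp
    · simp [hk]
  rw [expand h, expand h', Finset.sum_comm]
  refine Finset.sum_congr rfl fun l _ => Finset.sum_congr rfl fun k _ => ?_
  rw [key k l]
  simp only [and_comm]

/-- Bessel's inequality for finitely supported orthonormal functions. -/
theorem tsum_sq_proj_le {X : Type*} {n : ℕ} (U : Fin n → (X →₀ ℝ))
    (hU : ∀ k l, ((U k).sum fun x c => c * U l x) = if k = l then 1 else 0) (ρ : ℕ) (F : X → ℝ) :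
    ∑' y, ENNReal.ofReal ((∑ k : Fin n, if (k : ℕ) < ρ then
      U k y * (U k).sum fun y' c => c * F y' else 0) ^ 2) ≤ ∑' y, ENNReal.ofReal (F y ^ 2) := by
  classical
  -- All `U k` live on the finite set `W`: the left side is a finite sum even when the right side is
  -- infinite.
  set W : Finset X := Finset.univ.biUnion fun k => (U k).support with hW
  have hsub : ∀ k, (U k).support ⊆ W := fun k =>
    Finset.subset_biUnion_of_mem (fun k => (U k).support) (Finset.mem_univ k)
  have hsum : ∀ k (G : X → ℝ), ((U k).sum fun y c => c * G y) = ∑ y ∈ W, U k y * G y :=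
    fun k G => Finset.sum_subset (hsub k) fun y _ hy => by simp [Finsupp.notMem_support_iff.1 hy]
  simp_rw [hsum] at hU ⊢
  set c : Fin n → ℝ := fun k => if (k : ℕ) < ρ then ∑ y ∈ W, U k y * F y else 0 with hc
  set G : X → ℝ := fun y => ∑ k, c k * U k y with hG
  have hG' : ∀ y, (∑ k : Fin n, if (k : ℕ) < ρ then U k y * ∑ y' ∈ W, U k y' * F y' else 0)
      = G y := fun y => Finset.sum_congr rfl fun k _ => by
    simp only [hc]; split_ifs <;> ring
  simp_rw [hG']
  have hout : ∀ y ∉ W, ENNReal.ofReal (G y ^ 2) = 0 := fun y hy => by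
    have : G y = 0 := Finset.sum_eq_zero fun k _ => by
      rw [Finsupp.notMem_support_iff.1 fun h => hy (hsub k h), mul_zero]
    simp [this]
  rw [tsum_eq_sum hout]
  refine le_trans ?_ (ENNReal.sum_le_tsum W)
  rw [← ENNReal.ofReal_sum_of_nonneg fun _ _ => sq_nonneg _,
    ← ENNReal.ofReal_sum_of_nonneg fun _ _ => sq_nonneg _]
  refine ENNReal.ofReal_le_ofReal ?_
  -- With `G` the projection of `F`, both `⟨F, G⟩` and `‖G‖²` equal `∑ c_k²`, so `0 ≤ ‖F - G‖²` is
  -- the assertion.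
  have h1 : ∑ y ∈ W, F y * G y = ∑ k, c k ^ 2 := by
    simp only [hG, Finset.mul_sum]
    rw [Finset.sum_comm]
    refine Finset.sum_congr rfl fun k _ => ?_
    have : ∑ y ∈ W, F y * (c k * U k y) = c k * ∑ y ∈ W, U k y * F y := by
      rw [Finset.mul_sum]; exact Finset.sum_congr rfl fun _ _ => by ring
    rw [this]
    simp only [hc]
    split_ifs <;> ring
  have h2 : ∑ y ∈ W, G y ^ 2 = ∑ k, c k ^ 2 := by
    have : ∀ y, G y ^ 2 = ∑ k, ∑ l, c k * c l * (U k y * U l y) := fun y => by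
      rw [sq, hG, Finset.sum_mul_sum]
      exact Finset.sum_congr rfl fun _ _ => Finset.sum_congr rfl fun _ _ => by ring
    simp_rw [this]
    rw [Finset.sum_comm]
    refine Finset.sum_congr rfl fun k _ => ?_
    rw [Finset.sum_comm]
    simp_rw [← Finset.mul_sum, hU]
    simp [sq]
  have h3 : 0 ≤ ∑ y ∈ W, (F y - G y) ^ 2 := Finset.sum_nonneg fun _ _ => sq_nonneg _
  have h4 : ∑ y ∈ W, (F y - G y) ^ 2 =
      ∑ y ∈ W, F y ^ 2 - 2 * ∑ y ∈ W, F y * G y + ∑ y ∈ W, G y ^ 2 := by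
    rw [Finset.mul_sum, ← Finset.sum_sub_distrib, ← Finset.sum_add_distrib]
    exact Finset.sum_congr rfl fun _ _ => by ring
  linarith

open Classical in
/-- The sum of the squares of all entries with `j`-th index in `S`. -/
def slabSum (j : Fin d) (S : Set J) (x : MIdx d J → ℝ) : ℝ≥0∞ :=
  ∑' l : MIdx d J, if l j ∈ S then ENNReal.ofReal (x l ^ 2) else 0

theorem ofReal_norm_restr_sq (j : Fin d) (S : Set J) (v : L2 (MIdx d J)) :
    ENNReal.ofReal (‖restr {l : MIdx d J | l j ∈ S} v‖ ^ 2) = slabSum j S v := by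
  classical
  rw [ofReal_norm_sq]
  refine tsum_congr fun l => ?_
  by_cases hl : l j ∈ S <;> simp [restr_apply, hl]

/-- Projections which do not act on the mode `j` do not increase the contraction to `j`. -/
theorem slabSum_modeProj_le {p : Fin d → Prop} [DecidablePred p] {n : ℕ}
    (U : Fin n → (({i // p i} → J) →₀ ℝ))
    (hU : ∀ k l, ((U k).sum fun x c => c * U l x) = if k = l then 1 else 0)
    (ρ : ℕ) {j : Fin d} (hj : ¬ p j) (S : Set J) (x : MIdx d J → ℝ) :
    slabSum j S (modeProj p U ρ x) ≤ slabSum j S x := by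
  classical
  set e := Equiv.piEquivPiSubtypeProd p (fun _ : Fin d => J) with he
  have hej : ∀ y z, e.symm (y, z) j = z ⟨j, hj⟩ := fun y z => by
    simp [he, Equiv.piEquivPiSubtypeProd, hj]
  have hpart : ∀ y z, part p (e.symm (y, z)) = y := fun y z => by
    funext i
    simp [part, he, Equiv.piEquivPiSubtypeProd, i.2]
  have hglue : ∀ y y' z, glue p y' (e.symm (y, z)) = e.symm (y', z) := fun y y' z => by
    funext i
    by_cases hi : p i <;> simp [glue, he, Equiv.piEquivPiSubtypeProd, hi]
  unfold slabSum
  rw [← e.symm.tsum_eq, ← e.symm.tsum_eq (fun l : MIdx d J =>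
    if l j ∈ S then ENNReal.ofReal (x l ^ 2) else 0), ENNReal.tsum_prod', ENNReal.tsum_prod',
    ENNReal.tsum_comm, ENNReal.tsum_comm (f := fun y z => if e.symm (y, z) j ∈ S then
      ENNReal.ofReal (x (e.symm (y, z)) ^ 2) else 0)]
  -- The modes in `z` are untouched and include `j`, so the slab condition is constant on the fibre
  -- and Bessel's inequality applies there.
  refine ENNReal.tsum_le_tsum fun z => ?_
  simp_rw [hej]
  by_cases hz : z ⟨j, hj⟩ ∈ S
  · simp only [hz, if_true, modeProj, hpart, hglue]
    exact tsum_sq_proj_le U hU ρ fun y => x (e.symm (y, z))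
  · simp [hz]

/-- The projection onto leading left singular vectors, applied to the decomposed tensor, is the
projection onto the corresponding right singular vectors. -/
theorem MatSVD.proj_self {α : Finset (Fin d)} {v : MIdx d J → ℝ} (S : MatSVD α v) (ρ : ℕ) :
    S.proj ρ v = modeProj (fun i => i ∉ α) S.right ρ v := by
  rw [S.proj_eq_modeProj]
  have hv : ∀ m, v m = ∑ k, S.σ k * S.left k (part (fun i => i ∈ α) m) *
      S.right k (part (fun i => i ∉ α) m) := S.eq_sum
  have hp : ∀ (y : {i // i ∈ α} → J) m, part (fun i => i ∈ α) (glue (fun i => i ∈ α) y m) = y := by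
    intro y m
    funext i
    simp [part, glue, i.2]
  have hq : ∀ (y : {i // i ∉ α} → J) m, part (fun i => i ∉ α) (glue (fun i => i ∉ α) y m) = y := by
    intro y m
    funext i
    simp [part, glue, i.2]
  have hpq : ∀ (y : {i // i ∈ α} → J) m, part (fun i => i ∉ α) (glue (fun i => i ∈ α) y m) =
      part (fun i => i ∉ α) m := fun y m => part_glue_of_disjoint (fun i h h' => h' h) y m
  have hqp : ∀ (y : {i // i ∉ α} → J) m, part (fun i => i ∈ α) (glue (fun i => i ∉ α) y m) =
      part (fun i => i ∈ α) m := fun y m => part_glue_of_disjoint (fun i h h' => h h') y m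
  have hl : ∀ k l, ∑ y ∈ (S.left k).support, S.left k y * S.left l y = if k = l then 1 else 0 :=
    S.left_orth
  have hr : ∀ k l, ∑ y ∈ (S.right k).support, S.right k y * S.right l y =
      if k = l then 1 else 0 := S.right_orth
  funext m
  simp only [modeProj, Finsupp.sum]
  refine Finset.sum_congr rfl fun k _ => ?_
  -- By orthonormality both projections keep exactly the terms `σ k · left k ⊗ right k` with `k <
  -- ρ`.
  have h1 : ∑ y ∈ (S.left k).support, S.left k y * v (glue (fun i => i ∈ α) y m) =
      S.σ k * S.right k (part (fun i => i ∉ α) m) := by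
    simp_rw [hv, hp, hpq, Finset.mul_sum]
    rw [Finset.sum_comm]
    calc _ = ∑ l, S.σ l * S.right l (part (fun i => i ∉ α) m) *
          ∑ y ∈ (S.left k).support, S.left k y * S.left l y := by
          simp_rw [Finset.mul_sum]
          exact Finset.sum_congr rfl fun _ _ => Finset.sum_congr rfl fun _ _ => by ring
      _ = _ := by simp [hl]
  have h2 : ∑ y ∈ (S.right k).support, S.right k y * v (glue (fun i => i ∉ α) y m) =
      S.σ k * S.left k (part (fun i => i ∈ α) m) := by
    simp_rw [hv, hq, hqp, Finset.mul_sum]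
    rw [Finset.sum_comm]
    calc _ = ∑ l, S.σ l * S.left l (part (fun i => i ∈ α) m) *
          ∑ y ∈ (S.right k).support, S.right k y * S.right l y := by
          simp_rw [Finset.mul_sum]
          exact Finset.sum_congr rfl fun _ _ => Finset.sum_congr rfl fun _ _ => by ring
      _ = _ := by simp [hr]
  rw [h1, h2]
  split_ifs <;> ring

end ModeProjections

/-! ### Moving the projections of a dimension tree away from one mode. -/

section Trees

variable {d : ℕ} {J : Type*}

/-- An operator which commutes with all `P β`, `β ⊆ α`, commutes with the operators of a subtree. -/
theorem DimTree.applyAll_comm {X : Type*} (P : Finset (Fin d) → X → X) (W : X → X) :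
    ∀ t : DimTree d, (∀ β ⊆ t.modes, ∀ x, P β (W x) = W (P β x)) →
      ∀ x, t.applyAll P (W x) = W (t.applyAll P x)
  | .leaf _, _, _ => rfl
  | .node l r, h, x => by
    have hl : l.modes ⊆ (DimTree.node l r).modes := Finset.subset_union_left
    have hr : r.modes ⊆ (DimTree.node l r).modes := Finset.subset_union_right
    simp only [DimTree.applyAll]
    rw [h _ hl, h _ hr, l.applyAll_comm P W fun β hβ => h β (hβ.trans hl),
      r.applyAll_comm P W fun β hβ => h β (hβ.trans hr)]

theorem DimTree.applyAll_le {X : Type*} (P : Finset (Fin d) → X → X) (N : X → ℝ≥0∞) (j : Fin d)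
    (hP : ∀ α, j ∉ α → ∀ x, N (P α x) ≤ N x) :
    ∀ t : DimTree d, j ∉ t.modes → ∀ x, N (t.applyAll P x) ≤ N x
  | .leaf _, _, _ => le_rfl
  | .node l r, h, x => by
    simp only [DimTree.modes, Finset.mem_union, not_or] at h
    exact (r.applyAll_le P N j hP h.2 _).trans ((l.applyAll_le P N j hP h.1 _).trans
      ((hP _ h.2 _).trans (hP _ h.1 _)))

/-- If on `v` each `P α` acts like an operator `Q α` on the complementary modes, then applying all
`P α` from the root to the leaves does not increase contractions of `v`. -/
theorem DimTree.applyAll_le_self {X : Type*} (P Q : Finset (Fin d) → X → X) (N : X → ℝ≥0∞)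
    (j : Fin d) (v : X) (hPQ : ∀ α, P α v = Q α v)
    (hP : ∀ α, j ∉ α → ∀ x, N (P α x) ≤ N x) (hQ : ∀ α, j ∈ α → ∀ x, N (Q α x) ≤ N x)
    (hPP : ∀ α β, Disjoint α β → ∀ x, P α (P β x) = P β (P α x))
    (hPQc : ∀ α β, α ⊆ β → ∀ x, P α (Q β x) = Q β (P α x)) :
    ∀ t : DimTree d, t.Proper → j ∈ t.modes → ∀ W : X → X, (∀ x, N (W x) ≤ N x) →
      (∀ β ⊆ t.modes, ∀ x, P β (W x) = W (P β x)) → N (t.applyAll P (W v)) ≤ N v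
  | .leaf _, _, _, W, hW, _ => hW v
  | .node l r, ht, hj, W, hW, hc => by
    obtain ⟨hdis, hlp, hrp⟩ := ht
    have hl : l.modes ⊆ (DimTree.node l r).modes := Finset.subset_union_left
    have hr : r.modes ⊆ (DimTree.node l r).modes := Finset.subset_union_right
    simp only [DimTree.applyAll]
    -- `W` collects the operators already known not to increase `N`. The projection of the child
    -- containing `j` is moved past `W` to `v`, replaced there by `Q`, and then absorbed in `W`; the
    -- sibling's projections do not touch `j`.
    rcases Finset.mem_union.1 hj with hjl | hjr
    · have hjr : j ∉ r.modes := Finset.disjoint_left.1 hdis hjl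
      refine (r.applyAll_le P N j hP hjr _).trans ?_
      rw [hc _ hl, hPQ]
      refine l.applyAll_le_self P Q N j v hPQ hP hQ hPP hPQc hlp hjl
        (fun x => P r.modes (W (Q l.modes x)))
        (fun x => (hP _ hjr _).trans ((hW _).trans (hQ _ hjl _))) fun β hβ x => ?_
      rw [hPP β r.modes (Finset.disjoint_of_subset_left hβ hdis), hc β (hβ.trans hl),
        hPQc β _ hβ]
    -- The left subtree acts before the right one, so here it cannot be dropped from the outside and
    -- is absorbed in `W` as well.
    · have hjl : j ∉ l.modes := Finset.disjoint_right.1 hdis hjr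
      rw [hPP r.modes l.modes hdis.symm, hc _ hr, hPQ]
      refine r.applyAll_le_self P Q N j v hPQ hP hQ hPP hPQc hrp hjr
        (fun x => l.applyAll P (P l.modes (W (Q r.modes x))))
        (fun x => (l.applyAll_le P N j hP hjl _).trans
          ((hP _ hjl _).trans ((hW _).trans (hQ _ hjr _)))) fun β hβ x => ?_
      rw [← l.applyAll_comm P (P β) fun α hα x => hPP α β
        (Finset.disjoint_of_subset_left hα (Finset.disjoint_of_subset_right hβ hdis)) x,
        hPP β l.modes (Finset.disjoint_of_subset_left hβ hdis.symm), hc β (hβ.trans hr),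
        hPQc β _ hβ]

/-- Hierarchical HOSVD truncation does not increase the contractions of a tensor. -/
theorem IsTrunc.norm_restr_le {t : DimTree d} (ht : t.IsDimTree) {v w : L2 (MIdx d J)} {ε : ℝ}
    (h : IsTrunc t v ε w) (j : Fin d) (S : Set J) :
    ‖restr {l : MIdx d J | l j ∈ S} w‖ ≤ ‖restr {l : MIdx d J | l j ∈ S} v‖ := by
  obtain ⟨D, ρ, hw, -⟩ := h
  refine le_of_sq_le_sq ?_ (norm_nonneg _)
  rw [← ENNReal.ofReal_le_ofReal_iff (sq_nonneg _), ofReal_norm_restr_sq, ofReal_norm_restr_sq]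
  have hw' : (w : MIdx d J → ℝ) = t.applyAll (fun α => (D α).proj (ρ α)) v := funext hw
  rw [hw']
  refine t.applyAll_le_self (fun α => (D α).proj (ρ α))
    (fun α => modeProj (fun i => i ∉ α) (D α).right (ρ α)) (slabSum j S) j v
    (fun α => (D α).proj_self (ρ α)) ?_ ?_ ?_ ?_ ht.2 (ht.1 ▸ Finset.mem_univ j) id
    (fun _ => le_rfl) fun _ _ _ => rfl
  · intro α hα x
    simp only [MatSVD.proj_eq_modeProj]
    exact slabSum_modeProj_le _ (D α).left_orth _ hα S x
  · intro α hα x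
    exact slabSum_modeProj_le _ (D α).right_orth _ (not_not.2 hα) S x
  · intro α β hαβ x
    simp only [MatSVD.proj_eq_modeProj]
    exact modeProj_comm (fun i hi => Finset.disjoint_left.1 hαβ hi) _ _ _ _ x
  · intro α β hαβ x
    simp only [MatSVD.proj_eq_modeProj]
    exact modeProj_comm (fun i hi => not_not.2 (hαβ hi)) _ _ _ _ x

end Trees

/-! ### The separable scaling is dominated by the diagonal scaling -/

theorem expTerm_pos {h : ℝ} (hh : 0 < h) (x t : ℝ) : 0 < expTerm h x t := by
  unfold expTerm
  positivity

/-- With `y = e^x √t / (1 + e^X)`, the weight is at most a multiple of `e^x` and `ln(1 + e^x) √t ≥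
y`. Replacing the Gaussian by a rational function of `y` makes the sum over a geometric sequence of
`y` telescope. -/
theorem expTerm_le {h x X t : ℝ} (hh : 0 < h) (hx : x ≤ X) (ht : 0 < t) :
    expTerm h x t ≤ h * (4 / √Real.pi) * (1 + Real.exp X) / √t *
      ((Real.exp x * √t / (1 + Real.exp X)) / (1 + Real.exp x * √t / (1 + Real.exp X)) ^ 2) := by
  set z := Real.exp x with hz
  set B := 1 + Real.exp X with hB
  have hz0 : 0 < z := Real.exp_pos x
  have hB0 : 0 < B := by positivity
  have hst : 0 < √t := Real.sqrt_pos.2 ht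
  have hzB : 1 + z ≤ B := by
    have := Real.exp_le_exp.2 hx
    simp only [hB, hz]; linarith
  set y := z * √t / B with hy
  have hy0 : 0 < y := by positivity
  have h1 : (1 + Real.exp (-x))⁻¹ ≤ z := by
    rw [Real.exp_neg, ← hz]
    rw [inv_le_comm₀ (by positivity) hz0]
    linarith
  have h2 : z / B ≤ Real.log (1 + z) := by
    have h3 := Real.one_sub_inv_le_log_of_pos (show 0 < 1 + z by positivity)
    refine le_trans ?_ h3
    have : 1 - (1 + z)⁻¹ = z / (1 + z) := by field_simp; ring
    rw [this]
    exact div_le_div_of_nonneg_left hz0.le (by positivity) hzB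
  have h3 : y ^ 2 ≤ Real.log (1 + z) ^ 2 * t := by
    have h4 := pow_le_pow_left₀ (by positivity) h2 2
    have h5 : y ^ 2 = (z / B) ^ 2 * t := by
      rw [hy, mul_div_right_comm, mul_pow, Real.sq_sqrt ht.le]
    rw [h5]
    exact mul_le_mul_of_nonneg_right h4 ht.le
  -- `e^a ≥ 1 + a` for `a ≥ y²`, and `1 + y² ≥ (1 + y)² / 2`.
  have h4 : Real.exp (-(Real.log (1 + z) ^ 2 * t)) ≤ 2 / (1 + y) ^ 2 := by
    rw [Real.exp_neg]
    have h5 : 1 + y ^ 2 ≤ Real.exp (Real.log (1 + z) ^ 2 * t) := by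
      have := Real.add_one_le_exp (Real.log (1 + z) ^ 2 * t)
      linarith
    rw [inv_eq_one_div, div_le_div_iff₀ (Real.exp_pos _) (by positivity)]
    nlinarith [sq_nonneg (1 - y)]
  have h5 : expTerm h x t ≤ h * (2 / √Real.pi * z) * (2 / (1 + y) ^ 2) := by
    unfold expTerm
    gcongr
  refine h5.trans (le_of_eq ?_)
  have h6 : z = y * B / √t := by rw [hy]; field_simp
  rw [h6]
  field_simp
  ring

/-- Each term is dominated by `(1 - q)⁻¹` times the increment of `y / (1 + y)` from `q y` to `y`.
Telescoping gives a bound independent of `y₀`, hence of `t`. -/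
theorem sum_geometric_le {q y₀ : ℝ} (hq : 0 < q) (hq1 : q < 1) (hy : 0 < y₀) (N : ℕ) :
    ∑ i ∈ Finset.range N, (y₀ * q ^ i) / (1 + y₀ * q ^ i) ^ 2 ≤ (1 - q)⁻¹ := by
  have key : ∀ y : ℝ, 0 < y →
      y / (1 + y) ^ 2 ≤ (1 - q)⁻¹ * (y / (1 + y) - q * y / (1 + q * y)) := by
    intro y hy
    have h1 : y / (1 + y) - q * y / (1 + q * y) = (1 - q) * (y / ((1 + y) * (1 + q * y))) := by
      field_simp
      ring
    rw [h1, inv_mul_cancel_left₀ (by linarith)]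
    refine div_le_div_of_nonneg_left hy.le (by positivity) ?_
    rw [sq]
    refine mul_le_mul_of_nonneg_left ?_ (by positivity)
    have := mul_le_of_le_one_left hy.le hq1.le
    linarith
  have h : ∀ N : ℕ, ∑ i ∈ Finset.range N, (y₀ * q ^ i) / (1 + y₀ * q ^ i) ^ 2 ≤
      (1 - q)⁻¹ * (y₀ / (1 + y₀) - y₀ * q ^ N / (1 + y₀ * q ^ N)) := by
    intro N
    induction N with
    | zero => simp
    | succ N ih =>
      rw [Finset.sum_range_succ]
      have := key (y₀ * q ^ N) (by positivity)
      have e : q * (y₀ * q ^ N) = y₀ * q ^ (N + 1) := by ring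
      rw [e] at this
      linarith
  refine (h N).trans ?_
  have h1 : 0 ≤ (1 - q)⁻¹ := inv_nonneg.2 (by linarith)
  have h2 : y₀ / (1 + y₀) ≤ 1 := by rw [div_le_one (by positivity)]; linarith
  have h3 : 0 ≤ y₀ * q ^ N / (1 + y₀ * q ^ N) := by positivity
  exact mul_le_of_le_one_right h1 (by linarith)

/-- The nodes are equispaced, so the arguments `y` form a geometric sequence of ratio `e^{-h}`. An
upper bound of order `t^{-1/2}` is all that is needed to trade `S⁻¹(δ)` for `D⁻¹`; positivity
preserves supports. -/
theorem expSumLim_pos_and_le {h : ℝ} (hh : 0 < h) (nplus : ℕ) :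
    ∃ C : ℝ, 0 < C ∧ ∀ t : ℝ, 0 < t →
      0 < expSumLim h nplus t ∧ expSumLim h nplus t ≤ C * (√t)⁻¹ := by
  set B := 1 + Real.exp (nplus * h) with hB
  have hB0 : 0 < B := by positivity
  have hq1 : Real.exp (-h) < 1 := by rw [← Real.exp_zero]; exact Real.exp_lt_exp.2 (by linarith)
  refine ⟨h * (4 / √Real.pi) * B * (1 - Real.exp (-h))⁻¹, ?_, fun t ht => ?_⟩
  · have := inv_pos.2 (sub_pos.2 hq1)
    positivity
  have hst : 0 < √t := Real.sqrt_pos.2 ht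
  have hsum : ∀ N : ℕ, ∑ i ∈ Finset.range N, expTerm h (((nplus : ℝ) - i) * h) t ≤
      h * (4 / √Real.pi) * B * (1 - Real.exp (-h))⁻¹ * (√t)⁻¹ := by
    intro N
    have h1 : ∀ i ∈ Finset.range N, expTerm h (((nplus : ℝ) - i) * h) t ≤
        h * (4 / √Real.pi) * B / √t *
          ((Real.exp (nplus * h) * √t / B * Real.exp (-h) ^ i) /
            (1 + Real.exp (nplus * h) * √t / B * Real.exp (-h) ^ i) ^ 2) := by
      intro i _
      have hx : ((nplus : ℝ) - i) * h ≤ nplus * h := by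
        have : (0 : ℝ) ≤ i * h := by positivity
        linarith
      have h2 := expTerm_le hh hx ht
      have h3 : Real.exp (((nplus : ℝ) - i) * h) * √t / B =
          Real.exp (nplus * h) * √t / B * Real.exp (-h) ^ i := by
        rw [← Real.exp_nat_mul, show ((nplus : ℝ) - i) * h = nplus * h + i * -h by ring,
          Real.exp_add]
        ring
      rwa [← hB, h3] at h2
    refine (Finset.sum_le_sum h1).trans ?_
    rw [← Finset.mul_sum]
    have h4 := sum_geometric_le (Real.exp_pos (-h)) hq1
      (show 0 < Real.exp (nplus * h) * √t / B by positivity) N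
    refine (mul_le_mul_of_nonneg_left h4 (by positivity)).trans (le_of_eq ?_)
    ring
  have hs := summable_of_sum_range_le (fun i : ℕ => (expTerm_pos hh _ t).le) hsum
  refine ⟨hs.tsum_pos (fun i => (expTerm_pos hh _ t).le) 0 (expTerm_pos hh _ t), ?_⟩
  exact Real.tsum_le_of_sum_range_le (fun i : ℕ => (expTerm_pos hh _ t).le) hsum

namespace Problem

variable {d R : ℕ} {J : Type*} {P : Problem d R J}

theorem ScalingValid.D_ge_one (h : P.ScalingValid) (l : MIdx d J) : 1 ≤ P.D l :=
  Real.one_le_sqrt.2 (h.one_le_t l)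

theorem ScalingValid.exists_Sinv_le (h : P.ScalingValid) :
    ∃ C : ℝ, 0 < C ∧ ∀ l, 0 < P.Sinv l ∧ P.Sinv l ≤ C * (P.D l)⁻¹ := by
  obtain ⟨C, hC, H⟩ := expSumLim_pos_and_le h.h_pos P.nplus
  exact ⟨C, hC, fun l => H _ (zero_lt_one.trans_le (h.one_le_t l))⟩

/-- In a product in which at most one factor is differentiated, the weights are dominated by `D`. -/
theorem ScalingValid.prod_weight_le (h : P.ScalingValid) {o : Fin d → ℕ} (ho : ∑ j, o j ≤ 1)
    (l : MIdx d J) : ∏ j, P.weight j (l j) ^ o j ≤ P.D l := by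
  by_cases h0 : ∀ j, o j = 0
  · simp only [h0, pow_zero, Finset.prod_const_one]
    exact h.D_ge_one l
  · push Not at h0
    obtain ⟨i, hi⟩ := h0
    have h1 : o i + ∑ j ∈ Finset.univ.erase i, o j ≤ 1 := by
      rwa [Finset.add_sum_erase _ _ (Finset.mem_univ i)]
    have h2 : ∑ j ∈ Finset.univ.erase i, o j = 0 := by omega
    have h3 : o i = 1 := by omega
    have h4 : ∀ j, j ≠ i → o j = 0 := fun j hj =>
      Finset.sum_eq_zero_iff.1 h2 j (Finset.mem_erase.2 ⟨hj, Finset.mem_univ j⟩)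
    rw [Finset.prod_eq_single i (fun j _ hj => by rw [h4 j hj, pow_zero]) (by simp), h3, pow_one]
    refine Real.le_sqrt_of_sq_le ?_
    exact Finset.single_le_sum (f := fun j => P.weight j (l j) ^ 2) (fun _ _ => sq_nonneg _)
      (Finset.mem_univ i)

end Problem

/-! ### Operators acting on single modes, and their products -/

section ModeOperators

variable {d : ℕ} {J : Type*}

theorem slice_memℓp (i : Fin d) (l : MIdx d J) (v : L2 (MIdx d J)) :
    Memℓp (fun x : J => v (Function.update l i x)) 2 := by
  refine memℓp_gen ?_
  have h := (summable_sq v).comp_injective (Function.update_injective l i)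
  refine h.congr fun x => ?_
  simp

/-- The vector obtained from a tensor by varying the `i`-th index of the multi-index `l`. -/
def slice (i : Fin d) (l : MIdx d J) (v : L2 (MIdx d J)) : L2 J :=
  ⟨fun x => v (Function.update l i x), slice_memℓp i l v⟩

theorem slice_apply (i : Fin d) (l : MIdx d J) (v : L2 (MIdx d J)) (x : J) :
    slice i l v x = v (Function.update l i x) := rfl

/-- With all modes but `i` fixed, the inner sum is the squared norm of `B` applied to one vector of
`ℓ₂(J)`. Summing over the fixed modes keeps the operator norm. -/
theorem tsum_modeOp_le (i : Fin d) (B : L2 J →L[ℝ] L2 J) (v : L2 (MIdx d J)) :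
    ∑' l : MIdx d J, ENNReal.ofReal (B (slice i l v) (l i) ^ 2) ≤
      ENNReal.ofReal ((‖B‖ * ‖v‖) ^ 2) := by
  classical
  set e := Equiv.funSplitAt i J with he
  have hup : ∀ x x' z, Function.update (e.symm (x, z)) i x' = e.symm (x', z) := by
    intro x x' z
    funext k
    by_cases hk : k = i
    · subst hk
      simp [he, Equiv.funSplitAt, Equiv.piSplitAt]
    · simp [he, Equiv.funSplitAt, Equiv.piSplitAt, hk]
  have hi : ∀ x z, e.symm (x, z) i = x := by
    intro x z
    simp [he, Equiv.funSplitAt, Equiv.piSplitAt]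
  rw [mul_pow, ENNReal.ofReal_mul (sq_nonneg _), ofReal_norm_sq v,
    ← e.symm.tsum_eq, ← e.symm.tsum_eq (fun l => ENNReal.ofReal (v l ^ 2)), ENNReal.tsum_prod',
    ENNReal.tsum_prod', ENNReal.tsum_comm,
    ENNReal.tsum_comm (f := fun x z => ENNReal.ofReal (v (e.symm (x, z)) ^ 2)),
    ← ENNReal.tsum_mul_left]
  refine ENNReal.tsum_le_tsum fun z => ?_
  rcases isEmpty_or_nonempty J with hJ | ⟨⟨x₀⟩⟩
  · simp
  have hs : ∀ x, slice i (e.symm (x, z)) v = slice i (e.symm (x₀, z)) v := by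
    intro x
    ext x'
    simp only [slice_apply, hup]
  simp_rw [hi, hs]
  rw [← ofReal_norm_sq]
  have : ∑' x, ENNReal.ofReal (v (e.symm (x, z)) ^ 2) =
      ENNReal.ofReal (‖slice i (e.symm (x₀, z)) v‖ ^ 2) := by
    rw [ofReal_norm_sq]
    simp only [slice_apply, hup]
  rw [this, ← ENNReal.ofReal_mul (sq_nonneg _), ← mul_pow]
  exact ENNReal.ofReal_le_ofReal (pow_le_pow_left₀ (norm_nonneg _) (B.le_opNorm _) 2)

/-- The operator `B`, applied to the `i`-th mode of a tensor. -/
def modeOp (i : Fin d) (B : L2 J →L[ℝ] L2 J) (v : L2 (MIdx d J)) : L2 (MIdx d J) :=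
  ⟨fun l => B (slice i l v) (l i),
    memℓp_of_tsum_lt (ne_top_of_le_ne_top ENNReal.ofReal_ne_top (tsum_modeOp_le i B v))⟩

theorem modeOp_apply (i : Fin d) (B : L2 J →L[ℝ] L2 J) (v : L2 (MIdx d J)) (l : MIdx d J) :
    modeOp i B v l = B (slice i l v) (l i) := rfl

theorem norm_modeOp_le (i : Fin d) (B : L2 J →L[ℝ] L2 J) (v : L2 (MIdx d J)) :
    ‖modeOp i B v‖ ≤ ‖B‖ * ‖v‖ :=
  norm_le_of_tsum_le (mul_nonneg (norm_nonneg _) (norm_nonneg _)) (tsum_modeOp_le i B v)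

/-- The operators `B j`, applied to the modes `j` in a list, beginning with the last one. -/
def modeOps (B : Fin d → L2 J →L[ℝ] L2 J) (S : List (Fin d)) (v : L2 (MIdx d J)) :
    L2 (MIdx d J) :=
  S.foldr (fun i => modeOp i (B i)) v

theorem norm_modeOps_le {B : Fin d → L2 J →L[ℝ] L2 J} {c : ℝ} (S : List (Fin d))
    (hB : ∀ j ∈ S, ‖B j‖ ≤ c) (v : L2 (MIdx d J)) : ‖modeOps B S v‖ ≤ c ^ S.length * ‖v‖ := by
  induction S with
  | nil => simp [modeOps]
  | cons i S ih =>
    have h1 := norm_modeOp_le i (B i) (modeOps B S v)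
    have h2 := ih fun j hj => hB j (List.mem_cons_of_mem _ hj)
    have h3 := hB i List.mem_cons_self
    have h0 : 0 ≤ c := (norm_nonneg _).trans h3
    calc ‖modeOps B (i :: S) v‖ ≤ ‖B i‖ * ‖modeOps B S v‖ := h1
      _ ≤ c * (c ^ S.length * ‖v‖) := mul_le_mul h3 h2 (norm_nonneg _) h0
      _ = _ := by rw [List.length_cons, pow_succ]; ring

-- Induction on the list: modes not yet treated contribute Kronecker deltas. Finite support makes
-- each slice a finite combination of unit vectors, on which `B i` is given by its entries.
open Classical in
theorem modeOps_apply {B : Fin d → L2 J →L[ℝ] L2 J} {F : Finset (MIdx d J)} {v : L2 (MIdx d J)}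
    (hv : SuppIn (F : Set (MIdx d J)) v) (S : List (Fin d)) (hS : S.Nodup) (l : MIdx d J) :
    modeOps B S v l = ∑ m ∈ F,
      (∏ j, if j ∈ S then entry (B j) (l j) (m j) else if l j = m j then 1 else 0) * v m := by
  induction S generalizing l with
  | nil =>
    have h : ∀ m : MIdx d J, (∏ j, if l j = m j then (1 : ℝ) else 0) = if l = m then 1 else 0 := by
      intro m
      by_cases hlm : l = m
      · simp [hlm]
      · obtain ⟨j, hj⟩ := Function.ne_iff.1 hlm
        rw [if_neg hlm]
        exact Finset.prod_eq_zero (Finset.mem_univ j) (if_neg hj)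
    simp only [modeOps, List.foldr_nil, List.not_mem_nil, if_false, h, ite_mul, one_mul, zero_mul,
      Finset.sum_ite_eq]
    split_ifs with hl
    · rfl
    · exact hv l (by simpa using hl)
  | cons i S ih =>
    obtain ⟨hi, hS⟩ := List.nodup_cons.1 hS
    set c : MIdx d J → ℝ := fun m => (∏ j ∈ Finset.univ.erase i,
      if j ∈ S then entry (B j) (l j) (m j) else if l j = m j then 1 else 0) * v m with hc
    have hslice : slice i l (modeOps B S v) = ∑ m ∈ F, c m • lp.single 2 (m i) (1 : ℝ) := by
      ext x
      rw [slice_apply, ih hS, lp.coeFn_sum, Finset.sum_apply]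
      refine Finset.sum_congr rfl fun m _ => ?_
      rw [← Finset.mul_prod_erase _ _ (Finset.mem_univ i), if_neg hi, Function.update_self]
      have h1 : ∏ j ∈ Finset.univ.erase i, (if j ∈ S then
          entry (B j) (Function.update l i x j) (m j) else
            if Function.update l i x j = m j then (1 : ℝ) else 0) =
          ∏ j ∈ Finset.univ.erase i, if j ∈ S then entry (B j) (l j) (m j) else
            if l j = m j then 1 else 0 := by
        refine Finset.prod_congr rfl fun j hj => ?_
        rw [Function.update_of_ne (Finset.ne_of_mem_erase hj)]
      rw [h1]
      by_cases hx : x = m i <;> simp [hc, hx]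
    change B i (slice i l (modeOps B S v)) (l i) = _
    rw [hslice, map_sum, lp.coeFn_sum, Finset.sum_apply]
    refine Finset.sum_congr rfl fun m _ => ?_
    rw [← Finset.mul_prod_erase _ _ (Finset.mem_univ i), if_pos List.mem_cons_self, map_smul]
    have h1 : ∏ j ∈ Finset.univ.erase i, (if j ∈ i :: S then entry (B j) (l j) (m j) else
            if l j = m j then (1 : ℝ) else 0) =
        ∏ j ∈ Finset.univ.erase i, if j ∈ S then entry (B j) (l j) (m j) else
          if l j = m j then 1 else 0 := by
      refine Finset.prod_congr rfl fun j hj => ?_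
      simp [Finset.ne_of_mem_erase hj]
    rw [h1]
    simp only [hc, lp.coeFn_smul, Pi.smul_apply, smul_eq_mul]
    rw [← entry]
    ring

/-- The tensor product of operators, applied to a finitely supported tensor. -/
theorem exists_tensor_apply {B : Fin d → L2 J →L[ℝ] L2 J} {F : Finset (MIdx d J)}
    {v : L2 (MIdx d J)} (hv : SuppIn (F : Set (MIdx d J)) v) {c : ℝ} (hc : 1 ≤ c) (i : Fin d)
    (hB : ∀ j, j ≠ i → ‖B j‖ ≤ c) :
    ∃ e : L2 (MIdx d J), (∀ l, e l = ∑ m ∈ F, (∏ j, entry (B j) (l j) (m j)) * v m) ∧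
      ‖e‖ ≤ c ^ d * ‖modeOp i (B i) v‖ := by
  classical
  -- The last list element acts first, so in `S ++ [i]` the operator of mode `i` meets `v` itself;
  -- the others cost only their norms.
  set S := (Finset.univ.erase i).toList with hS
  have hnd : (S ++ [i]).Nodup := by
    refine List.nodup_append.2 ⟨Finset.nodup_toList _, List.nodup_singleton i, ?_⟩
    intro a ha b hb
    rw [List.mem_singleton.1 hb]
    rw [hS, Finset.mem_toList] at ha
    exact Finset.ne_of_mem_erase ha
  have hmem : ∀ j, j ∈ S ++ [i] := by
    intro j
    by_cases hj : j = i <;> simp [hS, hj]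
  refine ⟨modeOps B (S ++ [i]) v, fun l => ?_, ?_⟩
  · rw [modeOps_apply hv _ hnd]
    simp only [hmem, if_true]
  · have h1 : modeOps B (S ++ [i]) v = modeOps B S (modeOp i (B i) v) := by
      simp [modeOps]
    rw [h1]
    refine (norm_modeOps_le S (fun j hj => hB j ?_) _).trans ?_
    · rw [hS, Finset.mem_toList] at hj
      exact Finset.ne_of_mem_erase hj
    · refine mul_le_mul_of_nonneg_right (pow_le_pow_right₀ hc ?_) (norm_nonneg _)
      rw [hS, Finset.length_toList]
      exact (Finset.card_erase_le).trans (by simp)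

end ModeOperators

/-! ### Adaptively compressed operators -/

section Compression

variable {d : ℕ} {J : Type*}

theorem norm_le_of_abs_le_mul {ι : Type*} {v w : L2 ι} {c : ℝ} (hc : 0 ≤ c)
    (h : ∀ i, |v i| ≤ c * |w i|) : ‖v‖ ≤ c * ‖w‖ := by
  obtain ⟨e, he, hn⟩ := exists_of_abs_le hc w h
  rwa [show e = v from lp.ext (funext he)] at hn

theorem slice_restr (i : Fin d) (S : Set J) (l : MIdx d J) (v : L2 (MIdx d J)) :
    slice i l (restr {l : MIdx d J | l i ∈ S} v) = restr S (slice i l v) := by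
  classical
  ext x
  simp only [slice_apply, restr_apply, Set.mem_ofPred_eq, Function.update_self]

theorem modeOp_comp_restrL (i : Fin d) (B : L2 J →L[ℝ] L2 J) (S : Set J) (v : L2 (MIdx d J)) :
    modeOp i (B.comp (restrL S)) v = modeOp i B (restr {l : MIdx d J | l i ∈ S} v) := by
  ext l
  rw [modeOp_apply, modeOp_apply, slice_restr]
  rfl

theorem modeOp_add (i : Fin d) (B B' : L2 J →L[ℝ] L2 J) (v : L2 (MIdx d J)) :
    modeOp i (B + B') v = modeOp i B v + modeOp i B' v := by
  ext l
  rw [lp.coeFn_add, Pi.add_apply]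
  simp only [modeOp_apply, add_apply, lp.coeFn_add, Pi.add_apply]

theorem modeOp_sum (i : Fin d) {κ : Type*} (s : Finset κ) (B : κ → L2 J →L[ℝ] L2 J)
    (v : L2 (MIdx d J)) : modeOp i (∑ k ∈ s, B k) v = ∑ k ∈ s, modeOp i (B k) v := by
  ext l
  rw [lp.coeFn_sum, Finset.sum_apply]
  simp only [modeOp_apply, sum_apply, lp.coeFn_sum, Finset.sum_apply]

/-- The indices in `Γ L` which appear first in the layer `p`. -/
def newLayer (Γ : ℕ → Finset J) (L p : ℕ) : Set J := {y | y ∈ Γ L ∧ sInf {q | y ∈ Γ q} = p}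

/-- The adaptively compressed operator `∑_{p ≤ L} B_{[L-p]} R_{Γ p \ Γ (p-1)}`. -/
def adaptive (Bp : ℕ → L2 J →L[ℝ] L2 J) (Γ : ℕ → Finset J) (L : ℕ) : L2 J →L[ℝ] L2 J :=
  ∑ p ∈ Finset.range (L + 1), (Bp (L - p)).comp (restrL (newLayer Γ L p))

open Classical in
theorem restr_single (S : Set J) (y : J) :
    restr S (lp.single 2 y (1 : ℝ)) = if y ∈ S then lp.single 2 y (1 : ℝ) else 0 := by
  ext x
  by_cases hx : x = y
  · subst hx
    by_cases hS : x ∈ S <;> simp [restr_apply, hS]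
  · by_cases hS : y ∈ S <;> simp [restr_apply, hS, hx]

open Classical in
theorem entry_adaptive (Bp : ℕ → L2 J →L[ℝ] L2 J) (Γ : ℕ → Finset J) (L : ℕ) (x y : J) :
    entry (adaptive Bp Γ L) x y =
      if y ∈ Γ L then entry (Bp (L - sInf {p | y ∈ Γ p})) x y else 0 := by
  simp only [entry, adaptive, sum_apply, ContinuousLinearMap.comp_apply,
    restrL_apply, lp.coeFn_sum, Finset.sum_apply, restr_single, newLayer, Set.mem_ofPred_eq]
  by_cases hy : y ∈ Γ L
  · rw [Finset.sum_eq_single (sInf {p | y ∈ Γ p})]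
    · simp [hy]
    · intro p _ hp
      rw [if_neg fun h => hp h.2.symm]
      simp
    · intro h
      exact absurd (Finset.mem_range.2 (Nat.lt_succ_of_le (Nat.sInf_le hy))) h
  · simp [hy]

theorem sum_restr_newLayer (Γ : ℕ → Finset J) (L : ℕ) (w : L2 J) :
    ∑ p ∈ Finset.range (L + 1), restr (newLayer Γ L p) w = restr (Γ L : Set J) w := by
  classical
  ext y
  rw [lp.coeFn_sum, Finset.sum_apply]
  by_cases hy : y ∈ Γ L
  · rw [Finset.sum_eq_single (sInf {p | y ∈ Γ p})]
    · simp [restr_apply, newLayer, hy]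
    · intro p _ hp
      exact restr_of_notMem (fun h => hp h.2.symm) w
    · intro h
      exact absurd (Finset.mem_range.2 (Nat.lt_succ_of_le (Nat.sInf_le hy))) h
  · rw [restr_of_notMem (by simpa using hy)]
    exact Finset.sum_eq_zero fun p _ => restr_of_notMem (fun h => hy h.1) w

/-- There are two sources of error: columns outside `Γ L` are dropped, and columns first appearing
in layer `p` are compressed at level `L - p`. -/
theorem sub_adaptive (B : L2 J →L[ℝ] L2 J) (Bp : ℕ → L2 J →L[ℝ] L2 J) (Γ : ℕ → Finset J) (L : ℕ) :
    B - adaptive Bp Γ L = B.comp (restrL (Γ L : Set J)ᶜ) +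
      ∑ p ∈ Finset.range (L + 1), (B - Bp (L - p)).comp (restrL (newLayer Γ L p)) := by
  refine ContinuousLinearMap.ext fun w => ?_
  simp only [adaptive, sub_apply, add_apply,
    sum_apply, ContinuousLinearMap.comp_apply, restrL_apply,
    Finset.sum_sub_distrib, ← map_sum, sum_restr_newLayer, ← sub_restr, map_sub]
  abel

theorem rpow_two_neg_mul_add (s : ℝ) (p q : ℕ) :
    (2 : ℝ) ^ (-(s * p)) * (2 : ℝ) ^ (-(s * q)) = (2 : ℝ) ^ (-(s * (p + q : ℕ))) := by
  rw [← Real.rpow_add two_pos]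
  push_cast
  ring_nf

/-- Accuracy of adaptively compressed operators, in terms of the decay of the contractions. -/
theorem IsCompressionScheme.exists_bound {s : ℝ} (hs : 0 < s) {B : L2 J →L[ℝ] L2 J}
    {Bp : ℕ → L2 J →L[ℝ] L2 J} (h : IsCompressionScheme s B Bp) :
    ∃ c : ℝ, 0 ≤ c ∧ ‖B‖ ≤ c ∧ ∀ (Γ : ℕ → Finset J) (L : ℕ), ‖adaptive Bp Γ L‖ ≤ c ∧
      ∀ {d : ℕ} (i : Fin d) (v : L2 (MIdx d J)) (M : ℝ), ‖v‖ ≤ M →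
        (∀ p : ℕ, ‖restr {l : MIdx d J | l i ∉ Γ p} v‖ ≤ M * (2 : ℝ) ^ (-(s * p))) →
        ‖modeOp i (B - adaptive Bp Γ L) v‖ ≤ c * M * (2 : ℝ) ^ (-(s * L)) := by
  obtain ⟨a, b, -, hb, -, hbs, hp⟩ := h
  have hT : 0 ≤ ∑' q, b q := tsum_nonneg fun q => (hb q).le
  have h2s : 1 ≤ (2 : ℝ) ^ s := Real.one_le_rpow one_le_two hs.le
  have hsum : ∀ L : ℕ, ∑ p ∈ Finset.range (L + 1), b (L - p) ≤ ∑' q, b q := by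
    intro L
    have := Finset.sum_range_reflect b (L + 1)
    simp only [Nat.add_sub_cancel] at this
    rw [this]
    exact hbs.sum_le_tsum _ fun q _ => (hb q).le
  have h2T : 0 ≤ (2 : ℝ) ^ s * ∑' q, b q := mul_nonneg (zero_le_one.trans h2s) hT
  have hB0 := norm_nonneg B
  -- The bracket bounds the compression error, and the additional `‖B‖` turns this into a bound for
  -- `adaptive` itself.
  refine ⟨‖B‖ + (‖B‖ + 2 ^ s * ∑' q, b q), by positivity, by linarith, fun Γ L => ⟨?_, ?_⟩⟩
  · have h1 : ‖B - adaptive Bp Γ L‖ ≤ ‖B‖ + 2 ^ s * ∑' q, b q := by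
      have hR : ∀ S : Set J, ‖restrL S‖ ≤ 1 := fun S =>
        LinearMap.mkContinuous_norm_le _ zero_le_one _
      rw [sub_adaptive]
      refine (norm_add_le _ _).trans (add_le_add ?_ ?_)
      · exact (ContinuousLinearMap.opNorm_comp_le _ _).trans
          (mul_le_of_le_one_right (norm_nonneg _) (hR _))
      · refine (norm_sum_le _ _).trans ?_
        refine le_trans (Finset.sum_le_sum fun p _ => ?_)
          ((hsum L).trans (le_mul_of_one_le_left hT h2s))
        refine (ContinuousLinearMap.opNorm_comp_le _ _).trans
          ((mul_le_of_le_one_right (norm_nonneg _) (hR _)).trans ((hp (L - p)).2.2.trans ?_))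
        refine mul_le_of_le_one_right (hb _).le (Real.rpow_le_one_of_one_le_of_nonpos one_le_two ?_)
        exact neg_nonpos.2 (by positivity)
    have h2 := norm_sub_norm_le (adaptive Bp Γ L) B
    rw [norm_sub_rev] at h2
    linarith
  · intro d i v M hv hM
    have hM0 : 0 ≤ M := (norm_nonneg v).trans hv
    have h2L : 0 < (2 : ℝ) ^ (-(s * L)) := Real.rpow_pos_of_pos two_pos _
    -- Layer `p + 1` lies outside `Γ p`; this shift of the index costs the factor `2^s`. Layer `0`
    -- has no predecessor and is bounded by the full norm.
    have hlayer : ∀ p, ‖restr {l : MIdx d J | l i ∈ newLayer Γ L p} v‖ ≤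
        2 ^ s * M * (2 : ℝ) ^ (-(s * p)) := by
      intro p
      rcases p with _ | p
      · refine (norm_restr_le _ _).trans (hv.trans ?_)
        simpa using le_mul_of_one_le_left hM0 h2s
      · refine (norm_restr_mono (Λ' := {l : MIdx d J | l i ∉ Γ p}) ?_ v).trans
          ((hM p).trans (le_of_eq ?_))
        · intro l hl hl'
          have h1 : sInf {q | l i ∈ Γ q} ≤ p := Nat.sInf_le hl'
          have h2 : sInf {q | l i ∈ Γ q} = p + 1 := hl.2
          omega
        · rw [mul_comm (2 ^ s) M, mul_assoc, ← Real.rpow_add two_pos]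
          congr 2
          push_cast
          ring
    rw [sub_adaptive, modeOp_add, modeOp_sum, modeOp_comp_restrL]
    simp only [modeOp_comp_restrL]
    have h1 : ‖modeOp i B (restr {l : MIdx d J | l i ∈ (Γ L : Set J)ᶜ} v)‖ ≤
        ‖B‖ * (M * (2 : ℝ) ^ (-(s * L))) :=
      (norm_modeOp_le _ _ _).trans (mul_le_mul_of_nonneg_left (hM L) (norm_nonneg _))
    -- Accuracy `2^{-s(L-p)}` meets decay `2^{-sp}`: each layer contributes `b (L - p) 2^{-sL}`, and
    -- `b` is summable.
    have h2 : ‖∑ p ∈ Finset.range (L + 1),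
        modeOp i (B - Bp (L - p)) (restr {l : MIdx d J | l i ∈ newLayer Γ L p} v)‖ ≤
        2 ^ s * M * (2 : ℝ) ^ (-(s * L)) * ∑' q, b q := by
      refine le_trans ?_ (mul_le_mul_of_nonneg_left (hsum L) (by positivity))
      refine (norm_sum_le _ _).trans ?_
      rw [Finset.mul_sum]
      refine Finset.sum_le_sum fun p hpL => ?_
      refine (norm_modeOp_le _ _ _).trans
        ((mul_le_mul (hp (L - p)).2.2 (hlayer p) (norm_nonneg _)
          (mul_nonneg (hb _).le (by positivity))).trans (le_of_eq ?_))
      have h3 := rpow_two_neg_mul_add s (L - p) p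
      rw [Nat.sub_add_cancel (Nat.lt_succ_iff.1 (Finset.mem_range.1 hpL))] at h3
      rw [← h3]
      ring
    refine (norm_add_le _ _).trans ((add_le_add h1 h2).trans ?_)
    have h3 : 0 ≤ ‖B‖ * M * (2 : ℝ) ^ (-(s * L)) := by positivity
    nlinarith

/-- Exchange the factors one at a time. In the `i`-th term the factors before `i` are already
exchanged, so only one factor is a difference. -/
theorem prod_sub_prod_eq_sum (a b : Fin d → ℝ) : ∏ j, a j - ∏ j, b j =
    ∑ i, ∏ j, (if j < i then b j else if j = i then a j - b j else a j) := by
  have h := Finset.prod_sub_ordered Finset.univ a fun j => a j - b j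
  simp only [sub_sub_cancel] at h
  rw [h, sub_sub_cancel]
  refine Finset.sum_congr rfl fun i _ => ?_
  rw [Finset.prod_ite]
  have h1 : (Finset.univ.filter fun j => ¬ j < i) =
      insert i (Finset.univ.filter fun j => i < j) := by
    ext j
    simp [le_iff_eq_or_lt, eq_comm]
  rw [h1, Finset.prod_insert (by simp), if_pos rfl]
  have h2 : ∏ j ∈ Finset.univ.filter (fun j => i < j), (if j = i then a j - b j else a j) =
      ∏ j ∈ Finset.univ.filter (fun j => i < j), a j :=
    Finset.prod_congr rfl fun j hj => if_neg (Finset.mem_filter.1 hj).2.ne'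
  rw [h2]
  ring

end Compression

/-! ### Accuracy and sparsity of the compressed tensor operator. -/

namespace Problem

variable {d R : ℕ} {J : Type*} {P : Problem d R J}

open Classical in
theorem compL_eq (Γ : ℕ → Finset J) (L : ℕ) (n : Fin R) (j : Fin d) (x y : J) :
    P.compL Γ L n j x y = P.weight j x ^ P.testOrd n j *
      entry (adaptive (P.compressed n j) Γ L) x y * P.weight j y ^ P.trialOrd n j := by
  rw [entry_adaptive, compL]
  split_ifs <;> simp

theorem comp_eq (hscal : P.ScalingValid) (hsep : P.Separable) (n : Fin R) (j : Fin d) (x y : J) :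
    P.comp n j x y = P.weight j x ^ P.testOrd n j *
      entry (P.compHat n j) x y * P.weight j y ^ P.trialOrd n j := by
  have h1 := (hscal.weight_pos j x).ne'
  have h2 := (hscal.weight_pos j y).ne'
  rw [hsep.entry_eq]
  field_simp

/-- Accuracy of the compressed operator, for tensors with decaying contractions. -/
theorem exists_apply_error {s : ℝ} (hscal : P.ScalingValid) (hsep : P.Separable) (hs : 0 < s)
    (hscheme : ∀ n j, IsCompressionScheme s (P.compHat n j) (P.compressed n j)) :
    ∃ C : ℝ, 0 < C ∧ ∀ (Γ : Fin d → ℕ → Finset J) (L : ℕ) (F : Finset (MIdx d J))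
      (v : L2 (MIdx d J)) (z₁ z₂ : MIdx d J → ℝ) (c M : ℝ), 0 ≤ c →
      (∀ l, |z₁ l| ≤ c * (P.D l)⁻¹) → (∀ l, |z₂ l| ≤ c * (P.D l)⁻¹) →
      SuppIn (F : Set (MIdx d J)) v → ‖v‖ ≤ M →
      (∀ j (p : ℕ), ‖restr {l : MIdx d J | l j ∉ Γ j p} v‖ ≤ M * (2 : ℝ) ^ (-(s * p))) →
      ∃ e : L2 (MIdx d J),
        (∀ l, e l = z₁ l * ∑' m, (P.matA l m - P.matL Γ L l m) * (z₂ m * v m)) ∧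
        ‖e‖ ≤ C * c ^ 2 * M * (2 : ℝ) ^ (-(s * L)) := by
  classical
  choose c₀ hc₀ hB hA using fun n j => (hscheme n j).exists_bound hs
  set c₁ : ℝ := 1 + ∑ n, ∑ j, c₀ n j with hc₁
  have hle : ∀ n j, c₀ n j ≤ c₁ := fun n j => by
    have h1 := Finset.single_le_sum (f := fun j => c₀ n j) (fun j _ => hc₀ n j) (Finset.mem_univ j)
    have h2 := Finset.single_le_sum (f := fun n => ∑ j, c₀ n j)
      (fun n _ => Finset.sum_nonneg fun j _ => hc₀ n j) (Finset.mem_univ n)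
    linarith
  have hone : 1 ≤ c₁ := by
    have : 0 ≤ ∑ n, ∑ j, c₀ n j :=
      Finset.sum_nonneg fun n _ => Finset.sum_nonneg fun j _ => hc₀ n j
    linarith
  -- `R` separable terms, `d` exchanges in each, `c₁^d` for the unchanged factors and one `c₁` for
  -- the compression error.
  refine ⟨R * (d * c₁ ^ (d + 1)) + 1, by positivity, ?_⟩
  intro Γ L F v z₁ z₂ c M hc hz₁ hz₂ hv hvM hdecay
  have hM0 : 0 ≤ M := (norm_nonneg v).trans hvM
  set X : ℝ := (2 : ℝ) ^ (-(s * L)) with hX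
  have hX0 : 0 < X := Real.rpow_pos_of_pos two_pos _
  have hw0 : ∀ (o : Fin d → ℕ) (l : MIdx d J), 0 ≤ ∏ j, P.weight j (l j) ^ o j := fun o l =>
    Finset.prod_nonneg fun j _ => pow_nonneg (hscal.weight_pos j _).le _
  have hweight : ∀ (o : Fin d → ℕ), ∑ j, o j ≤ 1 → ∀ (z : MIdx d J → ℝ),
      (∀ l, |z l| ≤ c * (P.D l)⁻¹) → ∀ l, |(∏ j, P.weight j (l j) ^ o j) * z l| ≤ c := by
    intro o ho z hz l
    have hD : 0 < P.D l := zero_lt_one.trans_le (hscal.D_ge_one l)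
    rw [abs_mul, abs_of_nonneg (hw0 o l)]
    calc _ ≤ P.D l * (c * (P.D l)⁻¹) :=
          mul_le_mul (hscal.prod_weight_le ho l) (hz l) (abs_nonneg _) hD.le
      _ = c := by field_simp
  have hterm : ∀ n : Fin R, ∃ e : L2 (MIdx d J), (∀ l, e l = z₁ l * ∑ m ∈ F,
      (∏ j, P.comp n j (l j) (m j) - ∏ j, P.compL (Γ j) L n j (l j) (m j)) * (z₂ m * v m)) ∧
      ‖e‖ ≤ d * c₁ ^ (d + 1) * c ^ 2 * M * X := by
    intro n
    -- Trial weights and scaling form a diagonal multiplier bounded by `c`. It is moved onto `v`,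
    -- where it preserves the decay of the layers, so that only the bounded scaled components
    -- remain.
    obtain ⟨w, hw, hwn⟩ := exists_of_abs_le (g := fun l =>
      ((∏ j, P.weight j (l j) ^ P.trialOrd n j) * z₂ l) * v l) hc v fun l => by
        rw [abs_mul]
        exact mul_le_mul_of_nonneg_right (hweight _ (hsep.trialOrd_le n) z₂ hz₂ l) (abs_nonneg _)
    have hwF : SuppIn (F : Set (MIdx d J)) w := fun l hl => by rw [hw, hv l hl, mul_zero]
    have hwM : ‖w‖ ≤ c * M := hwn.trans (mul_le_mul_of_nonneg_left hvM hc)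
    have hwdecay : ∀ j (p : ℕ),
        ‖restr {l : MIdx d J | l j ∉ Γ j p} w‖ ≤ c * M * (2 : ℝ) ^ (-(s * p)) := by
      intro j p
      have h1 : ‖restr {l : MIdx d J | l j ∉ Γ j p} w‖ ≤
          c * ‖restr {l : MIdx d J | l j ∉ Γ j p} v‖ := by
        refine norm_le_of_abs_le_mul hc fun l => ?_
        rw [restr_apply, restr_apply]
        split_ifs
        · rw [hw, abs_mul]
          exact mul_le_mul_of_nonneg_right (hweight _ (hsep.trialOrd_le n) z₂ hz₂ l) (abs_nonneg _)
        · simp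
      refine h1.trans ?_
      rw [mul_assoc]
      exact mul_le_mul_of_nonneg_left (hdecay j p) hc
    set Bi : Fin d → Fin d → L2 J →L[ℝ] L2 J := fun i j =>
      if j < i then adaptive (P.compressed n j) (Γ j) L
      else if j = i then P.compHat n j - adaptive (P.compressed n j) (Γ j) L
      else P.compHat n j with hBi
    have hBin : ∀ i j, j ≠ i → ‖Bi i j‖ ≤ c₁ := by
      intro i j hj
      simp only [hBi, if_neg hj]
      split_ifs
      · exact ((hA n j (Γ j) L).1).trans (hle n j)
      · exact (hB n j).trans (hle n j)
    choose E hE hEn using fun i => exists_tensor_apply hwF hone i (hBin i)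
    have hEn' : ∀ i, ‖E i‖ ≤ c₁ ^ (d + 1) * c * M * X := by
      intro i
      have h1 : Bi i i = P.compHat n i - adaptive (P.compressed n i) (Γ i) L := by simp [hBi]
      have h2 := (hA n i (Γ i) L).2 i w (c * M) hwM (hwdecay i)
      have h3 := hEn i
      rw [h1] at h3
      refine h3.trans ((mul_le_mul_of_nonneg_left h2 (by positivity)).trans ?_)
      have h4 : c₀ n i * (c * M) * X ≤ c₁ * (c * M) * X := by
        have := hle n i
        gcongr
      refine (mul_le_mul_of_nonneg_left h4 (by positivity)).trans (le_of_eq ?_)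
      ring
    have hsumE : ∀ l, (∑ i, E i) l = ∑ m ∈ F, (∏ j, entry (P.compHat n j) (l j) (m j) -
        ∏ j, entry (adaptive (P.compressed n j) (Γ j) L) (l j) (m j)) * w m := by
      intro l
      rw [lp.coeFn_sum, Finset.sum_apply]
      simp_rw [hE]
      rw [Finset.sum_comm]
      refine Finset.sum_congr rfl fun m _ => ?_
      rw [← Finset.sum_mul, prod_sub_prod_eq_sum]
      congr 1
      refine Finset.sum_congr rfl fun i _ => Finset.prod_congr rfl fun j _ => ?_
      simp only [hBi]
      split_ifs <;> rfl
    obtain ⟨e, he, hen⟩ := exists_of_abs_le (g := fun l =>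
      ((∏ j, P.weight j (l j) ^ P.testOrd n j) * z₁ l) * (∑ i, E i) l) hc (∑ i, E i) fun l => by
        rw [abs_mul]
        exact mul_le_mul_of_nonneg_right (hweight _ (hsep.testOrd_le n) z₁ hz₁ l) (abs_nonneg _)
    refine ⟨e, fun l => ?_, hen.trans ?_⟩
    · rw [he, hsumE, Finset.mul_sum, Finset.mul_sum]
      refine Finset.sum_congr rfl fun m _ => ?_
      simp only [comp_eq hscal hsep, compL_eq, Finset.prod_mul_distrib, hw]
      ring
    · have h5 : ‖∑ i, E i‖ ≤ d * (c₁ ^ (d + 1) * c * M * X) := by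
        refine (norm_sum_le _ _).trans ((Finset.sum_le_sum fun i _ => hEn' i).trans ?_)
        simp
      refine (mul_le_mul_of_nonneg_left h5 hc).trans (le_of_eq ?_)
      ring
  choose e he hen using hterm
  refine ⟨∑ n, e n, fun l => ?_, ?_⟩
  · rw [lp.coeFn_sum, Finset.sum_apply, tsum_eq_sum (s := F) fun m hm => by
      rw [hv m (by simpa using hm)]; simp]
    simp_rw [he]
    rw [← Finset.mul_sum, Finset.sum_comm]
    congr 1
    refine Finset.sum_congr rfl fun m _ => ?_
    rw [← Finset.sum_mul, matA, matL, Finset.sum_sub_distrib]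
  · refine (norm_sum_le _ _).trans ((Finset.sum_le_sum fun n _ => hen n).trans ?_)
    rw [Finset.sum_const, Finset.card_univ, Fintype.card_fin, nsmul_eq_mul]
    have : 0 ≤ c ^ 2 * M * X := by positivity
    nlinarith

/-- The number of rows of the compressed operator which are nonzero in one mode. -/
theorem exists_support_bound {s : ℝ}
    (hscheme : ∀ n j, IsCompressionScheme s (P.compHat n j) (P.compressed n j)) :
    ∃ C : ℝ, 0 < C ∧ ∀ (Γ : Fin d → ℕ → Finset J) (L : ℕ) (c : ℝ), 0 ≤ c →
      (∀ j p, ((Γ j p).card : ℝ) ≤ c * 2 ^ p) → ∀ j, ∃ G : Finset J,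
        (∀ l m, P.matL Γ L l m ≠ 0 → l j ∈ G) ∧ (G.card : ℝ) ≤ C * c * 2 ^ L := by
  classical
  choose a b ha hb has hbs hp using hscheme
  have hT : ∀ n j, 0 ≤ ∑' q, a n j q := fun n j => tsum_nonneg fun q => (ha n j q).le
  refine ⟨∑ n, ∑ j, ∑' q, a n j q + 1, add_pos_of_nonneg_of_pos
    (Finset.sum_nonneg fun n _ => Finset.sum_nonneg fun j _ => hT n j) one_pos, ?_⟩
  intro Γ L c hc hΓ j
  have hfin : ∀ n p y, {x | entry (P.compressed n j p) x y ≠ 0}.Finite := fun n p y =>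
    ((hp n j p).2.1 y).1
  set G : Finset J := Finset.univ.biUnion fun n : Fin R => (Finset.range (L + 1)).biUnion fun p =>
    (Γ j p).biUnion fun y => (hfin n (L - p) y).toFinset with hG
  refine ⟨G, fun l m hlm => ?_, ?_⟩
  · obtain ⟨n, -, hn⟩ := Finset.exists_ne_zero_of_sum_ne_zero hlm
    have h1 := Finset.prod_ne_zero_iff.1 hn j (Finset.mem_univ j)
    unfold compL at h1
    split_ifs at h1 with hy
    · have h2 := right_ne_zero_of_mul (left_ne_zero_of_mul h1)
      have h3 : sInf {p | m j ∈ Γ j p} ≤ L := Nat.sInf_le hy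
      have h4 : m j ∈ Γ j (sInf {p | m j ∈ Γ j p}) :=
        Nat.sInf_mem (s := {p | m j ∈ Γ j p}) ⟨L, hy⟩
      simp only [hG, Finset.mem_biUnion, Finset.mem_univ, true_and, Finset.mem_range,
        Set.Finite.mem_toFinset, Set.mem_ofPred_eq]
      exact ⟨n, _, Nat.lt_succ_of_le h3, m j, h4, h2⟩
    · exact absurd rfl h1
  · have hcol : ∀ n p y, ((hfin n p y).toFinset.card : ℝ) ≤ a n j p * 2 ^ p := fun n p y => by
      rw [← Set.ncard_eq_toFinset_card _ (hfin n p y)]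
      exact ((hp n j p).2.1 y).2
    have h1 : (G.card : ℝ) ≤ ∑ n : Fin R, ∑ p ∈ Finset.range (L + 1), ∑ y ∈ Γ j p,
        ((hfin n (L - p) y).toFinset.card : ℝ) := by
      have : G.card ≤ ∑ n : Fin R, ∑ p ∈ Finset.range (L + 1), ∑ y ∈ Γ j p,
          (hfin n (L - p) y).toFinset.card :=
        Finset.card_biUnion_le.trans (Finset.sum_le_sum fun n _ =>
          Finset.card_biUnion_le.trans (Finset.sum_le_sum fun p _ => Finset.card_biUnion_le))
      exact_mod_cast this
    refine h1.trans ?_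
    -- At most `c 2^p` columns with `a (L - p) 2^{L-p}` entries each: the powers combine to `2^L`,
    -- and `a` is summable.
    have h2 : ∀ n : Fin R, ∑ p ∈ Finset.range (L + 1), ∑ y ∈ Γ j p,
        ((hfin n (L - p) y).toFinset.card : ℝ) ≤ (∑' q, a n j q) * (c * 2 ^ L) := by
      intro n
      have h3 : ∀ p ∈ Finset.range (L + 1), ∑ y ∈ Γ j p,
          ((hfin n (L - p) y).toFinset.card : ℝ) ≤ a n j (L - p) * (c * 2 ^ L) := by
        intro p hpL
        have hle : p ≤ L := Nat.lt_succ_iff.1 (Finset.mem_range.1 hpL)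
        refine (Finset.sum_le_sum fun y _ => hcol n (L - p) y).trans ?_
        rw [Finset.sum_const, nsmul_eq_mul]
        refine (mul_le_mul_of_nonneg_right (hΓ j p)
          (mul_nonneg (ha n j _).le (by positivity))).trans (le_of_eq ?_)
        rw [← Nat.sub_add_cancel hle, pow_add, Nat.add_sub_cancel]
        ring
      refine (Finset.sum_le_sum h3).trans ?_
      rw [← Finset.sum_mul]
      refine mul_le_mul_of_nonneg_right ?_ (by positivity)
      have := Finset.sum_range_reflect (a n j) (L + 1)
      simp only [Nat.add_sub_cancel] at this
      rw [this]
      exact (has n j).sum_le_tsum _ fun q _ => (ha n j q).le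
    refine (Finset.sum_le_sum fun n _ => h2 n).trans ?_
    rw [← Finset.sum_mul, mul_assoc]
    refine mul_le_mul_of_nonneg_right ?_ (by positivity)
    refine le_trans (Finset.sum_le_sum fun n _ => ?_) (le_add_of_nonneg_right zero_le_one)
    exact Finset.single_le_sum (f := fun j => ∑' q, a n j q) (fun j _ => hT n j)
      (Finset.mem_univ j)

end Problem

theorem norm_restr_restr_le {ι : Type*} (S T : Set ι) (v : L2 ι) :
    ‖restr S (restr T v)‖ ≤ ‖restr S v‖ := by
  classical
  refine norm_le_of_abs_le fun i => ?_
  by_cases hS : i ∈ S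
  · rw [restr_of_mem hS, restr_of_mem hS, restr_apply]
    split_ifs <;> simp
  · rw [restr_of_notMem hS, restr_of_notMem hS]

/-! ### Approximation classes -/

section ApproximationClasses

variable {J : Type*} {s : ℝ} {w : L2 J}

theorem nterm_le_card {F : Finset J} {ε : ℝ} (h : ‖w - restr (F : Set J) w‖ ≤ ε) :
    nterm w ε ≤ F.card := by
  refine Nat.sInf_le ⟨restr (F : Set J) w, ?_, h⟩
  rw [← Set.encard_coe_eq_coe_finsetCard]
  refine Set.encard_le_encard fun x hx => ?_
  by_contra hxF
  exact hx (restr_of_notMem hxF w)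

/-- Among the vectors with a given support, the restriction of `w` is closest to `w`, so every
competitor may be replaced by a restriction. -/
theorem exists_finset_card_le_nterm (w : L2 J) {ε : ℝ} (hε : 0 < ε) :
    ∃ F : Finset J, ‖w - restr (F : Set J) w‖ ≤ ε ∧ F.card ≤ nterm w ε := by
  classical
  have hne : {N : ℕ | ∃ v : L2 J, (Function.support v).encard ≤ N ∧ ‖w - v‖ ≤ ε}.Nonempty := by
    obtain ⟨F, hF⟩ := exists_finset_norm_sub_restr_le w hε
    refine ⟨F.card, restr (F : Set J) w, ?_, hF⟩
    rw [← Set.encard_coe_eq_coe_finsetCard]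
    refine Set.encard_le_encard fun x hx => ?_
    by_contra hxF
    exact hx (restr_of_notMem hxF w)
  obtain ⟨v, hv, hwv⟩ := Nat.sInf_mem hne
  have hfin : (Function.support v).Finite := Set.finite_of_encard_le_coe hv
  refine ⟨hfin.toFinset, (norm_le_of_abs_le fun i => ?_).trans hwv, ?_⟩
  · rw [lp.coeFn_sub, lp.coeFn_sub, Pi.sub_apply, Pi.sub_apply, restr_apply]
    by_cases hi : v i = 0 <;> simp [hi]
  · rw [hfin.encard_eq_coe_toFinset_card] at hv
    exact_mod_cast hv

theorem exists_finset_of_asNorm_lt_top (hs : 0 < s) (h : asNorm s w < ⊤) {ε : ℝ} (hε : 0 < ε) :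
    ∃ F : Finset J, ‖w - restr (F : Set J) w‖ ≤ ε ∧
      ε * (F.card : ℝ) ^ s ≤ (asNorm s w).toReal := by
  obtain ⟨F, hF, hcard⟩ := exists_finset_card_le_nterm w hε
  refine ⟨F, hF, ?_⟩
  have h1 : ENNReal.ofReal (ε * (nterm w ε : ℝ) ^ s) ≤ asNorm s w :=
    le_iSup₂ (f := fun (ε : ℝ) (_ : 0 < ε) => ENNReal.ofReal (ε * (nterm w ε : ℝ) ^ s)) ε hε
  refine le_trans ?_ ((ENNReal.ofReal_le_iff_le_toReal h.ne).1 h1)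
  have : (F.card : ℝ) ≤ nterm w ε := by exact_mod_cast hcard
  gcongr

/-- A vanishing quasi-norm makes the empty set admissible for every positive tolerance. -/
theorem eq_zero_of_asNorm_eq_zero (hs : 0 < s) (h : asNorm s w = 0) : w = 0 := by
  have hle : ∀ ε : ℝ, 0 < ε → ‖w‖ ≤ ε := by
    intro ε hε
    obtain ⟨F, hF, hcard⟩ := exists_finset_of_asNorm_lt_top hs (h ▸ ENNReal.zero_lt_top) hε
    have hF0 : F = ∅ := by
      by_contra hne
      have : 0 < (F.card : ℝ) := by
        exact_mod_cast Finset.card_pos.2 (Finset.nonempty_of_ne_empty hne)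
      rw [h] at hcard
      have h2 : 0 < ε * (F.card : ℝ) ^ s := by positivity
      exact absurd hcard (not_le.2 h2)
    have h0 : restr ((∅ : Finset J) : Set J) w = 0 := by
      ext i
      rw [restr_of_notMem (by simp)]
      rfl
    rwa [hF0, h0, sub_zero] at hF
  exact norm_eq_zero.1 (le_antisymm (le_of_forall_pos_le_add fun ε hε => by simpa using hle ε hε)
    (norm_nonneg _))

/-- Elements of `𝒜_s` have finitely supported approximations of size `O(ε^{-1/s})`. -/
theorem exists_card_le_of_asNorm_lt_top (hs : 0 < s) (h : asNorm s w < ⊤) :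
    ∃ c : ℝ, 0 < c ∧ ∀ ε : ℝ, 0 < ε → ∃ F : Finset J, ‖w - restr (F : Set J) w‖ ≤ ε ∧
      (F.card : ℝ) ≤ (c / ε) ^ (1 / s) := by
  refine ⟨(asNorm s w).toReal + 1, by positivity, fun ε hε => ?_⟩
  obtain ⟨F, hF, hcard⟩ := exists_finset_of_asNorm_lt_top hs h hε
  refine ⟨F, hF, ?_⟩
  rw [one_div, Real.le_rpow_inv_iff_of_pos (by positivity) (by positivity) hs, le_div_iff₀ hε]
  linarith

theorem exists_decay_of_asNorm_lt_top (hs : 0 < s) (h : asNorm s w < ⊤) :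
    ∃ c : ℝ, 0 < c ∧ ∀ p : ℕ, ∃ F : Finset J, F.card ≤ 2 ^ p ∧
      ‖w - restr (F : Set J) w‖ ≤ c * (2 : ℝ) ^ (-(s * p)) := by
  obtain ⟨c, hc, H⟩ := exists_card_le_of_asNorm_lt_top hs h
  refine ⟨c, hc, fun p => ?_⟩
  obtain ⟨F, hF, hcard⟩ := H (c * (2 : ℝ) ^ (-(s * p))) (by positivity)
  refine ⟨F, ?_, hF⟩
  have h1 : (c / (c * (2 : ℝ) ^ (-(s * p)))) ^ (1 / s) = (2 : ℝ) ^ p := by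
    rw [div_mul_cancel_left₀ hc.ne', ← Real.rpow_neg two_pos.le, neg_neg,
      ← Real.rpow_mul two_pos.le, ← Real.rpow_natCast]
    congr 1
    field_simp
  rw [h1] at hcard
  exact_mod_cast hcard

theorem tendsto_rpow_two_neg (hs : 0 < s) :
    Filter.Tendsto (fun p : ℕ => (2 : ℝ) ^ (-(s * p))) Filter.atTop (nhds 0) := by
  have h1 : ∀ p : ℕ, (2 : ℝ) ^ (-(s * p)) = ((2 : ℝ) ^ (-s)) ^ p := fun p => by
    rw [← Real.rpow_natCast, ← Real.rpow_mul two_pos.le, neg_mul]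
  simp_rw [h1]
  exact tendsto_pow_atTop_nhds_zero_of_lt_one (by positivity)
    (Real.rpow_lt_one_of_one_lt_of_neg one_lt_two (neg_neg_of_pos hs))

/-- For given `ε` take the first `p` with `c₂ 2^{-sp} ≤ ε`. It gives at most `c₁ 2^p` terms, and the
failure of `p - 1` bounds `2^p` by a multiple of `ε^{-1/s}`. -/
theorem asNorm_lt_top_of_decay (hs : 0 < s) {c₁ c₂ : ℝ} (hc₁ : 0 ≤ c₁)
    (h : ∀ p : ℕ, ∃ F : Finset J, (F.card : ℝ) ≤ c₁ * 2 ^ p ∧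
      ‖w - restr (F : Set J) w‖ ≤ c₂ * (2 : ℝ) ^ (-(s * p))) : asNorm s w < ⊤ := by
  have hc₂ : 0 ≤ c₂ := by
    obtain ⟨F, -, hF⟩ := h 0
    simpa using (norm_nonneg _).trans hF
  refine lt_of_le_of_lt (b := ENNReal.ofReal (‖w‖ * c₁ ^ s + c₂ * c₁ ^ s * 2 ^ s))
    (iSup₂_le fun ε hε => ENNReal.ofReal_le_ofReal ?_) ENNReal.ofReal_lt_top
  have hA : 0 ≤ ‖w‖ * c₁ ^ s := by positivity
  have hB : 0 ≤ c₂ * c₁ ^ s * 2 ^ s := by positivity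
  -- For `ε ≥ ‖w‖` no terms are needed, and `0^s = 0`. The other case provides `ε < ‖w‖`, which
  -- replaces the missing predecessor when `p = 0`.
  rcases le_or_gt ‖w‖ ε with hw | hw
  · have h0 : nterm w ε = 0 := by
      have := nterm_le_card (w := w) (F := ∅) (ε := ε) (by
        rw [sub_restr]
        exact (norm_restr_le _ _).trans hw)
      simpa using this
    rw [h0, Nat.cast_zero, Real.zero_rpow hs.ne', mul_zero]
    positivity
  · have hex : ∃ p : ℕ, c₂ * (2 : ℝ) ^ (-(s * p)) ≤ ε := by
      have h1 := (tendsto_rpow_two_neg hs).const_mul c₂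
      rw [mul_zero] at h1
      obtain ⟨p, hp⟩ := (h1.eventually (gt_mem_nhds hε)).exists
      exact ⟨p, hp.le⟩
    classical
    have hn : (nterm w ε : ℝ) ≤ c₁ * 2 ^ (Nat.find hex) := by
      obtain ⟨F, hF, hFn⟩ := h (Nat.find hex)
      have := nterm_le_card (hFn.trans (Nat.find_spec hex))
      exact le_trans (by exact_mod_cast this) hF
    have hn' : (nterm w ε : ℝ) ^ s ≤ c₁ ^ s * (2 ^ (Nat.find hex)) ^ s := by
      rw [← Real.mul_rpow hc₁ (by positivity)]
      exact Real.rpow_le_rpow (Nat.cast_nonneg _) hn hs.le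
    rcases hp : Nat.find hex with _ | q
    · rw [hp] at hn'
      simp only [pow_zero, Real.one_rpow, mul_one] at hn'
      have := mul_le_mul hw.le hn' (by positivity) (norm_nonneg _)
      linarith
    · have hlt : ε < c₂ * (2 : ℝ) ^ (-(s * q)) := by
        have := Nat.find_min hex (m := q) (by omega)
        exact not_le.1 this
      rw [hp] at hn'
      have h2 := mul_le_mul hlt.le hn' (by positivity) (by positivity)
      have h3 : c₂ * (2 : ℝ) ^ (-(s * q)) * (c₁ ^ s * (2 ^ (q + 1)) ^ s) = c₂ * c₁ ^ s * 2 ^ s := by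
        have h4 : ((2 : ℝ) ^ (q + 1)) ^ s = 2 ^ (s * q) * 2 ^ s := by
          rw [← Real.rpow_natCast, ← Real.rpow_mul two_pos.le, ← Real.rpow_add two_pos]
          congr 1
          push_cast
          ring
        have h5 : (2 : ℝ) ^ (-(s * q)) * 2 ^ (s * q) = 1 := by
          rw [← Real.rpow_add two_pos]; simp
        rw [h4]
        linear_combination (c₂ * c₁ ^ s * 2 ^ s) * h5
      linarith

end ApproximationClasses

/-! ### Sparsity of the solution, of the right-hand side and of its approximations. -/

namespace Problem

variable {d R : ℕ} {J : Type*} {P : Problem d R J} {s : ℝ}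

theorem Equation.spectralBounds {lmin lmax : ℝ} (h : P.Equation lmin lmax) :
    SpectralBounds P.Aδ lmin lmax := ⟨h.symm, h.lmin_pos, h.lmin_le, h.lower, h.upper⟩

theorem Equation.apply_sub {lmin lmax : ℝ} (h : P.Equation lmin lmax) (v : L2 (MIdx d J)) :
    P.Aδ (P.uδ - v) = P.fδ - P.Aδ v := by rw [map_sub, h.solution]

/-- Sparse approximations of the solution in all modes, with a common constant. -/
theorem exists_layers {u : L2 (MIdx d J)} (hs : 0 < s)
    (hu : ∀ j, asNorm s (contraction j u) < ⊤) :
    ∃ (c : ℝ) (F : Fin d → ℕ → Finset J), 0 < c ∧ ∀ j p, (F j p).card ≤ 2 ^ p ∧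
      ‖restr {l : MIdx d J | l j ∉ F j p} u‖ ≤ c * (2 : ℝ) ^ (-(s * p)) := by
  choose c hc F hF hFn using fun j => exists_decay_of_asNorm_lt_top hs (hu j)
  refine ⟨1 + ∑ j, c j, F, ?_, fun j p => ⟨hF j p, ?_⟩⟩
  · have := Finset.sum_nonneg fun j (_ : j ∈ Finset.univ) => (hc j).le
    linarith
  · rw [← norm_contraction_sub_restr]
    refine (hFn j p).trans (mul_le_mul_of_nonneg_right ?_ (by positivity))
    have := Finset.single_le_sum (f := c) (fun j _ => (hc j).le) (Finset.mem_univ j)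
    linarith

/-- The preconditioned right-hand side inherits the sparsity of the solution. -/
theorem asNorm_rhs_lt_top {lmin lmax : ℝ} (hscal : P.ScalingValid) (hsep : P.Separable)
    (heq : P.Equation lmin lmax) (hs : 0 < s)
    (hscheme : ∀ n j, IsCompressionScheme s (P.compHat n j) (P.compressed n j))
    (hu : ∀ j, asNorm s (contraction j P.uδ) < ⊤) (j : Fin d) :
    asNorm s (contraction j P.fδ) < ⊤ := by
  classical
  obtain ⟨c, F, hc, hF⟩ := exists_layers hs hu
  obtain ⟨CA, hCA, HA⟩ := exists_apply_error hscal hsep hs hscheme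
  obtain ⟨CG, hCG, HG⟩ := exists_support_bound hscheme
  obtain ⟨cS, hcS, hS⟩ := hscal.exists_Sinv_le
  have hSabs : ∀ l, |P.Sinv l| ≤ cS * (P.D l)⁻¹ := fun l => by
    rw [abs_of_pos (hS l).1]; exact (hS l).2
  refine asNorm_lt_top_of_decay hs (c₁ := CG)
    (c₂ := ‖P.Aδ‖ * (√d * c) + CA * cS ^ 2 * (‖P.uδ‖ + c)) hCG.le fun L => ?_
  set X := (2 : ℝ) ^ (-(s * L)) with hX
  have hX0 : 0 < X := Real.rpow_pos_of_pos two_pos _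
  set uL := restr (box fun j => F j L) P.uδ with huL
  have huLsupp : SuppIn (Fintype.piFinset fun j => F j L : Set (MIdx d J)) uL :=
    suppIn_box_piFinset (suppIn_restr _ _)
  obtain ⟨e, he, hen⟩ := HA F L (Fintype.piFinset fun j => F j L) uL P.Sinv P.Sinv cS
    (‖P.uδ‖ + c) hcS.le hSabs hSabs huLsupp
    ((norm_restr_le _ _).trans (by linarith)) fun i p => by
      refine (norm_restr_restr_le _ _ _).trans ((hF i p).2.trans (mul_le_mul_of_nonneg_right ?_
        (by positivity)))
      linarith [norm_nonneg P.uδ]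
  obtain ⟨G, hG, hGcard⟩ := HG F L 1 zero_le_one (fun i p => by
    rw [one_mul]; exact_mod_cast (hF i p).1) j
  refine ⟨G, by simpa using hGcard, ?_⟩
  -- `e` is the compression error on `uL`, so `A^δ uL - e` is the compressed product and lives over
  -- `G`. What remains of `f^δ` is `A^δ (u^δ - uL) + e`, of size `O(2^{-sL})`.
  have hval : ∀ l, l j ∉ G → P.Aδ uL l - e l = 0 := by
    intro l hl
    have h0 : ∀ m, P.matL F L l m = 0 := fun m => by
      by_contra h
      exact hl (hG l m h)
    rw [he, apply_of_suppIn P.Aδ huLsupp, tsum_eq_sum (s := Fintype.piFinset fun j => F j L)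
      fun m hm => by rw [huLsupp m (by simpa using hm)]; simp]
    rw [Finset.mul_sum, ← Finset.sum_sub_distrib]
    refine Finset.sum_eq_zero fun m _ => ?_
    rw [heq.entry_eq, h0]
    ring
  have h1 : ‖contraction j P.fδ - restr (G : Set J) (contraction j P.fδ)‖ ≤
      ‖P.Aδ (P.uδ - uL) + e‖ := by
    rw [norm_contraction_sub_restr]
    refine norm_le_of_abs_le fun l => ?_
    rw [restr_apply]
    split_ifs with hl
    · have h2 := hval l hl
      have h3 : (P.Aδ (P.uδ - uL) + e) l = P.fδ l - (P.Aδ uL l - e l) := by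
        rw [heq.apply_sub]
        simp only [lp.coeFn_add, lp.coeFn_sub, Pi.add_apply, Pi.sub_apply]
        ring
      rw [h3, h2, sub_zero]
    · simp
  have h2 : ‖P.uδ - uL‖ ≤ √d * (c * X) :=
    (norm_sub_restr_box_le _ _).trans (tail_le _ _ (by positivity) fun i => (hF i L).2)
  have h3 : ‖P.Aδ (P.uδ - uL)‖ ≤ ‖P.Aδ‖ * (√d * (c * X)) :=
    (P.Aδ.le_opNorm _).trans (mul_le_mul_of_nonneg_left h2 (norm_nonneg _))
  refine h1.trans ((norm_add_le _ _).trans ((add_le_add h3 hen).trans (le_of_eq ?_)))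
  ring

/-- The assumption bounds the supports of `S⁻¹(δ) f_ε`, and dividing by the positive scaling keeps
supports. The `𝒜_s` norms of `f^δ` become part of the constant because they are finite. -/
theorem exists_fApprox_support_bound (hscal : P.ScalingValid) (hs : 0 < s)
    (hrhs : P.RhsApproximable s) (hf : ∀ j, asNorm s (contraction j P.fδ) < ⊤) :
    ∃ C : ℝ, 0 < C ∧ ∀ ε : ℝ, 0 < ε → ∀ j, ∃ G : Finset J,
      (∀ l, P.fApprox ε l ≠ 0 → l j ∈ G) ∧ (G.card : ℝ) ≤ C * ε ^ (-1 / s) := by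
  obtain ⟨C, hC, H⟩ := hrhs
  obtain ⟨cS, hcS, hS⟩ := hscal.exists_Sinv_le
  set X : ℝ≥0∞ := (∑ j, asNorm s (contraction j P.fδ)) ^ (1 / s) with hX
  have hXtop : X ≠ ⊤ :=
    ENNReal.rpow_ne_top_of_nonneg (by positivity) (ENNReal.sum_ne_top.2 fun j _ => (hf j).ne)
  refine ⟨C * (X.toReal + 1), by positivity, fun ε hε j => ?_⟩
  obtain ⟨-, g, hg, hsupp, -⟩ := H ε hε
  have h1 : (((Function.support (contraction j g)).encard : ℕ∞) : ℝ≥0∞) ≤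
      ENNReal.ofReal (C * ε ^ (-1 / s)) * X :=
    (Finset.single_le_sum (f := fun j =>
      (((Function.support (contraction j g)).encard : ℕ∞) : ℝ≥0∞)) (fun _ _ => zero_le)
      (Finset.mem_univ j)).trans hsupp
  have htop : ENNReal.ofReal (C * ε ^ (-1 / s)) * X ≠ ⊤ :=
    ENNReal.mul_ne_top ENNReal.ofReal_ne_top hXtop
  have hfin : (Function.support (contraction j g)).Finite := by
    rw [← Set.encard_lt_top_iff, lt_top_iff_ne_top]
    intro h
    rw [h] at h1
    exact htop (top_le_iff.1 (by simpa using h1))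
  refine ⟨hfin.toFinset, fun l hl => ?_, ?_⟩
  · rw [Set.Finite.mem_toFinset, Function.mem_support]
    refine (contraction_ne_zero_iff j g (l j)).2 ⟨l, rfl, ?_⟩
    rw [hg]
    exact mul_ne_zero (hS l).1.ne' hl
  · rw [hfin.encard_eq_coe_toFinset_card] at h1
    have h2 := ENNReal.toReal_mono htop h1
    rw [ENNReal.toReal_mul, ENNReal.toReal_ofReal (by positivity)] at h2
    simp only [ENat.toENNReal_coe, ENNReal.toReal_natCast] at h2
    have : 0 ≤ C * ε ^ (-1 / s) := by positivity
    nlinarith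

end Problem

/-! ### Sizes of approximate residuals -/

/-- Tolerances stay below a fixed `W`, so bounded quantities can be absorbed into multiples of
`x^{-1/s}`. -/
theorem rpow_inv_mul_rpow_neg_inv_ge_one {s W x : ℝ} (hs : 0 < s) (hx : 0 < x) (hxW : x ≤ W) :
    1 ≤ W ^ (1 / s) * x ^ (-1 / s) := by
  have hW : 0 < W := hx.trans_le hxW
  rw [neg_div, Real.rpow_neg hx.le, ← div_eq_mul_inv, one_le_div (by positivity)]
  exact Real.rpow_le_rpow hx.le hxW (by positivity)

theorem rpow_neg_inv_le {s c x y : ℝ} (hs : 0 < s) (hc : 0 < c) (hx : 0 < x) (h : c * x ≤ y) :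
    y ^ (-1 / s) ≤ c ^ (-1 / s) * x ^ (-1 / s) := by
  rw [← Real.mul_rpow hc.le hx.le]
  exact Real.rpow_le_rpow_of_nonpos (by positivity) h
    (div_nonpos_of_nonpos_of_nonneg (by norm_num) hs.le)

theorem two_pow_le_of_lt {s a x : ℝ} {q : ℕ} (hs : 0 < s) (ha : 0 < a) (hx : 0 < x)
    (h : x ≤ a * (2 : ℝ) ^ (-(s * q))) : (2 : ℝ) ^ q ≤ a ^ (1 / s) * x ^ (-1 / s) := by
  rw [neg_div, Real.rpow_neg hx.le, ← div_eq_mul_inv, ← Real.div_rpow ha.le hx.le, one_div,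
    Real.le_rpow_inv_iff_of_pos (by positivity) (by positivity) hs, le_div_iff₀ hx]
  have h1 : ((2 : ℝ) ^ q) ^ s * (2 : ℝ) ^ (-(s * q)) = 1 := by
    rw [← Real.rpow_natCast, ← Real.rpow_mul two_pos.le, ← Real.rpow_add two_pos]
    have : (q : ℝ) * s + -(s * q) = 0 := by ring
    rw [this, Real.rpow_zero]
  calc _ ≤ ((2 : ℝ) ^ q) ^ s * (a * (2 : ℝ) ^ (-(s * q))) :=
        mul_le_mul_of_nonneg_left h (by positivity)
    _ = a := by linear_combination a * h1

theorem le_of_two_pow_lt {s a x : ℝ} {p : ℕ} (hs : 0 < s) (ha : 0 < a) (hx : 0 < x)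
    (h : (2 : ℝ) ^ p ≤ a * x ^ (-1 / s)) : x ≤ a ^ s * (2 : ℝ) ^ (-(s * p)) := by
  have h1 := Real.rpow_le_rpow (by positivity) h hs.le
  rw [Real.mul_rpow ha.le (by positivity), ← Real.rpow_mul hx.le, div_mul_cancel₀ _ hs.ne',
    Real.rpow_neg_one, ← div_eq_mul_inv, le_div_iff₀ hx, ← Real.rpow_natCast,
    ← Real.rpow_mul two_pos.le] at h1
  rw [Real.rpow_neg two_pos.le, ← div_eq_mul_inv, le_div_iff₀ (by positivity), mul_comm x,
    mul_comm s]
  exact h1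

/-! ### Layers of iterates and supports of computed residuals. -/

namespace Problem

variable {d R : ℕ} {J : Type*} {P : Problem d R J} {s : ℝ}

/-- Decay of best layers of an iterate which is close to a sparse tensor `u` in comparison to the
size of its support. -/
theorem norm_restr_layer_le {u v : L2 (MIdx d J)} {c c' : ℝ} {F : Fin d → ℕ → Finset J}
    (hc' : 0 ≤ c') (hF : ∀ j p, (F j p).card ≤ 2 ^ p ∧
      ‖restr {l : MIdx d J | l j ∉ F j p} u‖ ≤ c * (2 : ℝ) ^ (-(s * p)))
    {Λ : Fin d → Finset J} (hv : SuppIn (box Λ) v) (j : Fin d)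
    (hclose : ∀ p : ℕ, 2 ^ p < (Λ j).card → ‖u - v‖ ≤ c' * (2 : ℝ) ^ (-(s * p)))
    {Γ : ℕ → Finset J} (hΓ : IsBestLayers (contraction j v) Γ) (p : ℕ) :
    ‖restr {l : MIdx d J | l j ∉ Γ p} v‖ ≤ (c + c') * (2 : ℝ) ^ (-(s * p)) := by
  have hX : 0 < (2 : ℝ) ^ (-(s * p)) := Real.rpow_pos_of_pos two_pos _
  have hbest : ∀ G : Finset J, G.card ≤ 2 ^ p →
      ‖restr {l : MIdx d J | l j ∉ Γ p} v‖ ≤ ‖restr {l : MIdx d J | l j ∉ G} v‖ := by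
    intro G hG
    rw [← norm_contraction_sub_restr, ← norm_contraction_sub_restr]
    exact (hΓ.2 p).2 G hG
  have hc : 0 ≤ c * (2 : ℝ) ^ (-(s * p)) := (norm_nonneg _).trans (hF j p).2
  -- A layer as large as the support leaves nothing outside. A smaller one is at least as good as
  -- the layer `F j p` of `u`, and there closeness to `u` is assumed at the required rate.
  rcases le_or_gt (Λ j).card (2 ^ p) with hle | hlt
  · refine (hbest _ hle).trans ?_
    have h0 : restr {l : MIdx d J | l j ∉ Λ j} v = 0 := by
      ext l
      by_cases hl : l j ∈ Λ j
      · rw [restr_of_notMem (by simpa using hl)]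
        rfl
      · rw [restr_of_mem (by exact hl), hv l fun h => hl (h j)]
        rfl
    rw [h0, norm_zero, add_mul]
    positivity
  · refine (hbest _ (hF j p).1).trans ?_
    have h1 : restr {l : MIdx d J | l j ∉ F j p} v = restr {l : MIdx d J | l j ∉ F j p} u -
        restr {l : MIdx d J | l j ∉ F j p} (u - v) := by
      rw [restr_sub, sub_sub_cancel]
    rw [h1, add_mul]
    exact (norm_sub_le _ _).trans (add_le_add (hF j p).2
      ((norm_restr_le _ _).trans (hclose p hlt)))

/-- The support of an approximate residual with a relative accuracy: if the current support has
size `O(x^{-1/s})`, and both the error and the residual are comparable to `x`, then the support of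
the residual has size `O(x^{-1/s})`. -/
theorem exists_residual_support_bound (hscal : P.ScalingValid) (hsep : P.Separable) (hs : 0 < s)
    (hscheme : ∀ n j, IsCompressionScheme s (P.compHat n j) (P.compressed n j))
    (hrhs : P.RhsApproximable s) (hu : ∀ j, asNorm s (contraction j P.uδ) < ⊤)
    (hf : ∀ j, asNorm s (contraction j P.fδ) < ⊤) {cRes ω₁ : ℝ} (hcRes : 0 < cRes)
    {C₁ C₂ c₃ W : ℝ} (hC₁ : 0 < C₁) (hC₂ : 0 < C₂) (hc₃ : 0 < c₃) (hW : 0 < W) :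
    ∃ C : ℝ, 0 < C ∧ ∀ x : ℝ, 0 < x → x ≤ W → ∀ (Λ : Fin d → Finset J) (v r : L2 (MIdx d J)),
      SuppIn (box Λ) v → ∑ j, ((Λ j).card : ℝ) ≤ C₁ * x ^ (-1 / s) → ‖P.uδ - v‖ ≤ C₂ * x →
      P.IsRES cRes ω₁ v r → c₃ * x ≤ ‖r‖ →
      ∃ G : Fin d → Finset J, (∀ l, r l ≠ 0 → ∀ j, l j ∈ G j) ∧
        ∑ j, ((G j).card : ℝ) ≤ C * x ^ (-1 / s) := by
  classical
  obtain ⟨c, F, hc, hF⟩ := exists_layers hs hu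
  obtain ⟨CA, hCA, HA⟩ := exists_apply_error hscal hsep hs hscheme
  obtain ⟨CG, hCG, HG⟩ := exists_support_bound hscheme
  obtain ⟨Cf, hCf, Hf⟩ := exists_fApprox_support_bound hscal hs hrhs hf
  have hδ := hscal.δ_pos
  set q₀ : ℝ := 3 * (1 + P.δ) * (2 + P.δ) with hq₀
  have hq₀pos : 0 < q₀ := by positivity
  -- The data tolerance is `tol / q₀` with `tol ≥ cRes ‖r‖ ≥ cRes c₃ x`, hence at least `cε x`.
  set cε : ℝ := cRes * c₃ / q₀ with hcε
  have hcεpos : 0 < cε := by positivity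
  set M : ℝ := (‖P.uδ‖ + C₂ * W) + (c + C₂ * C₁ ^ s) with hM
  have hM0 : 0 < M := by positivity
  -- The first term covers `L = 0`; in the second, the factor 2 leads from the rejected level `L -
  -- 1` back to `L`.
  set CL : ℝ := W ^ (1 / s) + 2 * (CA * M / cε) ^ (1 / s) with hCL
  have hCL0 : 0 < CL := by positivity
  refine ⟨d * (Cf * cε ^ (-1 / s) + CG * CL) + 1, by positivity, ?_⟩
  intro x hx hxW Λ v r hv hΛ herr hres hrx
  have hX0 : 0 < x ^ (-1 / s) := Real.rpow_pos_of_pos hx _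
  have hrpos : 0 < ‖r‖ := (by positivity : 0 < c₃ * x).trans_le hrx
  rcases hres with ⟨-, rfl⟩ | ⟨-, tol, ε, η, T, Γ, L, n, g, htol, hctol, -, hε, hΓ, hL, hg, -, -, -,
    -, hr⟩
  · simp at hrpos
  have hε0 : 0 < ε := by rw [hε]; positivity
  have hεx : cε * x ≤ ε := by
    rw [hε, hcε, div_mul_eq_mul_div]
    refine div_le_div_of_nonneg_right ?_ hq₀pos.le
    refine le_trans ?_ hctol
    rw [mul_assoc]
    exact mul_le_mul_of_nonneg_left hrx hcRes.le
  have hvM : ‖v‖ ≤ M := by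
    have h1 := norm_sub_norm_le v P.uδ
    rw [norm_sub_rev] at h1
    have h2 := mul_le_mul_of_nonneg_left hxW hC₂.le
    have h3 : 0 ≤ c + C₂ * C₁ ^ s := by positivity
    linarith
  have hdecay : ∀ j (p : ℕ),
      ‖restr {l : MIdx d J | l j ∉ Γ j p} v‖ ≤ M * (2 : ℝ) ^ (-(s * p)) := by
    intro j p
    refine (norm_restr_layer_le (c' := C₂ * C₁ ^ s) (by positivity) hF hv j ?_ (hΓ j) p).trans
      (mul_le_mul_of_nonneg_right ?_ (by positivity))
    · intro p hp
      have h1 : ((Λ j).card : ℝ) ≤ C₁ * x ^ (-1 / s) :=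
        (Finset.single_le_sum (f := fun j => ((Λ j).card : ℝ)) (fun _ _ => Nat.cast_nonneg _)
          (Finset.mem_univ j)).trans hΛ
      have h2 : (2 : ℝ) ^ p ≤ C₁ * x ^ (-1 / s) := le_trans (by exact_mod_cast hp.le) h1
      refine herr.trans ?_
      rw [mul_assoc]
      exact mul_le_mul_of_nonneg_left (le_of_two_pow_lt hs hC₁ hx h2) hC₂.le
    · have : 0 ≤ ‖P.uδ‖ + C₂ * W := by positivity
      linarith
  have hLbound : (2 : ℝ) ^ L ≤ CL * x ^ (-1 / s) := by
    have h1 := rpow_inv_mul_rpow_neg_inv_ge_one hs hx hxW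
    have h2 : 0 ≤ (CA * M / cε) ^ (1 / s) * x ^ (-1 / s) := by positivity
    have h3 : CL * x ^ (-1 / s) = W ^ (1 / s) * x ^ (-1 / s) +
        2 * ((CA * M / cε) ^ (1 / s) * x ^ (-1 / s)) := by rw [hCL]; ring
    rw [h3]
    rcases L with _ | q
    · simp only [pow_zero]
      linarith
    -- Level `q = L - 1` misses the tolerance although its error is at most `CA M 2^{-sq}`; this
    -- bounds `2^q` from above.
    · have hnot : ¬ P.ApplyAccurate Γ v ε q := fun h => by
        have := hL.2 h
        omega
      have hDabs : ∀ l, |(P.D l)⁻¹| ≤ 1 * (P.D l)⁻¹ := fun l => by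
        rw [one_mul, abs_of_pos (inv_pos.2 (zero_lt_one.trans_le (hscal.D_ge_one l)))]
      obtain ⟨e, he, hen⟩ := HA Γ q (Fintype.piFinset Λ) v (fun l => (P.D l)⁻¹)
        (fun l => (P.D l)⁻¹) 1 M zero_le_one hDabs hDabs (suppIn_box_piFinset hv) hvM hdecay
      have hlt : ε < CA * M * (2 : ℝ) ^ (-(s * q)) := by
        by_contra hge
        refine hnot ⟨e, he, hen.trans ?_⟩
        rw [one_pow, mul_one]
        exact not_lt.1 hge
      have h4 : x ≤ CA * M / cε * (2 : ℝ) ^ (-(s * q)) := by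
        rw [div_mul_eq_mul_div, le_div_iff₀ hcεpos]
        linarith
      have h5 := two_pow_le_of_lt hs (by positivity) hx h4
      rw [pow_succ]
      linarith
  choose G₁ hG₁ hG₁card using Hf ε hε0
  choose G₂ hG₂ hG₂card using HG Γ L 1 zero_le_one fun j p => by
    rw [one_mul]; exact_mod_cast ((hΓ j).2 p).1
  refine ⟨fun j => G₁ j ∪ G₂ j, fun l hl j => ?_, ?_⟩
  · rw [Finset.mem_union]
    by_contra! h
    have h1 : P.fApprox ε l = 0 := by
      by_contra h0
      exact h.1 (hG₁ j l h0)
    have h2 : g l = 0 := by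
      rw [hg]
      refine (tsum_congr fun m => ?_).trans tsum_zero
      have : P.matL Γ L l m = 0 := by
        by_contra h0
        exact h.2 (hG₂ j l m h0)
      rw [this, zero_mul]
    exact hl (by rw [hr, h1, h2]; simp)
  · have h1 : ∀ j, ((G₁ j ∪ G₂ j).card : ℝ) ≤ (Cf * cε ^ (-1 / s) + CG * CL) * x ^ (-1 / s) := by
      intro j
      have h2 : ((G₁ j ∪ G₂ j).card : ℝ) ≤ (G₁ j).card + (G₂ j).card := by
        exact_mod_cast Finset.card_union_le _ _
      have h3 := mul_le_mul_of_nonneg_left (rpow_neg_inv_le hs hcεpos hx hεx) hCf.le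
      have h4 := mul_le_mul_of_nonneg_left hLbound hCG.le
      have h5 := hG₁card j
      have h6 := hG₂card j
      rw [mul_one] at h6
      linarith
    refine (Finset.sum_le_sum fun j _ => h1 j).trans ?_
    rw [Finset.sum_const, Finset.card_univ, Fintype.card_fin, nsmul_eq_mul]
    linarith

end Problem

/-! ### Convergence of the adaptive algorithm -/

namespace Params

variable {d : ℕ} {J : Type*} {q : Params d J}

theorem Convergence.ω₀k_pos (h : q.Convergence) (k : ℕ) : 0 < q.ω₀k k := by
  have := h.ω₀_pos
  have := h.ω₃_pos
  have := h.ω₄_pos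
  have := h.ω₅_pos
  unfold ω₀k
  positivity

theorem ω₀k_succ (k : ℕ) : q.ω₀k (k + 1) = (q.ω₃ + q.ω₄ + q.ω₅) * q.ω₀k k := by
  unfold ω₀k
  ring

theorem Convergence.ω₀k_succ_le (h : q.Convergence) (k : ℕ) : q.ω₀k (k + 1) ≤ q.ω₀k k := by
  rw [ω₀k_succ]
  exact mul_le_of_le_one_left (h.ω₀k_pos k).le h.sum_lt.le

theorem Convergence.ω₀k_le (h : q.Convergence) (k : ℕ) : q.ω₀k k ≤ q.ω₀ := by
  induction k with
  | zero => simp [ω₀k]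
  | succ k ih => exact (h.ω₀k_succ_le k).trans ih

theorem Convergence.ω₁_lt_one (h : q.Convergence) : q.ω₁ < 1 := by
  have := h.ω₁_lt
  have := h.bulk_lt
  linarith

theorem Convergence.bulk_quotient (h : q.Convergence) : 0 < (q.bulk - q.ω₁) / (1 + q.ω₁) ∧
    (q.bulk - q.ω₁) / (1 + q.ω₁) < 1 := by
  have h1 := h.ω₁_pos
  have h2 := h.ω₁_lt
  have h3 := h.bulk_lt
  refine ⟨div_pos (by linarith) (by linarith), ?_⟩
  rw [div_lt_one (by linarith)]
  linarith

theorem Convergence.tol_quotient (h : q.Convergence) : 0 < q.ω₂ / (1 - q.ω₁) ∧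
    q.ω₂ / (1 - q.ω₁) < (q.bulk - q.ω₁) / (1 + q.ω₁) * q.κ⁻¹ := by
  have h1 := h.ω₁_lt_one
  refine ⟨div_pos h.ω₂_pos (by linarith), ?_⟩
  rw [div_lt_iff₀ (by linarith)]
  have h2 := h.ω₂_lt
  calc q.ω₂ < _ := h2
    _ = _ := by ring

theorem one_le_κ (hl : 0 < q.lmin) (hle : q.lmin ≤ q.lmax) : 1 ≤ q.κ := (one_le_div hl).2 hle

/-- The condition on `ω₂` says precisely that the energy lost by inexact solving is less than the
gain from the bulk criterion, whence `ϑ < 1`. -/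
theorem Convergence.tol_sq_lt (h : q.Convergence) (hl : 0 < q.lmin) (hle : q.lmin ≤ q.lmax) :
    (q.ω₂ / (1 - q.ω₁)) ^ 2 * q.κ <
    ((q.bulk - q.ω₁) / (1 + q.ω₁)) ^ 2 * q.κ⁻¹ := by
  obtain ⟨h0, h1⟩ := h.tol_quotient
  have hκ : 0 < q.κ := zero_lt_one.trans_le (one_le_κ hl hle)
  have h2 := pow_lt_pow_left₀ h1 h0.le two_ne_zero
  calc _ < (((q.bulk - q.ω₁) / (1 + q.ω₁)) * q.κ⁻¹) ^ 2 * q.κ :=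
        mul_lt_mul_of_pos_right h2 hκ
    _ = _ := by field_simp

theorem Convergence.bulk_sq_lt (h : q.Convergence) (hl : 0 < q.lmin) (hle : q.lmin ≤ q.lmax) :
    ((q.bulk - q.ω₁) / (1 + q.ω₁)) ^ 2 * q.κ⁻¹ < 1 := by
  obtain ⟨h0, h1⟩ := h.bulk_quotient
  have hκ := one_le_κ hl hle
  have h2 : ((q.bulk - q.ω₁) / (1 + q.ω₁)) ^ 2 < 1 := pow_lt_one₀ h0.le h1 two_ne_zero
  have h3 : q.κ⁻¹ ≤ 1 := inv_le_one_of_one_le₀ hκ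
  have h4 : 0 < q.κ⁻¹ := inv_pos.2 (by linarith)
  nlinarith

theorem Convergence.ϑ_sq (h : q.Convergence) (hl : 0 < q.lmin)
    (hle : q.lmin ≤ q.lmax) : q.ϑ ^ 2 = 1 - ((q.bulk - q.ω₁) / (1 + q.ω₁)) ^ 2 * q.κ⁻¹ +
    (q.ω₂ / (1 - q.ω₁)) ^ 2 * q.κ := by
  refine Real.sq_sqrt ?_
  have h1 := h.bulk_sq_lt hl hle
  have hκ := one_le_κ hl hle
  have h2 : 0 ≤ (q.ω₂ / (1 - q.ω₁)) ^ 2 * q.κ := by positivity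
  linarith

theorem Convergence.ϑ_pos (h : q.Convergence) (hl : 0 < q.lmin)
    (hle : q.lmin ≤ q.lmax) : 0 < q.ϑ := by
  refine Real.sqrt_pos.2 ?_
  have h1 := h.bulk_sq_lt hl hle
  have hκ := one_le_κ hl hle
  have h2 : 0 ≤ (q.ω₂ / (1 - q.ω₁)) ^ 2 * q.κ := by positivity
  linarith

theorem Convergence.ϑ_lt_one (h : q.Convergence) (hl : 0 < q.lmin)
    (hle : q.lmin ≤ q.lmax) : q.ϑ < 1 := by
  have h1 := h.ϑ_sq hl hle
  have h2 := h.tol_sq_lt hl hle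
  have h3 := h.ϑ_pos hl hle
  nlinarith

/-- Taking logarithms, the lower bound on `M` gives `ϑ^M ≤ ω₃ κ^{-1/2}`; this is its square, as
needed for energies. -/
theorem Convergence.ϑ_pow_le (h : q.Convergence) (hl : 0 < q.lmin) (hle : q.lmin ≤ q.lmax) :
    (q.ϑ ^ 2) ^ q.M ≤ q.ω₃ ^ 2 * q.κ⁻¹ := by
  have h0 := h.ϑ_pos hl hle
  have h1 := h.ϑ_lt_one hl hle
  have hκ := one_le_κ hl hle
  have hω₃ := h.ω₃_pos
  have hω₃1 : q.ω₃ < 1 := by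
    have := h.sum_lt
    have := h.ω₄_pos
    have := h.ω₅_pos
    linarith
  set y := q.ω₃ * q.κ ^ (-1 / 2 : ℝ) with hy
  have hy0 : 0 < y := by positivity
  have hsq : y ^ 2 = q.ω₃ ^ 2 * q.κ⁻¹ := by
    rw [hy, mul_pow, ← Real.rpow_natCast (q.κ ^ (-1 / 2 : ℝ)), ← Real.rpow_mul (by linarith)]
    norm_num [Real.rpow_neg_one]
  have hlog : Real.log q.ϑ < 0 := Real.log_neg h0 h1
  have hM : Real.log y / Real.log q.ϑ ≤ q.M :=
    (le_abs_self _).trans ((Nat.le_ceil _).trans (Nat.cast_le.2 h.M_ge))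
  have h2 : q.M * Real.log q.ϑ ≤ Real.log y := by
    rwa [div_le_iff_of_neg hlog] at hM
  have h3 : q.ϑ ^ q.M ≤ y := by
    rw [← Real.log_le_log_iff (by positivity) hy0, Real.log_pow]
    exact h2
  rw [← hsq, ← pow_mul, mul_comm 2, pow_mul]
  exact pow_le_pow_left₀ (by positivity) h3 2

end Params

section Convergence

variable {d R : ℕ} {J : Type*} {P : Problem d R J} {q : Params d J}

theorem Problem.IsRES.norm_le {cRes ω₁ : ℝ} {v r : L2 (MIdx d J)} (h : P.IsRES cRes ω₁ v r) :
    ‖P.fδ - P.Aδ v - r‖ ≤ ω₁ * ‖r‖ := by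
  rcases h with ⟨h1, rfl⟩ | h
  · simp [h1]
  · exact h.1

/-- A bound for the energy norm of the error, squared, in the `k`-th outer iteration. -/
def energyBound (q : Params d J) (k : ℕ) : ℝ := 81 / 25 * (q.κ / q.lmin) * q.ω₀k k ^ 2

/-- The properties of the iterates on which the convergence of the algorithm rests. -/
structure IterateBounds (P : Problem d R J) (q : Params d J) (k m : ℕ) (Λ : Fin d → Finset J)
    (u : L2 (MIdx d J)) (ρ : ℝ) : Prop where
  suppIn : SuppIn (box Λ) u
  le_M : m ≤ q.M
  first : m = 0 →
    inner ℝ (P.uδ - u) (P.Aδ (P.uδ - u)) + (q.ω₂ * ρ) ^ 2 / q.lmin ≤ energyBound q k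
  later : ∀ m', m = m' + 1 →
    inner ℝ (P.uδ - u) (P.Aδ (P.uδ - u)) ≤ (q.ϑ ^ 2) ^ m' * energyBound q k ∧
    ∃ r : L2 (MIdx d J), ρ = ‖r‖ ∧ ‖P.Aδ (P.uδ - u) - r‖ ≤ q.ω₁ * ‖r‖ ∧
      q.bulk * ‖r‖ ≤ ‖restr (box Λ) r‖

theorem energyBound_nonneg (heq : P.Equation q.lmin q.lmax) (k : ℕ) : 0 ≤ energyBound q k := by
  have h1 := Params.one_le_κ heq.lmin_pos heq.lmin_le
  have := heq.lmin_pos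
  unfold energyBound
  positivity

/-- The factor `κ / lmin` in `energyBound` is cancelled by `κ⁻¹` and by passing from energy to norm,
and `9/5` is the root of `81/25`. It is used with `c = ω₃` at the end of an inner loop and with `c =
κ` elsewhere. -/
theorem norm_le_of_energy_le (hconv : q.Convergence) (heq : P.Equation q.lmin q.lmax) {k : ℕ}
    {e : L2 (MIdx d J)} {c : ℝ} (hc : 0 ≤ c)
    (h : inner ℝ e (P.Aδ e) ≤ c ^ 2 * q.κ⁻¹ * energyBound q k) :
    ‖e‖ ≤ 9 / 5 * c * (q.lmin⁻¹ * q.ω₀k k) := by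
  have hl := heq.lmin_pos
  have hκ := Params.one_le_κ heq.lmin_pos heq.lmin_le
  have hx := hconv.ω₀k_pos k
  refine le_of_sq_le_sq ?_ (by positivity)
  have h1 := (heq.lower e).trans h
  have h2 : c ^ 2 * q.κ⁻¹ * energyBound q k =
      q.lmin * (9 / 5 * c * (q.lmin⁻¹ * q.ω₀k k)) ^ 2 := by
    unfold energyBound
    field_simp
    ring
  rw [h2] at h1
  exact le_of_mul_le_mul_left h1 hl

theorem norm_error_le (hconv : q.Convergence) (heq : P.Equation q.lmin q.lmax) {k : ℕ}
    {e : L2 (MIdx d J)}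
    (h : inner ℝ e (P.Aδ e) ≤ energyBound q k) : ‖e‖ ≤ 9 / 5 * q.κ * q.lmin⁻¹ * q.ω₀k k := by
  have hκ := Params.one_le_κ heq.lmin_pos heq.lmin_le
  have h1 : inner ℝ e (P.Aδ e) ≤ q.κ ^ 2 * q.κ⁻¹ * energyBound q k := by
    refine h.trans (le_mul_of_one_le_left (energyBound_nonneg heq k) ?_)
    rwa [sq, mul_assoc, mul_inv_cancel₀ (by linarith), mul_one]
  have := norm_le_of_energy_le hconv heq (by linarith) h1
  linarith

/-- The energy after solving the Galerkin problem approximately. -/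
theorem IterateBounds.energy_solve (hconv : q.Convergence) (heq : P.Equation q.lmin q.lmax)
    {k m : ℕ} {Λ : Fin d → Finset J} {u u' : L2 (MIdx d J)} {ρ : ℝ}
    (hI : IterateBounds P q k m Λ u ρ) (solve : IsPCG P.Aδ P.fδ u (box Λ) (q.ω₂ * ρ) u') :
    inner ℝ (P.uδ - u') (P.Aδ (P.uδ - u')) ≤ (q.ϑ ^ 2) ^ m * energyBound q k := by
  have hspec := heq.spectralBounds
  have hsupp := solve.suppIn hI.suppIn
  have hres : ‖restr (box Λ) (P.Aδ (P.uδ - u'))‖ ≤ q.ω₂ * ρ := by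
    rw [heq.apply_sub]
    exact solve.norm_residual_le
  rcases m with _ | m'
  -- No bulk criterion holds for the first solve. Quasi-optimality against the starting value itself
  -- costs `(ω₂ ρ)² / lmin`, which `first` includes.
  · rw [pow_zero, one_mul]
    exact (hspec.energy_le_of_residual_le (hsupp.sub hI.suppIn) hres).trans (hI.first rfl)
  · obtain ⟨hen, r, rfl, hr, hbulk⟩ := hI.later m' rfl
    have h1 := hspec.energy_step hconv.ω₁_pos hconv.ω₁_lt hconv.bulk_lt hI.suppIn hsupp hr hbulk
      hres
    have h2 := hconv.ϑ_sq heq.lmin_pos heq.lmin_le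
    rw [← Params.κ, ← h2] at h1
    refine h1.trans ((mul_le_mul_of_nonneg_left hen (sq_nonneg _)).trans (le_of_eq ?_))
    rw [pow_succ]
    ring

theorem IterateBounds.energy_solve_le (hconv : q.Convergence) (heq : P.Equation q.lmin q.lmax)
    {k m : ℕ} {Λ : Fin d → Finset J} {u u' : L2 (MIdx d J)}
    {ρ : ℝ} (hI : IterateBounds P q k m Λ u ρ)
    (solve : IsPCG P.Aδ P.fδ u (box Λ) (q.ω₂ * ρ) u') :
    inner ℝ (P.uδ - u') (P.Aδ (P.uδ - u')) ≤ energyBound q k := by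
  refine (hI.energy_solve hconv heq solve).trans
    (mul_le_of_le_one_left (energyBound_nonneg heq k) (pow_le_one₀ (sq_nonneg _) ?_))
  exact pow_le_one₀ (hconv.ϑ_pos heq.lmin_pos heq.lmin_le).le
    (hconv.ϑ_lt_one heq.lmin_pos heq.lmin_le).le

theorem IterateBounds.energy_le (hconv : q.Convergence) (heq : P.Equation q.lmin q.lmax)
    {k m : ℕ} {Λ : Fin d → Finset J} {u : L2 (MIdx d J)}
    {ρ : ℝ} (hI : IterateBounds P q k m Λ u ρ) :
    inner ℝ (P.uδ - u) (P.Aδ (P.uδ - u)) ≤ energyBound q k := by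
  rcases m with _ | m'
  · have h1 := hI.first rfl
    have h2 : 0 ≤ (q.ω₂ * ρ) ^ 2 / q.lmin := div_nonneg (sq_nonneg _) heq.lmin_pos.le
    linarith
  · refine (hI.later m' rfl).1.trans
      (mul_le_of_le_one_left (energyBound_nonneg heq k) (pow_le_one₀ (sq_nonneg _) ?_))
    exact pow_le_one₀ (hconv.ϑ_pos heq.lmin_pos heq.lmin_le).le
      (hconv.ϑ_lt_one heq.lmin_pos heq.lmin_le).le

/-- The error at the end of an inner loop. -/
theorem IterateBounds.norm_error_finished (hconv : q.Convergence)
    (heq : P.Equation q.lmin q.lmax) {k m : ℕ} {Λ : Fin d → Finset J}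
    {u u' r : L2 (MIdx d J)} {ρ : ℝ} (hI : IterateBounds P q k m Λ u ρ)
    (solve : IsPCG P.Aδ P.fδ u (box Λ) (q.ω₂ * ρ) u') (estimate : P.IsRES q.cRes q.ω₁ u' r)
    (finished : (1 + q.ω₁) * ‖r‖ ≤ q.ω₃ * q.ω₀k k ∨ m = q.M) :
    ‖P.uδ - u'‖ ≤ 9 / 5 * q.ω₃ * (q.lmin⁻¹ * q.ω₀k k) := by
  have hl := heq.lmin_pos
  have hx := hconv.ω₀k_pos k
  have hω₃ := hconv.ω₃_pos
  -- Either the residual test bounds the error through `lmin`, or `M` reductions by `ϑ` have been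
  -- carried out after the first solve.
  rcases finished with h | rfl
  · have h1 := heq.spectralBounds.lmin_mul_norm_le (P.uδ - u')
    rw [heq.apply_sub] at h1
    have h2 := norm_add_le (P.fδ - P.Aδ u' - r) r
    rw [sub_add_cancel] at h2
    have h3 := estimate.norm_le
    have h4 : q.lmin * ‖P.uδ - u'‖ ≤ q.ω₃ * q.ω₀k k := by linarith
    have h5 : ‖P.uδ - u'‖ ≤ q.ω₃ * (q.lmin⁻¹ * q.ω₀k k) := by
      rw [mul_comm] at h4
      rw [← le_div_iff₀ hl] at h4
      exact h4.trans (le_of_eq (by ring))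
    have h6 : 0 ≤ q.ω₃ * (q.lmin⁻¹ * q.ω₀k k) := by positivity
    linarith
  · exact norm_le_of_energy_le hconv heq hω₃.le ((hI.energy_solve hconv heq solve).trans
      (mul_le_mul_of_nonneg_right (hconv.ϑ_pow_le heq.lmin_pos heq.lmin_le)
        (energyBound_nonneg heq k)))

/-- The convergence bounds hold for all iterates. -/
theorem iterateBounds_of_reach (hconv : q.Convergence) (heq : P.Equation q.lmin q.lmax)
    (hω₀ : ‖P.fδ‖ ≤ q.ω₀) (hω : 3 * q.ω₃ ≤ q.ω₄ + q.ω₅) {ε : ℝ} {k m : ℕ}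
    {Λ : Fin d → Finset J} {u : L2 (MIdx d J)} {ρ : ℝ} (h : Reach P q ε k m Λ u ρ) :
    IterateBounds P q k m Λ u ρ := by
  classical
  have hl := heq.lmin_pos
  have hspec := heq.spectralBounds
  have hκ := Params.one_le_κ heq.lmin_pos heq.lmin_le
  have hω₁ := hconv.ω₁_lt_one
  -- Hence the loss of the first solve after a coarsening is at most the energy present at that
  -- point.
  have hloss : (q.ω₂ / (1 - q.ω₁)) ^ 2 * q.κ ≤ 1 :=
    ((hconv.tol_sq_lt heq.lmin_pos heq.lmin_le).trans
      (hconv.bulk_sq_lt heq.lmin_pos heq.lmin_le)).le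
  induction h with
  | init =>
    refine ⟨suppIn_zero _, Nat.zero_le _, fun _ => ?_, fun m' h => absurd h (by omega)⟩
    have h1 := hspec.energy_le_norm_apply_sq P.uδ
    rw [heq.solution] at h1
    have h2 := pow_le_pow_left₀ (norm_nonneg _) hω₀ 2
    have hω₂ : q.ω₂ ≤ 1 := by
      have h3 := (hconv.tol_quotient).2
      have h4 := hconv.bulk_quotient
      have h5 : q.κ⁻¹ ≤ 1 := inv_le_one_of_one_le₀ hκ
      have h6 : q.ω₂ / (1 - q.ω₁) < 1 :=
        h3.trans_le ((mul_le_of_le_one_right h4.1.le h5).trans h4.2.le)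
      rw [div_lt_one (by linarith)] at h6
      linarith [hconv.ω₁_pos]
    have h3 : (q.ω₂ * q.ω₀) ^ 2 ≤ q.ω₀ ^ 2 := by
      rw [mul_pow]
      exact mul_le_of_le_one_left (sq_nonneg _) (pow_le_one₀ hconv.ω₂_pos.le hω₂)
    rw [sub_zero]
    have h4 : inner ℝ P.uδ (P.Aδ P.uδ) ≤ q.ω₀ ^ 2 / q.lmin := by
      rw [heq.solution, le_div_iff₀ hl]
      linarith
    have h5 : (q.ω₂ * q.ω₀) ^ 2 / q.lmin ≤ q.ω₀ ^ 2 / q.lmin :=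
      div_le_div_of_nonneg_right h3 hl.le
    have h6 : energyBound q 0 = 81 / 25 * q.κ * (q.ω₀ ^ 2 / q.lmin) := by
      simp only [energyBound, Params.ω₀k, pow_zero, one_mul]
      ring
    have h7 : 0 ≤ q.ω₀ ^ 2 / q.lmin := by positivity
    rw [h6]
    nlinarith
  | @inner k m Λ Λ' u u' r ρ prev solve estimate not_done not_small not_last expand ih =>
    have hM := ih.le_M
    obtain ⟨Γ, ⟨htail, -⟩, hΛ'⟩ := expand
    have hΛ : box Λ ⊆ box Λ' := fun l hl j => by
      rw [hΛ' j]; exact Finset.mem_union_left _ (hl j)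
    have hΓ : box Γ ⊆ box Λ' := fun l hl j => by
      rw [hΛ' j]; exact Finset.mem_union_right _ (hl j)
    refine ⟨(solve.suppIn ih.suppIn).mono hΛ, by omega, fun h => absurd h (by omega), ?_⟩
    intro m' hm'
    obtain rfl : m = m' := by omega
    refine ⟨ih.energy_solve hconv heq solve, r, rfl, ?_, ?_⟩
    · rw [heq.apply_sub]
      exact estimate.norm_le
    -- The discarded part of `r` is at most `√(1 - bulk²) ‖r‖`, so by Pythagoras the captured part
    -- is at least `bulk ‖r‖`.
    · refine le_trans ?_ (norm_restr_mono hΓ r)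
      refine le_of_sq_le_sq ?_ (norm_nonneg _)
      have h1 := pow_le_pow_left₀ (norm_nonneg _) ((norm_sub_restr_box_le r Γ).trans htail) 2
      have hb : q.bulk ^ 2 ≤ 1 :=
        pow_le_one₀ (hconv.ω₁_pos.trans hconv.ω₁_lt).le hconv.bulk_lt.le
      rw [mul_pow, Real.sq_sqrt (by linarith)] at h1
      have h2 := norm_sq_restr_add (box Γ) r
      rw [mul_pow]
      linarith
  | @outer k m Λ Λ' u u' r w v r' ρ prev solve estimate not_done finished trunc coarse supp
      estimate' ih =>
    have hx := hconv.ω₀k_pos k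
    refine ⟨fun l hl => ?_, Nat.zero_le _, fun _ => ?_, fun m' h => absurd h (by omega)⟩
    · by_contra hv
      refine hl fun j => ?_
      have : l j ∈ (Λ' j : Set J) := by
        rw [supp j]
        exact (contraction_ne_zero_iff j v (l j)).2 ⟨l, rfl, hv⟩
      simpa using this
    · have h1 := ih.norm_error_finished hconv heq solve estimate finished
      obtain ⟨-, -, -, h2⟩ := trunc
      obtain ⟨Γ, ⟨h3, -⟩, rfl⟩ := coarse
      have h4 := (norm_sub_restr_box_le w Γ).trans h3
      set e := P.uδ - restr (box Γ) w with he
      have h5 : e = (P.uδ - u') + (u' - w) + (w - restr (box Γ) w) := by rw [he]; abel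
      -- `9/5 ω₃ + ω₄ + ω₅ ≤ 6/5 (ω₃ + ω₄ + ω₅)` is equivalent to `3 ω₃ ≤ ω₄ + ω₅`.
      have h6 : ‖e‖ ≤ 6 / 5 * (q.lmin⁻¹ * q.ω₀k (k + 1)) := by
        rw [h5]
        refine (norm_add₃_le).trans ?_
        rw [Params.ω₀k_succ]
        have h7 : 0 < q.lmin⁻¹ * q.ω₀k k := by positivity
        nlinarith
      have h7 : (1 - q.ω₁) * ‖r'‖ ≤ ‖P.Aδ e‖ := by
        have h8 := estimate'.norm_le
        rw [← heq.apply_sub] at h8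
        have h9 := norm_sub_norm_le r' (P.Aδ e)
        rw [norm_sub_rev] at h9
        linarith
      have h8 := pow_le_pow_left₀ (mul_nonneg (by linarith) (norm_nonneg _)) h7 2
      have h9 := h8.trans (hspec.norm_apply_sq_le e)
      rw [mul_pow] at h9
      set N := inner ℝ e (P.Aδ e) with hN
      have hN0 : 0 ≤ N := hspec.energy_nonneg e
      have h10 : (q.ω₂ * ‖r'‖) ^ 2 / q.lmin ≤ N := by
        have hp : 0 < 1 - q.ω₁ := by linarith
        calc (q.ω₂ * ‖r'‖) ^ 2 / q.lmin
            = q.ω₂ ^ 2 / (1 - q.ω₁) ^ 2 / q.lmin * ((1 - q.ω₁) ^ 2 * ‖r'‖ ^ 2) := by field_simp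
          _ ≤ q.ω₂ ^ 2 / (1 - q.ω₁) ^ 2 / q.lmin * (q.lmax * N) :=
            mul_le_mul_of_nonneg_left h9 (by positivity)
          _ = (q.ω₂ / (1 - q.ω₁)) ^ 2 * q.κ * N := by rw [Params.κ]; field_simp
          _ ≤ N := mul_le_of_le_one_left hN0 hloss
      have h11 : N ≤ q.lmax * (6 / 5 * (q.lmin⁻¹ * q.ω₀k (k + 1))) ^ 2 :=
        (heq.upper e).trans (mul_le_mul_of_nonneg_left
          (pow_le_pow_left₀ (norm_nonneg _) h6 2) hspec.lmax_pos.le)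
      -- `9/4 · (6/5)² = 81/25`. The energy and the loss together need only the factor 2.
      have h12 : energyBound q (k + 1) =
          9 / 4 * (q.lmax * (6 / 5 * (q.lmin⁻¹ * q.ω₀k (k + 1))) ^ 2) := by
        rw [energyBound, Params.κ]
        field_simp
        ring
      rw [h12]
      linarith

end Convergence

/-! ### Sizes of the index sets -/

section Sizes

variable {d R : ℕ} {J : Type*} {P : Problem d R J} {q : Params d J} {s : ℝ}

/-- Truncation and coarsening of a tensor close to the sparse tensor `u` gives small supports. -/
theorem exists_coarse_size_bound {u : L2 (MIdx d J)} (hs : 0 < s)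
    (hu : ∀ j, asNorm s (contraction j u) < ⊤) (hd : 0 < d) {t : DimTree d} (ht : t.IsDimTree)
    {K a b : ℝ} (hK : 0 ≤ K) (ha : 0 ≤ a) (hab : √d * a < b) :
    ∃ C : ℝ, 0 < C ∧ ∀ (x ε : ℝ) (u' w v : L2 (MIdx d J)) (Λ : Fin d → Finset J), 0 < x →
      ‖u - u'‖ ≤ a * x → IsTrunc t u' ε w → IsCoarse K w (b * x) v →
      (∀ j, (Λ j : Set J) = Function.support (contraction j v)) →
      ∑ j, ((Λ j).card : ℝ) ≤ C * x ^ (-1 / s) := by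
  classical
  have hsd : 0 < √(d : ℝ) := Real.sqrt_pos.2 (by exact_mod_cast hd)
  choose c hc H using fun j => exists_card_le_of_asNorm_lt_top hs (hu j)
  -- Chosen so that `√d (θ + a) = b`: it is the accuracy left for approximating `u` after the error
  -- of `u'` is accounted for.
  set θ := (b - √d * a) / √d with hθ
  have hθ0 : 0 < θ := div_pos (by linarith) hsd
  have hC0 : 0 ≤ ∑ j, (c j / θ) ^ (1 / s) := Finset.sum_nonneg fun j _ => by
    have := hc j
    positivity
  refine ⟨K * (∑ j, (c j / θ) ^ (1 / s)) + 1, by positivity, ?_⟩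
  intro x ε u' w v Λ hx herr htr hco hΛ
  have hX0 : 0 < x ^ (-1 / s) := Real.rpow_pos_of_pos hx _
  obtain ⟨Γ, ⟨-, hmin⟩, rfl⟩ := hco
  choose F hF hFcard using fun j => H j (θ * x) (by positivity)
  have hsub : ∀ j, Λ j ⊆ Γ j := by
    intro j y hy
    have hy' : y ∈ (Λ j : Set J) := hy
    rw [hΛ j] at hy'
    obtain ⟨l, rfl, hl⟩ := (contraction_ne_zero_iff _ _ _).1 hy'
    by_contra hn
    exact hl (restr_of_notMem (fun h : l ∈ box Γ => hn (h j)) w)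
  -- The sets `F` come from `u`, yet serve `w`: tails do not grow from `u'` to `w`, whatever the
  -- truncation error.
  have htail : tail w F ≤ b * x := by
    have h1 : ∀ j, ‖restr {l : MIdx d J | l j ∉ F j} w‖ ≤ θ * x + a * x := by
      intro j
      refine (htr.norm_restr_le ht j {y | y ∉ F j}).trans ?_
      have h2 : restr {l : MIdx d J | l j ∉ F j} u' = restr {l : MIdx d J | l j ∉ F j} u -
          restr {l : MIdx d J | l j ∉ F j} (u - u') := by
        rw [restr_sub, sub_sub_cancel]
      change ‖restr {l : MIdx d J | l j ∉ F j} u'‖ ≤ _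
      rw [h2]
      refine (norm_sub_le _ _).trans (add_le_add ?_ ((norm_restr_le _ _).trans herr))
      rw [← norm_contraction_sub_restr]
      exact hF j
    refine (tail_le w F (by positivity) h1).trans (le_of_eq ?_)
    rw [hθ]
    field_simp
    ring
  have h1 : ∑ j, ((Λ j).card : ℝ) ≤ ∑ j, ((Γ j).card : ℝ) :=
    Finset.sum_le_sum fun j _ => by exact_mod_cast Finset.card_le_card (hsub j)
  have h2 : ∀ j, ((F j).card : ℝ) ≤ (c j / θ) ^ (1 / s) * x ^ (-1 / s) := by
    intro j
    have hcj := hc j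
    refine (hFcard j).trans (le_of_eq ?_)
    rw [neg_div, Real.rpow_neg hx.le, ← div_eq_mul_inv, ← Real.div_rpow (by positivity) hx.le,
      div_div]
  have h3 := mul_le_mul_of_nonneg_left (Finset.sum_le_sum fun j (_ : j ∈ Finset.univ) => h2 j) hK
  rw [← Finset.sum_mul] at h3
  have h4 := hmin F htail
  linarith

/-- The total size of the index sets in terms of the tolerances of the outer iterations. -/
theorem exists_size_bound (hd : 0 < d) (hscal : P.ScalingValid) (hsep : P.Separable)
    (heq : P.Equation q.lmin q.lmax) (hs : 0 < s)
    (hscheme : ∀ n j, IsCompressionScheme s (P.compHat n j) (P.compressed n j))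
    (hrhs : P.RhsApproximable s) (hconv : q.Convergence) (hω₀ : ‖P.fδ‖ ≤ q.ω₀)
    (hω : 3 * q.ω₃ ≤ q.ω₄ + q.ω₅) (hω₅ : √d * (9 / 5 * q.ω₃) < q.ω₅)
    (hu : ∀ j, asNorm s (contraction j P.uδ) < ⊤) (n : ℕ) :
    ∃ C : ℝ, 0 < C ∧ ∀ (ε : ℝ) (k m : ℕ) (Λ : Fin d → Finset J) (u : L2 (MIdx d J)) (ρ : ℝ),
      Reach P q ε k m Λ u ρ → m ≤ n → ∑ j, ((Λ j).card : ℝ) ≤ C * q.ω₀k k ^ (-1 / s) := by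
  classical
  have hl := heq.lmin_pos
  have hω₃ := hconv.ω₃_pos
  have hω₁ := hconv.ω₁_pos
  have hκ := Params.one_le_κ heq.lmin_pos heq.lmin_le
  have hK : 0 ≤ q.K := zero_le_one.trans hconv.K_ge
  -- Induction on a bound for the inner index, uniformly in `k`. The constant grows with every
  -- expansion, which is harmless as the inner index never exceeds `M`.
  induction n with
  | zero =>
    have hab : √d * (9 / 5 * q.ω₃ * q.lmin⁻¹) < q.ω₅ * q.lmin⁻¹ := by
      rw [← mul_assoc]
      exact mul_lt_mul_of_pos_right hω₅ (inv_pos.2 hl)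
    obtain ⟨C, hC, H⟩ := exists_coarse_size_bound hs hu hd hconv.tree hK
      (a := 9 / 5 * q.ω₃ * q.lmin⁻¹) (by positivity) hab
    have hS : 0 ≤ ∑ j, ((q.Λ₀ j).card : ℝ) := Finset.sum_nonneg fun _ _ => Nat.cast_nonneg _
    have hSW : 0 ≤ (∑ j, ((q.Λ₀ j).card : ℝ)) * q.ω₀ ^ (1 / s) :=
      mul_nonneg hS (Real.rpow_nonneg hconv.ω₀_pos.le _)
    -- The second summand accounts for the arbitrary initial set, the only set with `m = 0` that is
    -- not a result of coarsening.
    refine ⟨C + (∑ j, ((q.Λ₀ j).card : ℝ)) * q.ω₀ ^ (1 / s), add_pos_of_pos_of_nonneg hC hSW, ?_⟩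
    intro ε k m Λ u ρ h hm
    have hx := hconv.ω₀k_pos k
    have hX0 : 0 < q.ω₀k k ^ (-1 / s) := Real.rpow_pos_of_pos hx _
    rw [add_mul]
    cases h with
    | init =>
      have h1 := rpow_inv_mul_rpow_neg_inv_ge_one hs hx (hconv.ω₀k_le 0)
      have h2 := le_mul_of_one_le_right hS h1
      rw [← mul_assoc] at h2
      have h3 : 0 ≤ C * q.ω₀k 0 ^ (-1 / s) := by positivity
      linarith
    | inner => exact absurd hm (by omega)
    | @outer k m Λ₁ _ u₁ u' r w _ r' ρ₁ prev solve estimate not_done finished trunc coarse supp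
        estimate' =>
      have hI := iterateBounds_of_reach hconv heq hω₀ hω prev
      have h1 := hI.norm_error_finished hconv heq solve estimate finished
      have hxk := hconv.ω₀k_pos k
      rw [← mul_assoc] at h1
      have h2 := H (q.ω₀k k) _ u' w u Λ hxk h1 trunc coarse supp
      have h3 := rpow_neg_inv_le (c := 1) hs one_pos hx
        ((one_mul _).le.trans (hconv.ω₀k_succ_le k))
      rw [Real.one_rpow, one_mul] at h3
      have h4 := mul_le_mul_of_nonneg_left h3 hC.le
      have h5 : 0 ≤ (∑ j, ((q.Λ₀ j).card : ℝ)) * q.ω₀ ^ (1 / s) * q.ω₀k (k + 1) ^ (-1 / s) :=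
        mul_nonneg hSW hX0.le
      linarith
  | succ n ih =>
    obtain ⟨C, hC, H⟩ := ih
    have hf := fun j => Problem.asNorm_rhs_lt_top hscal hsep heq hs hscheme hu j
    obtain ⟨C', hC', H'⟩ := Problem.exists_residual_support_bound (ω₁ := q.ω₁) (W := q.ω₀)
      (C₂ := 9 / 5 * q.κ * q.lmin⁻¹) (c₃ := q.ω₃ / (1 + q.ω₁)) hscal hsep hs hscheme hrhs hu hf
      hconv.cRes_pos hC (by positivity) (by positivity) hconv.ω₀_pos
    refine ⟨C + q.K * C', by positivity, ?_⟩
    intro ε k m Λ u ρ h hm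
    have hx := hconv.ω₀k_pos k
    have hX0 : 0 < q.ω₀k k ^ (-1 / s) := Real.rpow_pos_of_pos hx _
    have hX1 : 0 ≤ q.K * C' * q.ω₀k k ^ (-1 / s) := by positivity
    rw [add_mul]
    rcases Nat.lt_or_ge n m with hlt | hle
    swap
    · have := H ε k m Λ u ρ h hle
      linarith
    cases h with
    | init => exact absurd hlt (by omega)
    | outer => exact absurd hlt (by omega)
    | @inner _ m Λ₁ _ u₁ _ r ρ₁ prev solve estimate not_done not_small not_last expand =>
      have hI := iterateBounds_of_reach hconv heq hω₀ hω prev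
      have h1 := H ε k m Λ₁ u₁ ρ₁ prev (by omega)
      have hen := norm_error_le hconv heq (hI.energy_solve_le hconv heq solve)
      -- That the inner loop continued bounds the residual from below, so its tolerance is not much
      -- smaller than `ω₀k k`.
      have hr : q.ω₃ / (1 + q.ω₁) * q.ω₀k k ≤ ‖r‖ := by
        rw [div_mul_eq_mul_div, div_le_iff₀ (by linarith)]
        linarith
      obtain ⟨G, hG, hGcard⟩ := H' _ hx (hconv.ω₀k_le k) Λ₁ u r (solve.suppIn hI.suppIn) h1 hen
        estimate hr
      obtain ⟨Γ, ⟨-, hmin⟩, hΛ⟩ := expand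
      -- `G` covers the whole support of `r`, so its tail is zero and it competes with the coarse
      -- set at any tolerance.
      have h2 := hmin G ((tail_eq_zero hG).le.trans (by positivity))
      have h3 : ∑ j, ((Λ j).card : ℝ) ≤ ∑ j, ((Λ₁ j).card : ℝ) + ∑ j, ((Γ j).card : ℝ) := by
        rw [← Finset.sum_add_distrib]
        refine Finset.sum_le_sum fun j _ => ?_
        rw [hΛ j]
        exact_mod_cast Finset.card_union_le _ _
      have h4 := mul_le_mul_of_nonneg_left hGcard hK
      linarith

/-- If the solution vanishes, the algorithm stops at once. -/
theorem eq_zero_of_reach_of_solution_eq_zero (heq : P.Equation q.lmin q.lmax)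
    (hconv : q.Convergence) (h0 : P.uδ = 0) {ε : ℝ} (hε : 0 < ε) {k m : ℕ}
    {Λ : Fin d → Finset J} {u : L2 (MIdx d J)} {ρ : ℝ} (h : Reach P q ε k m Λ u ρ) :
    u = 0 ∧ 0 ≤ ρ := by
  have hf : P.fδ = 0 := by rw [← heq.solution, h0, map_zero]
  have hω₁ := hconv.ω₁_lt_one
  have key : ∀ {Λ : Fin d → Finset J} {u u' r : L2 (MIdx d J)} {ρ : ℝ}, u = 0 ∧ 0 ≤ ρ →
      IsPCG P.Aδ P.fδ u (box Λ) (q.ω₂ * ρ) u' → P.IsRES q.cRes q.ω₁ u' r →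
      ¬ ε < (1 + q.ω₁) * ‖r‖ := by
    rintro Λ u u' r ρ ⟨rfl, hρ⟩ solve estimate hlt
    have h1 : u' = 0 := solve.eq_of_residual_le (by
      rw [hf, map_zero, sub_zero]
      refine (norm_restr_le _ _).trans ?_
      rw [norm_zero]
      exact mul_nonneg hconv.ω₂_pos.le hρ)
    have h2 := estimate.norm_le
    rw [h1, hf, map_zero, sub_zero, zero_sub, norm_neg] at h2
    -- The exact residual is zero, so the relative accuracy gives `‖r‖ ≤ ω₁ ‖r‖` with `ω₁ < 1`.
    have h3 : ‖r‖ = 0 := by nlinarith [norm_nonneg r]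
    rw [h3, mul_zero] at hlt
    linarith
  induction h with
  | init => exact ⟨rfl, hconv.ω₀_pos.le⟩
  | inner prev solve estimate not_done _ _ _ ih => exact absurd not_done (key ih solve estimate)
  | outer prev solve estimate not_done _ _ _ _ _ ih =>
    exact absurd not_done (key ih solve estimate)

end Sizes

end HTAWGM

end

/-! ### The main theorem. -/

open HTAWGM in
theorem proposition4 {d R : ℕ} {J : Type*} (hd : 2 ≤ d)
    (P : Problem d R J) (q : Params d J) (s sstar : ℝ) (γ : ℕ → ℝ)
    -- the preconditioned operator equation
    (hscal : P.ScalingValid) (hsep : P.Separable) (heq : P.Equation q.lmin q.lmax)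
    -- compressibility of the one-dimensional components, and the compression that is used
    (hs : 0 < s) (hs' : s < sstar)
    (hcompress : ∀ n j, IsCompressible sstar (P.compHat n j))
    (hscheme : ∀ n j, IsCompressionScheme s (P.compHat n j) (P.compressed n j))
    -- approximability of the right-hand side
    (hrhs : P.RhsApproximable s)
    -- parameters of the algorithm
    (hconv : q.Convergence) (hω₀ : ‖P.fδ‖ ≤ q.ω₀)
    (hω₄ : √(2 * d - 3) * q.ω₃ < q.ω₄) (hω₅ : √d * (1 + √(2 * d - 3)) * q.ω₃ < q.ω₅)
    -- approximability of the solution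
    (hγ0 : γ 0 = 1) (hγpos : ∀ n, 0 < γ n) (hγmono : StrictMono γ)
    (hγadm : BddAbove (Set.range fun n => γ (n + 1) / γ n))
    (hurank : MemRankClass q.tree γ P.uδ)
    (husparse : ∀ j, asNorm s (contraction j P.uδ) < ⊤) :
    ∃ C : ℝ, 0 < C ∧
      ∀ (ε : ℝ), 0 < ε → ∀ (k m : ℕ) (Λ : Fin d → Finset J) (u : L2 (MIdx d J)) (ρ : ℝ),
        Reach P q ε k m Λ u ρ → u ≠ P.uδ →
          ∑ j, ((Λ j).card : ℝ) ≤
            C * ‖P.uδ - u‖ ^ (-1 / s) *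
              (∑ j, (asNorm s (contraction j P.uδ)).toReal) ^ (1 / s) := by
  have hd' : (2 : ℝ) ≤ d := by exact_mod_cast hd
  have hω₃ := hconv.ω₃_pos
  have hκ := Params.one_le_κ heq.lmin_pos heq.lmin_le
  have hl := heq.lmin_pos
  set S := ∑ j, (asNorm s (contraction j P.uδ)).toReal with hS
  have hS0 : 0 ≤ S := Finset.sum_nonneg fun _ _ => ENNReal.toReal_nonneg
  rcases hS0.eq_or_lt with hS0 | hSpos
  · refine ⟨1, one_pos, fun ε hε k m Λ u ρ hreach hne => absurd ?_ hne⟩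
    have hj : asNorm s (contraction (⟨0, by omega⟩ : Fin d) P.uδ) = 0 := by
      have := (Finset.sum_eq_zero_iff_of_nonneg fun _ _ => ENNReal.toReal_nonneg).1
        (hS ▸ hS0.symm) (⟨0, by omega⟩ : Fin d) (Finset.mem_univ _)
      exact ((ENNReal.toReal_eq_zero_iff _).1 this).resolve_right (husparse _).ne
    have h0 : P.uδ = 0 := by
      rw [← norm_eq_zero, ← norm_contraction (⟨0, by omega⟩ : Fin d),
        eq_zero_of_asNorm_eq_zero hs hj, norm_zero]
    rw [h0]
    exact (eq_zero_of_reach_of_solution_eq_zero heq hconv h0 hε hreach).1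
  · have hr1 : 1 ≤ √(2 * (d : ℝ) - 3) := Real.one_le_sqrt.2 (by linarith)
    have hr2 : 1 ≤ √(d : ℝ) := Real.one_le_sqrt.2 (by linarith)
    -- From `√(2d-3) ≥ 1`. The slack between `2` and `9/5` absorbs the enlarged constant in the
    -- error at the end of the inner loops.
    have h1 : √d * (2 * q.ω₃) < q.ω₅ := by
      refine lt_of_le_of_lt ?_ hω₅
      rw [mul_assoc]
      exact mul_le_mul_of_nonneg_left (mul_le_mul_of_nonneg_right (by linarith) hω₃.le)
        (by linarith)
    have h2 : 3 * q.ω₃ ≤ q.ω₄ + q.ω₅ := by nlinarith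
    have h3 : √d * (9 / 5 * q.ω₃) < q.ω₅ :=
      (mul_le_mul_of_nonneg_left (by linarith) (by linarith)).trans_lt h1
    obtain ⟨C, hC, H⟩ := exists_size_bound (by omega) hscal hsep heq hs hscheme hrhs hconv hω₀ h2 h3
      husparse q.M
    set c := (9 / 5 * q.κ * q.lmin⁻¹)⁻¹ with hc
    have hc0 : 0 < c := by positivity
    have hSs : 0 < S ^ (1 / s) := Real.rpow_pos_of_pos hSpos _
    -- `c` converts `ω₀k k` into the actual error, and the fixed positive number `S^{1/s}` is
    -- divided out to match the stated form.
    refine ⟨C * c ^ (-1 / s) / S ^ (1 / s), by positivity, ?_⟩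
    intro ε hε k m Λ u ρ hreach hne
    have hI := iterateBounds_of_reach hconv heq hω₀ h2 hreach
    have hx := hconv.ω₀k_pos k
    have he : 0 < ‖P.uδ - u‖ := norm_pos_iff.2 (sub_ne_zero.2 hne.symm)
    have h4 := norm_error_le hconv heq (hI.energy_le hconv heq)
    have h5 : c * ‖P.uδ - u‖ ≤ q.ω₀k k := by
      rw [hc, inv_mul_le_iff₀ (by positivity)]
      exact h4
    have h6 := mul_le_mul_of_nonneg_left (rpow_neg_inv_le hs hc0 he h5) hC.le
    refine (H ε k m Λ u ρ hreach hI.le_M).trans (h6.trans (le_of_eq ?_))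
    field_simp
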